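/- Let $G_{\mathbb R}$ be a connected semisimple linear Lie group with Lie algebra $\mathfrak g_{\mathbb R}$, let $G$ be its (connected) complexification, with Lie algebra $\mathfrak g=\mathfrak g_{\mathbb R}\oplus i\mathfrak g_{\mathbb R}$, let $\mathfrak g_{\mathbb R}=\mathfrak k_{\mathbb R}\oplus\mathfrak p_{\mathbb R}$ be a Cartan decomposition, and let $\mathfrak u_{\mathbb R}=\mathfrak k_{\mathbb R}\oplus i\mathfrak p_{\mathbb R}$ be the Lie algebra of the corresponding compact form $U_{\mathbb R}$ of $G$. Let $X$ be the flag variety of $G$, i.e. the variety of Borel subalgebras $\mathfrak b_x$ of $\mathfrak g$, with $T_xX\cong\mathfrak g/\mathfrak b_x$, where $u\in\mathfrak g$ gives the tangent vector $u_x=\frac{d}{ds}\big|_{s=0}\exp(su)\cdot x$. Let $\mathfrak h\cong\mathfrak b_x/[\mathfrak b_x,\mathfrak b_x]$ be the universal Cartan algebra, the same for all $x\in X$ by $G$-equivariance, and let $\lambda\in\mathfrak h^*$ be regular, i.e. nonzero on all coroots. For $x\in X$ let $\mathfrak t_{\mathbb R}=\mathfrak u_{\mathbb R}\cap\mathfrak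 b_x$ be the Cartan subalgebra of $\mathfrak u_{\mathbb R}$ that fixes $x$, and let $\lambda_x\in\mathfrak g^*$ be the complex linear function that equals $\lambda$ on $\mathfrak t_{\mathbb R}$ (via $\mathfrak t_{\mathbb R}\to\mathfrak b_x/[\mathfrak b_x,\mathfrak b_x]\cong\mathfrak h$) and vanishes on $[\mathfrak t_{\mathbb R},\mathfrak u_{\mathbb R}]$; recall $\mathfrak u_{\mathbb R}=\mathfrak t_{\mathbb R}\oplus[\mathfrak t_{\mathbb R},\mathfrak u_{\mathbb R}]$. Let $m_\lambda:X\to\mathfrak g^*$, $m_\lambda(x)=\lambda_x$. Let $\pi:T^*X\to X$ be the cotangent bundle, with fibres $T_x^*X\cong(\mathfrak g/\mathfrak b_x)^*$, let $\mu:T^*X\to\mathfrak g^*$ be the moment map, given on fibres by the inclusion $(\mathfrak g/\mathfrak b_x)^*\to\mathfrak g^*$, and let $\mu_\lambda=\mu+m_\lambda\circ\pi$ be the twisted moment map. Let $\Omega_\lambda\subset\mathfrak g^*$ be the coadjoint $G$-orbit of $\lambda_x$ (the same for all $x$), with its Kirillov–Kostant form $\sigma_\lambda$, $$\sigma_\lambda|_\zeta(\mathrm{ad}^*_u\zeta,\mathrm{ad}^*_v\zeta)=\zeta([u,v])\qquad(\zeta\in\Omega_\lambda,\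 u,v\in\mathfrak g),\qquad (\mathrm{ad}^*_u\zeta)(y)=-\zeta([u,y]).$$ Let $\sigma=d\theta$ be the canonical (holomorphic) symplectic form on $T^*X$, where $\theta_{(x,\xi)}(V)=\langle\xi,d\pi(V)\rangle$. Lemma. The twisted moment map $\mu_\lambda$ maps $T^*X$ into $\Omega_\lambda$, and $$\mu_\lambda^*\sigma_\lambda=-\sigma+\pi^*\tau_\lambda$$ as complex-valued 2-forms on $T^*X$, where $\tau_\lambda$ is the 2-form on $X$ with $\tau_\lambda(u_x,v_x)=\lambda_x([u,v])$ for $x\in X$ and $u,v\in\mathfrak u_{\mathbb R}$. -/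

import Mathlib

open scoped ContDiff Topology

attribute [local instance 100] LieRing.ofAssociativeRing

noncomputable section

namespace TwistedMoment

/-! ### The group `G` and its Lie algebra `𝔤` -/

/-- Complex `N × N` matrices, with the commutator bracket. -/
abbrev Mat (N : ℕ) := Matrix (Fin N) (Fin N) ℂ

/-- The complex Lie algebra of matrices generated by a real Lie algebra `𝔤_ℝ` of matrices.
If `𝔤_ℝ ∩ i 𝔤_ℝ = 0`, then `𝔤 = 𝔤_ℝ ⊕ i 𝔤_ℝ` is the complexification of `𝔤_ℝ`. -/
abbrev complexified {N : ℕ} (gR : LieSubalgebra ℝ (Mat N)) : LieSubalgebra ℂ (Mat N) :=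
  LieSubalgebra.lieSpan ℂ (Mat N) (gR : Set (Mat N))

/-- The complexification `G` of the linear group `G_ℝ`: the connected subgroup of `GL(N, ℂ)` with
Lie algebra `𝔤`, i.e. the subgroup generated by `exp 𝔤`. -/
def complexGroup {N : ℕ} (gR : LieSubalgebra ℝ (Mat N)) : Subgroup (Mat N)ˣ :=
  Subgroup.closure {k | ∃ x ∈ complexified gR, (k : Mat N) = NormedSpace.exp x}

theorem exp_conj_mem_aux {A : Type*} [NormedRing A] [NormedAlgebra ℂ A] [CompleteSpace A]
    (g : Submodule ℂ A) (hcl : IsClosed (g : Set A)) {x y : A}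
    (hx : ∀ z ∈ g, x * z - z * x ∈ g) (hy : y ∈ g) :
    NormedSpace.exp x * y * NormedSpace.exp (-x) ∈ g := by
  let L : A →L[ℂ] A := (ContinuousLinearMap.mul ℂ A) x
  let R : A →L[ℂ] A := (ContinuousLinearMap.mul ℂ A).flip (-x)
  have hLz : ∀ z, L z = x * z := fun z => rfl
  have hRz : ∀ z, R z = z * (-x) := fun z => rfl
  clear_value L R
  have hLR : Commute L R := by
    ext1 z
    simp [hLz, hRz, mul_assoc]
  have hL : ∀ z n, (L ^ n) z = x ^ n * z := by
    intro z n
    induction n generalizing z with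
    | zero => simp
    | succ n ih =>
      rw [pow_succ, pow_succ, mul_apply_eq_comp, ih, hLz, mul_assoc]
  have hR : ∀ z n, (R ^ n) z = z * (-x) ^ n := by
    intro z n
    induction n generalizing z with
    | zero => simp
    | succ n ih =>
      rw [pow_succ, pow_succ', mul_apply_eq_comp, ih, hRz, mul_assoc]
  have hev : ∀ (T : A →L[ℂ] A) (z : A),
      HasSum (fun n : ℕ => ((n.factorial : ℂ)⁻¹) • (T ^ n) z) (NormedSpace.exp T z) := by
    intro T z
    have h := NormedSpace.exp_series_hasSum_exp' (𝕂 := ℂ) T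
    simpa using h.mapL (ContinuousLinearMap.apply ℂ A z)
  have eL : ∀ z, NormedSpace.exp L z = NormedSpace.exp x * z := by
    intro z
    have h := (NormedSpace.exp_series_hasSum_exp' (𝕂 := ℂ) x).mul_right z
    refine (hev L z).unique ?_
    simpa [hL] using h
  have eR : ∀ z, NormedSpace.exp R z = z * NormedSpace.exp (-x) := by
    intro z
    have h := (NormedSpace.exp_series_hasSum_exp' (𝕂 := ℂ) (-x)).mul_left z
    refine (hev R z).unique ?_
    simpa only [hR, Algebra.mul_smul_comm] using h
  have e : NormedSpace.exp (L + R) y = NormedSpace.exp x * y * NormedSpace.exp (-x) := by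
    let _ : NormedAlgebra ℚ (A →L[ℂ] A) := NormedAlgebra.restrictScalars ℚ ℂ (A →L[ℂ] A)
    rw [NormedSpace.exp_add_of_commute hLR, mul_apply_eq_comp, eR, eL,
      mul_assoc]
  rw [← e]
  have hp : ∀ n, ((L + R) ^ n) y ∈ g := by
    intro n
    induction n with
    | zero => simpa using hy
    | succ n ih =>
      rw [pow_succ', mul_apply_eq_comp]
      have h := hx _ ih
      simpa [hLz, hRz, sub_eq_add_neg] using h
  refine hcl.mem_of_tendsto (hev (L + R) y) (Filter.Eventually.of_forall fun s => ?_)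
  exact g.sum_mem fun n _ => g.smul_mem _ (hp n)

section

attribute [local instance] Matrix.linftyOpNormedRing Matrix.linftyOpNormedAlgebra

theorem exp_conj_mem {N : ℕ} (g : LieSubalgebra ℂ (Mat N)) {x y : Mat N}
    (hx : x ∈ g) (hy : y ∈ g) :
    NormedSpace.exp x * y * NormedSpace.exp (-x) ∈ g :=
  exp_conj_mem_aux g.toSubmodule g.toSubmodule.closed_of_finiteDimensional
    (fun _ hz => g.lie_mem hx hz) hy

theorem exp_inv {N : ℕ} {k : (Mat N)ˣ} {x : Mat N} (h : (k : Mat N) = NormedSpace.exp x) :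
    ((k⁻¹ : (Mat N)ˣ) : Mat N) = NormedSpace.exp (-x) := by
  rw [Matrix.coe_units_inv, h, Matrix.exp_neg]

end

section

variable {N : ℕ} {gR : LieSubalgebra ℝ (Mat N)}

theorem conj_mem {k : (Mat N)ˣ} (hk : k ∈ complexGroup gR) :
    ∀ y ∈ complexified gR, (k : Mat N) * y * ((k⁻¹ : (Mat N)ˣ) : Mat N) ∈ complexified gR ∧
      ((k⁻¹ : (Mat N)ˣ) : Mat N) * y * (k : Mat N) ∈ complexified gR := by
  induction hk using Subgroup.closure_induction with
  | mem k h =>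
    obtain ⟨x, hx, e⟩ := h
    intro y hy
    rw [exp_inv e, e]
    refine ⟨exp_conj_mem _ hx hy, ?_⟩
    simpa using exp_conj_mem _ (neg_mem hx) hy
  | one => intro y hy; simpa using hy
  | mul a b _ _ ha hb =>
    intro y hy
    refine ⟨?_, ?_⟩
    · simpa [mul_assoc] using (ha _ (hb _ hy).1).1
    · simpa [mul_assoc] using (hb _ (ha _ hy).2).2
  | inv a _ ha =>
    intro y hy
    simpa using (ha y hy).symm

/-- The adjoint action of `G` on `𝔤`: `Ad k y = k y k⁻¹`. -/
def Ad (k : complexGroup gR) : complexified gR →ₗ⁅ℂ⁆ complexified gR where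
  toFun y := ⟨(k : (Mat N)ˣ) * (y : Mat N) * ((k : (Mat N)ˣ)⁻¹ : (Mat N)ˣ),
    (conj_mem k.2 y y.2).1⟩
  map_add' x y := by ext1; simp [mul_add, add_mul]
  map_smul' c x := by ext1; simp
  map_lie' {x y} := by
    ext1
    simp [Ring.lie_def, mul_sub, sub_mul, mul_assoc]

/-- The coadjoint action of `G` on `𝔤*`: `(Ad* k ζ)(y) = ζ (Ad k⁻¹ y)`. -/
def coAd (k : complexGroup gR) (ζ : Module.Dual ℂ (complexified gR)) :
    Module.Dual ℂ (complexified gR) :=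
  ζ ∘ₗ (Ad k⁻¹ : complexified gR →ₗ[ℂ] complexified gR)

end

/-! ### The flag variety, its cotangent bundle, smooth maps and tangent vectors -/

section

variable {N : ℕ} (gR : LieSubalgebra ℝ (Mat N))

/-- The flag variety `X` of `G`: the set of all Borel (i.e. maximal solvable) subalgebras of `𝔤`. -/
def FlagVariety : Type :=
  {b : LieSubalgebra ℂ (complexified gR) //
    Maximal (fun b : LieSubalgebra ℂ (complexified gR) => LieAlgebra.IsSolvable b) b}

variable {gR}

/-- The Borel subalgebra `𝔟_x` fixing `x`. -/
def FlagVariety.borel (x : FlagVariety gR) : LieSubalgebra ℂ (complexified gR) := x.1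

/-- The tangent space `T_x X`, identified with `𝔤 / 𝔟_x`: the class of `u` is the tangent vector
`u_x`, the velocity at `0` of `s ↦ exp(s u) · x`. -/
abbrev FlagVariety.Tangent (x : FlagVariety gR) : Type :=
  (complexified gR) ⧸ x.borel.toSubmodule

/-- The tangent vector `u_x` given by `u ∈ 𝔤`. -/
def FlagVariety.vec (x : FlagVariety gR) (u : complexified gR) : x.Tangent :=
  x.borel.toSubmodule.mkQ u

variable (gR) in
/-- The cotangent bundle `T*X`; the fibre is `T*_x X = (𝔤 / 𝔟_x)*`. -/
structure CotangentBundle : Type where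
  /-- the projection `π : T*X → X` -/
  proj : FlagVariety gR
  /-- the covector -/
  covec : Module.Dual ℂ proj.Tangent

/-- The moment map `μ : T*X → 𝔤*`: on fibres, the inclusion `(𝔤 / 𝔟_x)* → 𝔤*`. -/
def moment (p : CotangentBundle gR) : Module.Dual ℂ (complexified gR) :=
  p.covec ∘ₗ p.proj.borel.toSubmodule.mkQ

/-- `x' = k · x`, i.e. `𝔟_{x'} = Ad k 𝔟_x`. -/
def IsTranslate (k : complexGroup gR) (x x' : FlagVariety gR) : Prop :=
  x'.borel = x.borel.map (Ad k)

/-- Smoothness on a set of a map into `G ⊆ GL(N, ℂ)`. -/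
def SmoothOnGroup {M : Type*} [NormedAddCommGroup M] [NormedSpace ℝ M]
    (k : M → complexGroup gR) (U : Set M) : Prop :=
  ∀ i j, ContDiffOn ℝ ∞ (fun z => ((k z : (Mat N)ˣ) : Mat N) i j) U

/-- Smooth maps into the homogeneous space `X`.  As `G → X`, `k ↦ k · x₀`, is a submersion, a map
into `X` is smooth iff, locally, it is of the form `z ↦ k(z) · x₀` with `k` a smooth map
into `G`. -/
def SmoothFlag {M : Type*} [NormedAddCommGroup M] [NormedSpace ℝ M]
    (f : M → FlagVariety gR) : Prop :=
  ∀ z₀, ∃ U : Set M, IsOpen U ∧ z₀ ∈ U ∧ ∃ k : M → complexGroup gR,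
    SmoothOnGroup k U ∧ ∀ z ∈ U, IsTranslate (k z) (f z₀) (f z)

/-- Smooth maps into `T*X ⊆ X × 𝔤*`. -/
def SmoothCotangent {M : Type*} [NormedAddCommGroup M] [NormedSpace ℝ M]
    (f : M → CotangentBundle gR) : Prop :=
  SmoothFlag (fun z => (f z).proj) ∧ ∀ y, ContDiff ℝ ∞ (fun z => moment (f z) y)

/-- `v ∈ T_x X` is the velocity at time `t` of the curve `c` in `X`, `c(t) = x`: near `t` one has
`c(s) = k(s) · x` with `k` smooth in `G`, `k(t) = 1`, and `v` is given by `k'(t) ∈ 𝔤`. -/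
def FlagVelocity (c : ℝ → FlagVariety gR) (t : ℝ) {x : FlagVariety gR} (v : x.Tangent) : Prop :=
  c t = x ∧ ∃ U : Set ℝ, IsOpen U ∧ t ∈ U ∧ ∃ k : ℝ → complexGroup gR,
    SmoothOnGroup k U ∧ k t = 1 ∧ (∀ s ∈ U, IsTranslate (k s) x (c s)) ∧
    ∃ u : complexified gR,
      (∀ i j, HasDerivAt (fun s => ((k s : (Mat N)ˣ) : Mat N) i j) ((u : Mat N) i j) t) ∧
      v = x.vec u

/-- `α` is the velocity at time `t` of the curve `f` in `𝔤*`. -/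
def DualVelocity (f : ℝ → Module.Dual ℂ (complexified gR)) (t : ℝ)
    (α : Module.Dual ℂ (complexified gR)) : Prop :=
  ∀ y, HasDerivAt (fun s => f s y) (α y) t

/-- Vectors at `p ∈ T*X` in the ambient `X × 𝔤*`; the tangent space `T_p (T*X)` is the subset
`CotangentBundle.tangentSpace` of these. -/
structure CotangentBundle.Ambient (p : CotangentBundle gR) : Type where
  /-- the component `dπ(V)` along `X` -/
  base : p.proj.Tangent
  /-- the component `dμ(V)` along `𝔤*` -/
  dual : Module.Dual ℂ (complexified gR)

/-- `V` is the velocity at time `t` of the curve `c` in `T*X`, with `c(t) = p`. -/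
def CotangentVelocity (c : ℝ → CotangentBundle gR) (t : ℝ) {p : CotangentBundle gR}
    (V : p.Ambient) : Prop :=
  c t = p ∧ FlagVelocity (fun s => (c s).proj) t V.base ∧
    DualVelocity (fun s => moment (c s)) t V.dual

/-- The tangent space `T_p (T*X)`: the velocities of the smooth curves in `T*X` through `p`. -/
def CotangentBundle.tangentSpace (p : CotangentBundle gR) : Set p.Ambient :=
  {V | ∃ c : ℝ → CotangentBundle gR, SmoothCotangent c ∧ CotangentVelocity c 0 V}

/-- The canonical (Liouville) 1-form on `T*X`: `θ_p(V) = ⟨p, dπ(V)⟩`. -/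
def liouville {p : CotangentBundle gR} (V : p.Ambient) : ℂ := p.covec V.base

/-- The canonical symplectic form `σ = dθ` on `T*X` (in canonical coordinates `∑ dpᵢ ∧ dqᵢ`).
`dθ(V, W)` is the number `∂₁(θ(∂₂φ)) - ∂₂(θ(∂₁φ))` at `0`, for every smooth
`φ : ℝ² → T*X` with `φ(0) = p`, `∂₁φ(0) = V`, `∂₂φ(0) = W`. -/
def canonicalForm {p : CotangentBundle gR} (V W : p.Ambient) : ℂ :=
  Classical.epsilon fun c : ℂ =>
    ∀ (φ : ℝ × ℝ → CotangentBundle gR) (V₁ V₂ : ∀ z, (φ z).Ambient), SmoothCotangent φ →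
      (∀ z, CotangentVelocity (fun s => φ (s, z.2)) z.1 (V₁ z)) →
      (∀ z, CotangentVelocity (fun s => φ (z.1, s)) z.2 (V₂ z)) →
      CotangentVelocity (fun s => φ (s, 0)) 0 V →
      CotangentVelocity (fun s => φ (0, s)) 0 W →
      c = deriv (fun s : ℝ => liouville (V₂ (s, 0))) 0 -
        deriv (fun s : ℝ => liouville (V₁ (0, s))) 0

/-! ### Coadjoint orbits -/

/-- The infinitesimal coadjoint action: `(ad* u ζ)(y) = -ζ [u, y]`. -/
def coad (u : complexified gR) (ζ : Module.Dual ℂ (complexified gR)) :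
    Module.Dual ℂ (complexified gR) :=
  -(ζ ∘ₗ (LieAlgebra.ad ℂ (complexified gR) u))

/-- The tangent space at `ζ` of the coadjoint orbit `G · ζ`. -/
def orbitTangent (ζ : Module.Dual ℂ (complexified gR)) :
    Set (Module.Dual ℂ (complexified gR)) :=
  {α | ∃ u, α = coad u ζ}

/-- The Kirillov–Kostant symplectic form of the coadjoint orbit `G · ζ`, at `ζ`:
the number `ζ [u, v]` at the tangent vectors `α = ad* u ζ`, `β = ad* v ζ`. -/
def kirillovKostant (ζ α β : Module.Dual ℂ (complexified gR)) : ℂ :=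
  Classical.epsilon fun c : ℂ => ∀ u v, α = coad u ζ → β = coad v ζ → c = ζ ⁅u, v⁆

/-! ### The dual of the universal Cartan algebra -/

variable (gR) in
/-- An element `λ` of the dual `𝔥*` of the universal Cartan algebra `𝔥`, the fibre of the trivial
`G`-bundle with fibres `𝔟_x / [𝔟_x, 𝔟_x]`: a `G`-equivariant family of linear functions on the
`𝔟_x / [𝔟_x, 𝔟_x]`. -/
structure UniversalWeight : Type where
  /-- `λ` as a function on `𝔟_x` -/
  onBorel : ∀ x : FlagVariety gR, x.borel →ₗ[ℂ] ℂ
  map_lie : ∀ (x : FlagVariety gR) (y z : x.borel), onBorel x ⁅y, z⁆ = 0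
  equivariant : ∀ (k : complexGroup gR) (x x' : FlagVariety gR), IsTranslate k x x' →
    ∀ (y : x.borel) (y' : x'.borel),
      (y' : complexified gR) = Ad k (y : complexified gR) → onBorel x' y' = onBorel x y

/-- `λ` is regular: for all Cartan subalgebras `𝔱` of `𝔤`, all `x` with `𝔱 ⊆ 𝔟_x` and all roots `α`,
`λ`, viewed as a function on `𝔱 ≅ 𝔥`, does not vanish on the coroot of `α`, i.e. on the line
`[𝔤_α, 𝔤_{-α}] ⊆ 𝔱`. -/
def UniversalWeight.IsRegular (lam : UniversalWeight gR) : Prop :=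
  ∀ (x : FlagVariety gR) (t : LieSubalgebra ℂ (complexified gR)) [t.IsCartanSubalgebra]
    (ht : t ≤ x.borel) (α : t → ℂ), α ≠ 0 → LieAlgebra.rootSpace t α ≠ ⊥ →
    ∀ h ∈ LieAlgebra.corootSpace (R := ℂ) (L := complexified gR) (H := t) α,
      h ≠ 0 → lam.onBorel x ⟨h, ht h.2⟩ ≠ 0

/-! ### The compact form and the twisted moment map -/

variable (gR) in
/-- A Cartan decomposition `𝔤_ℝ = 𝔨_ℝ ⊕ 𝔭_ℝ`. -/
structure CartanDecomposition where
  k : Submodule ℝ gR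
  p : Submodule ℝ gR
  isCompl : IsCompl k p
  lie_k_k : ∀ x ∈ k, ∀ y ∈ k, ⁅x, y⁆ ∈ k
  lie_k_p : ∀ x ∈ k, ∀ y ∈ p, ⁅x, y⁆ ∈ p
  lie_p_p : ∀ x ∈ p, ∀ y ∈ p, ⁅x, y⁆ ∈ k
  killing_k : ∀ x ∈ k, x ≠ 0 → killingForm ℝ gR x x < 0
  killing_p : ∀ x ∈ p, x ≠ 0 → 0 < killingForm ℝ gR x x

variable (C : CartanDecomposition gR) (lam : UniversalWeight gR)

/-- The Lie algebra `𝔲_ℝ = 𝔨_ℝ ⊕ i 𝔭_ℝ ⊆ 𝔤` of the compact form `U_ℝ` of `G`. -/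
def CartanDecomposition.compactForm : Set (complexified gR) :=
  {u | ∃ x ∈ C.k, ∃ y ∈ C.p, (u : Mat N) = (x : Mat N) + Complex.I • (y : Mat N)}

/-- The map `m_λ : X → 𝔤*`, `x ↦ λ_x`.  Here `𝔱_ℝ = 𝔲_ℝ ∩ 𝔟_x` is the Cartan of `𝔲_ℝ` that fixes `x`,
and `λ_x` is the complex linear function on `𝔤` which equals `λ` on `𝔱_ℝ` and vanishes on
`[𝔱_ℝ, 𝔲_ℝ]`, where `𝔲_ℝ = 𝔱_ℝ ⊕ [𝔱_ℝ, 𝔲_ℝ]`. -/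
def twist (x : FlagVariety gR) : Module.Dual ℂ (complexified gR) :=
  Classical.epsilon fun f : Module.Dual ℂ (complexified gR) =>
    (∀ t : x.borel, (t : complexified gR) ∈ C.compactForm → f t = lam.onBorel x t) ∧
    ∀ t ∈ x.borel, t ∈ C.compactForm → ∀ u ∈ C.compactForm, f ⁅t, u⁆ = 0

/-- The twisted moment map `μ_λ = μ + m_λ ∘ π`. -/
def twistedMoment (p : CotangentBundle gR) : Module.Dual ℂ (complexified gR) :=
  moment p + twist C lam p.proj

/-- The differential `dμ_λ : T_p (T*X) → 𝔤*` of the twisted moment map, computed along curves. -/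
def dTwistedMoment {p : CotangentBundle gR} (V : p.Ambient) :
    Module.Dual ℂ (complexified gR) :=
  Classical.epsilon fun α => ∀ c : ℝ → CotangentBundle gR, SmoothCotangent c →
    CotangentVelocity c 0 V → DualVelocity (fun s => twistedMoment C lam (c s)) 0 α

/-- The `G`-orbit `Ω_λ ⊆ 𝔤*` through `λ_x`; since `G` acts transitively on `X`, different `x ∈ X`
give the same orbit. -/
def twistedOrbit : Set (Module.Dual ℂ (complexified gR)) :=
  {ζ | ∃ (x : FlagVariety gR) (k : complexGroup gR), ζ = coAd k (twist C lam x)}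

/-- The 2-form `τ_λ` on `X`: `τ_λ(u_x, v_x) = λ_x [u, v]` for `u, v ∈ 𝔲_ℝ`. -/
def tau {x : FlagVariety gR} (a b : x.Tangent) : ℂ :=
  Classical.epsilon fun c : ℂ => ∀ u ∈ C.compactForm, ∀ v ∈ C.compactForm,
    a = x.vec u → b = x.vec v → c = twist C lam x ⁅u, v⁆

end

end TwistedMoment

end

noncomputable section

namespace TwistedMoment

/-! ### Hermitian forms -/

section Hermitian

variable {V : Type*} [AddCommGroup V] [Module ℂ V]

/-! Fix `p = (x, ξ)`, write `b` for the Borel subalgebra at `x`, `κ` for the Killing form, `μ =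
μ(p)`, and `λ` for the twist at `x`. Conjugation with respect to the compact form makes `-κ(conj x,
y)` a positive Hermitian form, for which `ad y` has adjoint `-ad (conj y)`.

Structure of `b`. Its Killing complement `perp b` lies in `b` (`perp_le`), and `𝔤 = b ⊕ conj (perp
b)` is an orthogonal decomposition. The space `torus b c = b ∩ conj b` is a Cartan subalgebra
complementing `perp b` in `b` (`torus_isCartanSubalgebra`, `exists_add_of_mem`). No conjugacy
theorem is used: everything follows from `eq_zero_of_mem_perp_of_lie_eq_zero`, proved by a trace
argument with the element dual to `y ↦ tr (P ad y)`, where `P` is the projection to `b`.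
Consequently `λ` is the weight composed with `P` (`twist_eq_extend`).

Orbit. Under `κ`, `λ` corresponds to some `h` in the torus and `μ` to some `ν ∈ perp b`. Regularity
says that the centralizer of `h` is the torus, so `ad h` is bijective on `perp b`. Descending the
filtration of `perp b` by iterated brackets with `[b, b]`, exponentials of elements of `perp b` move
`h + ν` to `h` (`regular_add_transitive`), which gives the orbit statement. In the same way `ad (h +
ν)` is bijective on `perp b`, so every functional vanishing on `b` has the form `ad*_z (μ + λ)` with
`z ∈ perp b` (`exists_perp_apply_lie`).

Forms. Let `V`, `W` be tangent vectors over `v_x`, `w_x` with `v, w ∈ 𝔲_ℝ`, and let `V'`, `W'` be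
their components along `𝔤*`. The twist has derivative `ad*_v λ` (`dualVelocity_twist`), so `dμ_λ(V)
= V' + ad*_v λ = ad*_{v+z} (μ + λ)`, where `z` accounts for the vertical part `V' - ad*_v μ`. The
Maurer–Cartan equation gives `σ(V, W) = V'(w) - W'(v) + μ[v, w]` (`canonicalForm_eq`). Expanding `(μ
+ λ)[v + z, w + z']` then gives `-σ(V, W) + λ[v, w]`. -/

/-- The inner product space structure given by a positive definite Hermitian form. -/
abbrev hermitianCore (H : V →ₗ⋆[ℂ] V →ₗ[ℂ] ℂ)
    (symm : ∀ x y, starRingEnd ℂ (H y x) = H x y) (pos : ∀ x ≠ 0, 0 < (H x x).re) :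
    InnerProductSpace.Core ℂ V where
  inner x y := H x y
  conj_inner_symm x y := symm x y
  re_inner_nonneg x := by
    rcases eq_or_ne x 0 with rfl | h
    · simp
    · exact (pos x h).le
  add_left x y z := by simp
  smul_left x y r := by simp
  definite x h := by
    by_contra hx
    have := pos x hx
    rw [h] at this
    simp at this

theorem isCompl_of_hermitian [FiniteDimensional ℂ V] (H : V →ₗ⋆[ℂ] V →ₗ[ℂ] ℂ)
    (symm : ∀ x y, starRingEnd ℂ (H y x) = H x y) (pos : ∀ x ≠ 0, 0 < (H x x).re)
    (b c : Submodule ℂ V) (hc : ∀ x, x ∈ c ↔ ∀ y ∈ b, H y x = 0) : IsCompl b c := by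
  let core := hermitianCore H symm pos
  let _ : NormedAddCommGroup V := core.toNormedAddCommGroup
  let _ : InnerProductSpace ℂ V := InnerProductSpace.ofCore core.toCore
  have : c = bᗮ := by
    ext x
    rw [hc, Submodule.mem_orthogonal]
    rfl
  rw [this]
  exact Submodule.isCompl_orthogonal b

/-- In an orthonormal basis, `tr (T* T)` is the sum of the squared norms of the columns of `T`. -/
theorem eq_zero_of_trace_adjoint_comp [FiniteDimensional ℂ V] (H : V →ₗ⋆[ℂ] V →ₗ[ℂ] ℂ)
    (symm : ∀ x y, starRingEnd ℂ (H y x) = H x y) (pos : ∀ x ≠ 0, 0 < (H x x).re)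
    (S T : V →ₗ[ℂ] V) (hST : ∀ x y, H (T x) y = H x (S y))
    (h0 : LinearMap.trace ℂ V (S ∘ₗ T) = 0) : T = 0 := by
  let core := hermitianCore H symm pos
  let _ : NormedAddCommGroup V := core.toNormedAddCommGroup
  let _ : InnerProductSpace ℂ V := InnerProductSpace.ofCore core.toCore
  let e := stdOrthonormalBasis ℂ V
  rw [LinearMap.trace_eq_sum_inner _ e] at h0
  have key : ∀ i, inner ℂ (e i) ((S ∘ₗ T) (e i)) = ((‖T (e i)‖ ^ 2 : ℝ) : ℂ) := by
    intro i
    have : inner ℂ (T (e i)) (T (e i)) = inner ℂ (e i) ((S ∘ₗ T) (e i)) := hST _ _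
    rw [← this, inner_self_eq_norm_sq_to_K]
    simp
  simp only [key] at h0
  rw [← Complex.ofReal_sum, Complex.ofReal_eq_zero,
    Finset.sum_eq_zero_iff_of_nonneg fun _ _ => by positivity] at h0
  refine e.toBasis.ext fun i => ?_
  simpa using h0 i (Finset.mem_univ i)

theorem trace_adjoint [FiniteDimensional ℂ V] (H : V →ₗ⋆[ℂ] V →ₗ[ℂ] ℂ)
    (symm : ∀ x y, starRingEnd ℂ (H y x) = H x y) (pos : ∀ x ≠ 0, 0 < (H x x).re)
    (S T : V →ₗ[ℂ] V) (hST : ∀ x y, H (T x) y = H x (S y)) :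
    LinearMap.trace ℂ V S = starRingEnd ℂ (LinearMap.trace ℂ V T) := by
  let core := hermitianCore H symm pos
  let _ : NormedAddCommGroup V := core.toNormedAddCommGroup
  let _ : InnerProductSpace ℂ V := InnerProductSpace.ofCore core.toCore
  let e := stdOrthonormalBasis ℂ V
  rw [LinearMap.trace_eq_sum_inner _ e, LinearMap.trace_eq_sum_inner _ e, map_sum]
  refine Finset.sum_congr rfl fun i _ => ?_
  have h1 : inner ℂ (T (e i)) (e i) = inner ℂ (e i) (S (e i)) := hST _ _
  rw [← h1, inner_conj_symm]

end Hermitian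

/-! ### Solvable Lie algebras -/

section Solvable

theorem lie_mem_derivedSeries_one {L : Type*} [LieRing L] [LieAlgebra ℂ L] (x y : L) :
    ⁅x, y⁆ ∈ LieAlgebra.derivedSeries ℂ L 1 := by
  rw [LieAlgebra.derivedSeries_def, LieAlgebra.derivedSeriesOfIdeal_succ,
    LieAlgebra.derivedSeriesOfIdeal_zero]
  exact LieSubmodule.lie_mem_lie trivial trivial

theorem derivedSeries_one_induction {L : Type*} [LieRing L] [LieAlgebra ℂ L] {p : L → Prop}
    (lie : ∀ x y : L, p ⁅x, y⁆) (zero : p 0) (add : ∀ x y, p x → p y → p (x + y))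
    (smul : ∀ (c : ℂ) x, p x → p (c • x)) {x : L} (hx : x ∈ LieAlgebra.derivedSeries ℂ L 1) :
    p x := by
  rw [LieAlgebra.derivedSeries_def, LieAlgebra.derivedSeriesOfIdeal_succ,
    LieAlgebra.derivedSeriesOfIdeal_zero, ← LieSubmodule.mem_toSubmodule,
    LieSubmodule.lieIdeal_oper_eq_linear_span'] at hx
  induction hx using Submodule.span_induction with
  | mem x h => obtain ⟨y, -, z, -, rfl⟩ := h; exact lie y z
  | zero => exact zero
  | add x y _ _ hx hy => exact add x y hx hy
  | smul c x _ hx => exact smul c x hx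

theorem isSolvable_of_derivedSeries_one {L : Type*} [LieRing L] [LieAlgebra ℂ L]
    (h : LieAlgebra.IsSolvable (LieAlgebra.derivedSeries ℂ L 1)) : LieAlgebra.IsSolvable L := by
  obtain ⟨k, hk⟩ := LieAlgebra.IsSolvable.solvable ℂ (LieAlgebra.derivedSeries ℂ L 1)
  rw [LieIdeal.derivedSeries_eq_bot_iff] at hk
  refine LieAlgebra.IsSolvable.mk (R := ℂ) (k := k + 1) ?_
  rwa [LieAlgebra.derivedSeries_def, LieAlgebra.derivedSeriesOfIdeal_add]

open LieAlgebra LieModule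

variable {L M : Type*} [LieRing L] [LieAlgebra ℂ L] [IsSolvable L]
  [AddCommGroup M] [Module ℂ M] [LieRingModule L M] [LieModule ℂ L M] [FiniteDimensional ℂ M]

/-- By Lie's theorem the dual module contains a common eigenvector `f`. Its weight kills brackets,
so `f` is annihilated by the derived ideal and vanishes on the image of that ideal; if the image
were everything, `f` would be zero. -/
theorem derived_lie_ne_top [Nontrivial M] :
    ⁅derivedSeries ℂ L 1, (⊤ : LieSubmodule ℂ L M)⁆ ≠ ⊤ := by
  intro htop
  obtain ⟨χ, hχ⟩ := exists_nontrivial_weightSpace_of_isSolvable ℂ L (Module.Dual ℂ M)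
  obtain ⟨⟨f, hf⟩, hf0⟩ := exists_ne (0 : weightSpace (Module.Dual ℂ M) χ)
  rw [mem_weightSpace] at hf
  have hχ0 : ∀ x y : L, χ ⁅x, y⁆ = 0 := by
    intro x y
    have h1 : ⁅⁅x, y⁆, f⁆ = χ ⁅x, y⁆ • f := hf _
    rw [lie_lie, hf, hf, lie_smul, lie_smul, hf, hf, smul_smul, smul_smul, mul_comm, sub_self]
      at h1
    have hfne : f ≠ 0 := fun h => hf0 (by ext1; simpa using h)
    exact (smul_eq_zero.mp h1.symm).resolve_right hfne
  have hχD : ∀ x ∈ derivedSeries ℂ L 1, χ x = 0 := by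
    intro x hx
    exact derivedSeries_one_induction (p := fun x => χ x = 0) hχ0 (map_zero _)
      (fun x y hx hy => by rw [map_add, hx, hy, add_zero])
      (fun c x hx => by rw [map_smul, hx, smul_zero]) hx
  apply hf0
  ext1
  change f = 0
  ext m
  have hm : m ∈ ⁅derivedSeries ℂ L 1, (⊤ : LieSubmodule ℂ L M)⁆ := by rw [htop]; trivial
  rw [← LieSubmodule.mem_toSubmodule, LieSubmodule.lieIdeal_oper_eq_linear_span'] at hm
  induction hm using Submodule.span_induction with
  | mem x h =>
    obtain ⟨y, hy, z, -, rfl⟩ := h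
    have h1 := LinearMap.congr_fun (hf y) z
    rw [hχD y hy] at h1
    simpa using h1
  | zero => simp
  | add x y _ _ hx hy => rw [map_add, hx, hy, map_add]
  | smul c x _ hx => rw [map_smul, hx, map_smul]

theorem derived_lie_lt (N : LieSubmodule ℂ L M) (hN : N ≠ ⊥) :
    ⁅derivedSeries ℂ L 1, N⁆ < N := by
  refine lt_of_le_of_ne (LieSubmodule.lie_le_right _ _) fun h => ?_
  have : Nontrivial N := (LieSubmodule.nontrivial_iff_ne_bot ℂ L M).mpr hN
  apply derived_lie_ne_top (L := L) (M := N)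
  rw [eq_top_iff]
  rintro ⟨m, hm⟩ -
  have hm' := hm
  rw [← h] at hm'
  have hmap : LieSubmodule.map N.incl ⁅derivedSeries ℂ L 1, (⊤ : LieSubmodule ℂ L N)⁆
      = ⁅derivedSeries ℂ L 1, N⁆ := by
    rw [LieSubmodule.map_bracket_eq]
    congr 1
    ext x
    simp
  rw [← hmap] at hm'
  obtain ⟨y, hy, hym⟩ := (LieSubmodule.mem_map _).mp hm'
  have : y = ⟨m, hm⟩ := by ext1; exact hym
  rwa [← this]

/-- Induction along the filtration of a module over a solvable Lie algebra by the iterated images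
of the derived ideal. -/
theorem derived_induction {P : LieSubmodule ℂ L M → Prop} (bot : P ⊥)
    (step : ∀ N, P ⁅derivedSeries ℂ L 1, N⁆ → P N) (N : LieSubmodule ℂ L M) : P N := by
  have := LieSubmodule.wellFoundedLT_of_isArtinian ℂ L M
  induction N using WellFoundedLT.induction with
  | ind N ih =>
    by_cases hN : N = ⊥
    · rwa [hN]
    · exact step N (ih _ (derived_lie_lt N hN))

/-- The operator `[x, y] z` sends each step of the derived filtration into the next one, hence is
nilpotent and has trace zero. This is the easy half of Cartan's criterion. -/
theorem traceForm_lie_eq_zero (x y z : L) : traceForm ℂ L M ⁅x, y⁆ z = 0 := by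
  rw [traceForm_apply_apply]
  set T := toEnd ℂ L M ⁅x, y⁆ ∘ₗ toEnd ℂ L M z with hT
  have key : ∀ N : LieSubmodule ℂ L M, ∃ k : ℕ, ∀ m ∈ N, (T ^ k) m = 0 := by
    refine derived_induction ⟨0, fun m hm => by simpa using hm⟩ ?_
    rintro N ⟨k, hk⟩
    refine ⟨k + 1, fun m hm => ?_⟩
    rw [pow_succ, Module.End.mul_apply]
    exact hk _ (LieSubmodule.lie_mem_lie (lie_mem_derivedSeries_one x y) (N.lie_mem hm))
  obtain ⟨k, hk⟩ := key ⊤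
  have : IsNilpotent T := ⟨k, LinearMap.ext fun m => hk m trivial⟩
  exact (LinearMap.isNilpotent_trace_of_isNilpotent this).eq_zero

/-- The hard half of Cartan's criterion. The trace form of `L` vanishes on `D = [b, b]`, so `[D, D]`
acts nilpotently on `L`; by Engel it is a nilpotent Lie algebra, and two solvable extensions lead
back to `b`. -/
theorem isSolvable_of_traceForm_lie_eq_zero {L : Type*} [LieRing L] [LieAlgebra ℂ L]
    [FiniteDimensional ℂ L] (b : LieSubalgebra ℂ L)
    (h : ∀ x ∈ b, ∀ y ∈ b, ∀ z ∈ b, killingForm ℂ L ⁅x, y⁆ z = 0) : IsSolvable b := by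
  let D := derivedSeries ℂ b 1
  have htr : traceForm ℂ D L = 0 := by
    ext ⟨x, hx⟩ ⟨y, hy⟩
    change killingForm ℂ L x y = 0
    refine derivedSeries_one_induction (p := fun x : b => killingForm ℂ L x y = 0) ?_ ?_ ?_ ?_ hx
    · intro u v
      exact h u u.2 v v.2 y y.2
    · simp
    · intro u v hu hv
      simp [hu, hv]
    · intro c u hu
      simp [hu]
  have hnil := isNilpotent_derivedSeries_of_traceForm_eq_zero htr
  rw [isNilpotent_iff_forall' (R := ℂ)] at hnil
  have : LieRing.IsNilpotent (derivedSeries ℂ D 1) := by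
    rw [LieAlgebra.isNilpotent_iff_forall (R := ℂ)]
    intro x
    obtain ⟨k, hk⟩ := hnil x
    refine ⟨k, LinearMap.ext fun y => ?_⟩
    -- Nilpotency is known for the action on `L`; the adjoint action on `[D, D]` is its restriction.
    have key : ∀ j : ℕ, ((((ad ℂ (derivedSeries ℂ D 1) x ^ j) y : D) : b) : L) =
        (toEnd ℂ (derivedSeries ℂ D 1) L x ^ j) ((y : D) : b) := by
      intro j
      induction j with
      | zero => rfl
      | succ j ih => rw [pow_succ', pow_succ', Module.End.mul_apply, Module.End.mul_apply, ← ih]; rfl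
    have := key k
    rw [hk] at this
    ext
    simpa using this
  exact isSolvable_of_derivedSeries_one (isSolvable_of_derivedSeries_one inferInstance)

/-- The subalgebra generated by a subalgebra `b` and an element `x` with `[x, b] ⊆ b + ℂ x`. -/
def adjoin {L : Type*} [LieRing L] [LieAlgebra ℂ L] (b : LieSubalgebra ℂ L) (x : L)
    (hx : ∀ y ∈ b, ⁅x, y⁆ ∈ b.toSubmodule ⊔ ℂ ∙ x) : LieSubalgebra ℂ L where
  toSubmodule := b.toSubmodule ⊔ ℂ ∙ x
  lie_mem' := by
    intro u v hu hv
    obtain ⟨y, hy, w, hw, rfl⟩ := Submodule.mem_sup.mp hu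
    obtain ⟨z, hz, w', hw', rfl⟩ := Submodule.mem_sup.mp hv
    obtain ⟨c, rfl⟩ := Submodule.mem_span_singleton.mp hw
    obtain ⟨d, rfl⟩ := Submodule.mem_span_singleton.mp hw'
    have e : ⁅y + c • x, z + d • x⁆ = ⁅y, z⁆ + (c • ⁅x, z⁆ - d • ⁅x, y⁆) := by
      rw [add_lie, lie_add, lie_add, smul_lie, lie_smul, smul_lie, lie_smul, lie_self,
        ← lie_skew x y]
      simp only [smul_zero, add_zero, smul_neg]
      abel
    change ⁅y + c • x, z + d • x⁆ ∈ b.toSubmodule ⊔ ℂ ∙ x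
    rw [e]
    exact add_mem (Submodule.mem_sup_left (b.lie_mem hy hz))
      (sub_mem (Submodule.smul_mem _ _ (hx z hz)) (Submodule.smul_mem _ _ (hx y hy)))

theorem isSolvable_adjoin {L : Type*} [LieRing L] [LieAlgebra ℂ L] (b : LieSubalgebra ℂ L) (x : L)
    (hb : IsSolvable b) (hxb : ∀ y ∈ b, ⁅x, y⁆ ∈ b)
    (hx : ∀ y ∈ b, ⁅x, y⁆ ∈ b.toSubmodule ⊔ ℂ ∙ x) : IsSolvable (adjoin b x hx) := by
  have hlie : ∀ u v : adjoin b x hx, ((⁅u, v⁆ : adjoin b x hx) : L) ∈ b := by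
    rintro ⟨u, hu⟩ ⟨v, hv⟩
    obtain ⟨y, hy, w, hw, rfl⟩ := Submodule.mem_sup.mp hu
    obtain ⟨z, hz, w', hw', rfl⟩ := Submodule.mem_sup.mp hv
    obtain ⟨c, rfl⟩ := Submodule.mem_span_singleton.mp hw
    obtain ⟨d, rfl⟩ := Submodule.mem_span_singleton.mp hw'
    change ⁅y + c • x, z + d • x⁆ ∈ b
    have e : ⁅y + c • x, z + d • x⁆ = ⁅y, z⁆ + (c • ⁅x, z⁆ - d • ⁅x, y⁆) := by
      rw [add_lie, lie_add, lie_add, smul_lie, lie_smul, smul_lie, lie_smul, lie_self,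
        ← lie_skew x y]
      simp only [smul_zero, add_zero, smul_neg]
      abel
    rw [e]
    exact add_mem (b.lie_mem hy hz) (sub_mem (b.smul_mem _ (hxb z hz)) (b.smul_mem _ (hxb y hy)))
  apply isSolvable_of_derivedSeries_one
  have hD : ∀ u ∈ derivedSeries ℂ (adjoin b x hx) 1, (u : L) ∈ b := fun u hu =>
    derivedSeries_one_induction (p := fun u : adjoin b x hx => (u : L) ∈ b) hlie b.zero_mem
      (fun u v => b.add_mem) (fun c u hu => b.smul_mem c hu) hu
  let f : derivedSeries ℂ (adjoin b x hx) 1 →ₗ⁅ℂ⁆ b :=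
    { toFun u := ⟨u, hD u u.2⟩
      map_add' _ _ := rfl
      map_smul' _ _ := rfl
      map_lie' := rfl }
  refine Function.Injective.lieAlgebra_isSolvable (f := f) fun u v huv => ?_
  ext
  exact congrArg (fun w : b => (w : L)) huv

end Solvable

/-! ### Borel subalgebras of a complex Lie algebra with a compact conjugation -/

section Borel

set_option linter.unusedSectionVars false

open LieAlgebra LieModule

/-- The operators `Y` and `Z` preserve the range of the projection `P`, so this is the trace of the
commutator of their compressions to that range. -/
theorem trace_mul_commutator_eq_zero {V : Type*} [AddCommGroup V] [Module ℂ V]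
    [FiniteDimensional ℂ V] (P Y Z : Module.End ℂ V) (hP : P * P = P) (hY : Y * P = P * (Y * P))
    (hZ : Z * P = P * (Z * P)) : LinearMap.trace ℂ V (P * (Y * Z - Z * Y)) = 0 := by
  have key : ∀ Y Z : Module.End ℂ V, Z * P = P * (Z * P) →
      LinearMap.trace ℂ V (P * (Y * Z)) = LinearMap.trace ℂ V ((P * Y * P) * (P * Z * P)) := by
    intro Y Z hZ
    calc LinearMap.trace ℂ V (P * (Y * Z)) = LinearMap.trace ℂ V (P * (P * (Y * Z))) := by
          rw [← mul_assoc P P, hP]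
      _ = LinearMap.trace ℂ V (P * Y * (Z * P)) := by
          rw [LinearMap.trace_mul_comm]; simp only [mul_assoc]
      _ = LinearMap.trace ℂ V ((P * Y * P) * (P * Z * P)) := by
          have : (P * Y * P) * (P * Z * P) = P * Y * ((P * P) * (Z * P)) := by
            simp only [mul_assoc]
          rw [this, hP, ← hZ]
  rw [mul_sub, map_sub, key Y Z hZ, key Z Y hY, LinearMap.trace_mul_comm, sub_self]

/-- The conjugation of a complex Lie algebra with respect to a compact real form. -/
structure CompactConj (L : Type*) [LieRing L] [LieAlgebra ℂ L] where
  conj : L →ₗ⋆[ℂ] L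
  conj_conj : ∀ x, conj (conj x) = x
  conj_lie : ∀ x y, conj ⁅x, y⁆ = ⁅conj x, conj y⁆
  killing_conj : ∀ x y,
    killingForm ℂ L (conj x) (conj y) = starRingEnd ℂ (killingForm ℂ L x y)
  killing_neg : ∀ x ≠ 0, (killingForm ℂ L (conj x) x).re < 0

variable {L : Type*} [LieRing L] [LieAlgebra ℂ L] [FiniteDimensional ℂ L]

namespace CompactConj

variable (c : CompactConj L)

/-- The Hermitian form `-κ(conj x, y)`. -/
def form : L →ₗ⋆[ℂ] L →ₗ[ℂ] ℂ := 
  -(LinearMap.comp (killingForm ℂ L : L →ₗ[ℂ] L →ₗ[ℂ] ℂ) c.conj)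

theorem form_apply (x y : L) : c.form x y = -killingForm ℂ L (c.conj x) y := rfl

theorem form_symm (x y : L) : starRingEnd ℂ (c.form y x) = c.form x y := by
  rw [form_apply, form_apply, map_neg, ← c.killing_conj, c.conj_conj, traceForm_comm]

theorem form_pos (x : L) (hx : x ≠ 0) : 0 < (c.form x x).re := by
  rw [form_apply, Complex.neg_re]
  linarith [c.killing_neg x hx]

theorem form_lie (x y z : L) : c.form ⁅y, x⁆ z = -c.form x ⁅c.conj y, z⁆ := by
  rw [form_apply, form_apply, c.conj_lie, ← lie_skew, map_neg, LinearMap.neg_apply,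
    traceForm_apply_lie_apply]

include c in
theorem isKilling : IsKilling ℂ L where
  killingCompl_top_eq_bot := by
    rw [eq_bot_iff]
    intro x hx
    rw [LieIdeal.mem_killingCompl] at hx
    by_contra h
    have := c.killing_neg x h
    rw [hx _ trivial] at this
    simp at this

end CompactConj

variable {b : LieSubalgebra ℂ L}

section Maximal

variable (hb : Maximal (fun b : LieSubalgebra ℂ L => IsSolvable b) b)
include hb

/-- Otherwise `b + ℂ x` would be a larger solvable subalgebra. -/
theorem mem_of_normalizes {x : L} (hx : ∀ y ∈ b, ⁅x, y⁆ ∈ b) : x ∈ b := by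
  have h := hb.2 (isSolvable_adjoin b x hb.1 hx fun y hy => Submodule.mem_sup_left (hx y hy))
    (show b.toSubmodule ≤ b.toSubmodule ⊔ ℂ ∙ x from le_sup_left)
  exact h (Submodule.mem_sup_right (Submodule.mem_span_singleton_self x) :
    x ∈ b.toSubmodule ⊔ ℂ ∙ x)

theorem killing_lie_eq_zero {x y z : L} (hx : x ∈ b) (hy : y ∈ b) (hz : z ∈ b) :
    killingForm ℂ L ⁅x, y⁆ z = 0 := by
  have : IsSolvable b := hb.1
  exact traceForm_lie_eq_zero (L := b) (M := L) ⟨x, hx⟩ ⟨y, hy⟩ ⟨z, hz⟩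

end Maximal

variable (b) in
/-- The orthogonal complement of `b` with respect to the Killing form, as a `b`-module. -/
def perp : LieSubmodule ℂ b L where
  carrier := {x | ∀ y ∈ b, killingForm ℂ L x y = 0}
  zero_mem' y _ := by simp
  add_mem' {u v} hu hv y hy := by
    rw [map_add, LinearMap.add_apply, hu y hy, hv y hy, add_zero]
  smul_mem' a u hu y hy := by
    rw [map_smul, LinearMap.smul_apply, hu y hy, smul_zero]
  lie_mem {y x} hx z hz := by
    change killingForm ℂ L ⁅(y : L), x⁆ z = 0
    rw [← lie_skew, map_neg, LinearMap.neg_apply, traceForm_apply_lie_apply,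
      hx _ (b.lie_mem y.2 hz), neg_zero]

theorem mem_perp {x : L} : x ∈ perp b ↔ ∀ y ∈ b, killingForm ℂ L x y = 0 := Iff.rfl

theorem lie_mem_perp {x y : L} (hy : y ∈ b) (hx : x ∈ perp b) : ⁅y, x⁆ ∈ perp b :=
  (perp b).lie_mem (x := ⟨y, hy⟩) hx

/-- If `perp b` were not inside `b`, Lie's theorem applied to its image in `L / b` would give `v ∈
perp b` outside `b` with `[y, v] ∈ χ(y) v + b`. Then `b + ℂ v` is a subalgebra, solvable by Cartan's
criterion, against maximality. -/
theorem perp_le (hb : Maximal (fun b : LieSubalgebra ℂ L => IsSolvable b) b) {x : L}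
    (hx : x ∈ perp b) : x ∈ b := by
  by_contra hxb
  let Q := LieSubmodule.map (LieSubmodule.Quotient.mk' b.toLieSubmodule) (perp b)
  have hQ : Nontrivial Q := by
    refine nontrivial_of_ne ⟨LieSubmodule.Quotient.mk' b.toLieSubmodule x,
      LieSubmodule.mem_map_of_mem hx⟩ 0 fun h => hxb ?_
    have h' : LieSubmodule.Quotient.mk' b.toLieSubmodule x = 0 := congrArg Subtype.val h
    rwa [LieSubmodule.Quotient.mk_eq_zero] at h'
  have : IsSolvable b := hb.1
  obtain ⟨χ, hχ⟩ := exists_nontrivial_weightSpace_of_isSolvable ℂ b Q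
  obtain ⟨⟨⟨q, hq⟩, hw⟩, hne⟩ := exists_ne (0 : weightSpace Q χ)
  obtain ⟨v, hv, rfl⟩ := (LieSubmodule.mem_map _).mp hq
  rw [mem_weightSpace] at hw
  have hvb : v ∉ b := fun h => hne <| by
    ext
    exact (LieSubmodule.Quotient.mk_eq_zero b.toLieSubmodule).mpr h
  have hlie : ∀ y (hy : y ∈ b), ⁅y, v⁆ - χ ⟨y, hy⟩ • v ∈ b := by
    intro y hy
    have h := congrArg Subtype.val (hw ⟨y, hy⟩)
    have h' : LieSubmodule.Quotient.mk' b.toLieSubmodule (⁅y, v⁆ - χ ⟨y, hy⟩ • v) = 0 := by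
      rw [map_sub, map_smul, sub_eq_zero]
      exact h
    rwa [LieSubmodule.Quotient.mk_eq_zero] at h'
  have hv' : ∀ y ∈ b, ⁅v, y⁆ ∈ b.toSubmodule ⊔ ℂ ∙ v := by
    intro y hy
    have e : ⁅v, y⁆ = -(⁅y, v⁆ - χ ⟨y, hy⟩ • v) + (-χ ⟨y, hy⟩) • v := by
      rw [← lie_skew v y]; module
    rw [e]
    exact Submodule.add_mem_sup (neg_mem (hlie y hy))
      (Submodule.smul_mem _ _ (Submodule.mem_span_singleton_self v))
  have hsolv : IsSolvable (adjoin b v hv') := by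
    apply isSolvable_of_traceForm_lie_eq_zero
    intro x1 h1 x2 h2 x3 h3
    obtain ⟨y1, hy1, w1, hw1, rfl⟩ := Submodule.mem_sup.mp h1
    obtain ⟨y2, hy2, w2, hw2, rfl⟩ := Submodule.mem_sup.mp h2
    obtain ⟨y3, hy3, w3, hw3, rfl⟩ := Submodule.mem_sup.mp h3
    obtain ⟨c1, rfl⟩ := Submodule.mem_span_singleton.mp hw1
    obtain ⟨c2, rfl⟩ := Submodule.mem_span_singleton.mp hw2
    obtain ⟨c3, rfl⟩ := Submodule.mem_span_singleton.mp hw3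
    have e : ⁅y1 + c1 • v, y2 + c2 • v⁆ = ⁅y1, y2⁆ + (c2 • ⁅y1, v⁆ - c1 • ⁅y2, v⁆) := by
      rw [add_lie, lie_add, lie_add, smul_lie, lie_smul, smul_lie, lie_smul, lie_self,
        ← lie_skew v y2]
      module
    have k1 : ∀ y ∈ b, killingForm ℂ L ⁅y, v⁆ v = 0 := fun y _ => by
      rw [traceForm_apply_lie_apply, lie_self, map_zero]
    -- These vanishings rest on `κ([y, v], v) = κ(y, [v, v])`, on the stability of `perp b` under
    -- `b`, on `v ⊥ b`, and on the solvability of `b`.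
    have k2 : ∀ y ∈ b, killingForm ℂ L ⁅y, v⁆ y3 = 0 := fun y hy =>
      lie_mem_perp hy hv y3 hy3
    have k3 : killingForm ℂ L ⁅y1, y2⁆ v = 0 := by
      rw [traceForm_comm]; exact hv _ (b.lie_mem hy1 hy2)
    have k4 := killing_lie_eq_zero hb hy1 hy2 hy3
    rw [e]
    simp only [map_add, map_sub, map_smul, LinearMap.add_apply, LinearMap.sub_apply,
      LinearMap.smul_apply, k1 _ hy1, k1 _ hy2, k2 _ hy1, k2 _ hy2, k3, k4, smul_zero, add_zero,
      sub_zero]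
  have h := hb.2 hsolv (show b.toSubmodule ≤ b.toSubmodule ⊔ ℂ ∙ v from le_sup_left)
  exact hvb (h (Submodule.mem_sup_right (Submodule.mem_span_singleton_self v) :
    v ∈ b.toSubmodule ⊔ ℂ ∙ v))

variable (c : CompactConj L)

theorem lie_mem_perp_of_mem (hb : Maximal (fun b : LieSubalgebra ℂ L => IsSolvable b) b) {x y : L}
    (hx : x ∈ b) (hy : y ∈ b) : ⁅x, y⁆ ∈ perp b := fun _ hz => killing_lie_eq_zero hb hx hy hz

theorem eq_zero_of_mem_perp {x : L} (hx : x ∈ perp b) (hx' : c.conj x ∈ b) : x = 0 := by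
  by_contra h
  have := c.killing_neg x h
  rw [traceForm_comm, hx _ hx'] at this
  simp at this

variable (b) in
/-- The conjugate of the orthogonal complement of `b`. -/
def conjPerp : Submodule ℂ L := (perp b).toSubmodule.comap c.conj

theorem mem_conjPerp {x : L} : x ∈ conjPerp b c ↔ c.conj x ∈ perp b := Iff.rfl

-- Conjugation turns Killing orthogonality into orthogonality for the Hermitian form, so `conjPerp b
-- c` is the orthogonal complement of `b`; `proj b c` is therefore self-adjoint (`form_proj`).
variable (b) in
theorem isCompl_conjPerp : IsCompl b.toSubmodule (conjPerp b c) := by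
  refine isCompl_of_hermitian c.form c.form_symm c.form_pos _ _ fun x => ?_
  rw [mem_conjPerp, mem_perp]
  refine forall₂_congr fun y _ => ?_
  rw [c.form_apply, neg_eq_zero, traceForm_comm]
  constructor
  · intro h
    rw [← c.conj_conj x, c.killing_conj, h, map_zero]
  · intro h
    rw [← c.conj_conj y, c.killing_conj, c.conj_conj] at *
    rw [h, map_zero]

variable (b) in
/-- The projection to `b` along the conjugate of its orthogonal complement. -/
def proj : L →ₗ[ℂ] L := b.toSubmodule.projection (conjPerp b c) (isCompl_conjPerp b c)

theorem proj_mem (x : L) : proj b c x ∈ b :=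
  Submodule.projection_apply_mem _ _

theorem proj_of_mem {x : L} (hx : x ∈ b) : proj b c x = x :=
  Submodule.projection_apply_of_mem_left _ hx

theorem proj_of_mem_conjPerp {x : L} (hx : x ∈ conjPerp b c) : proj b c x = 0 :=
  (Submodule.projection_apply_eq_zero_iff _).mpr hx

theorem sub_proj_mem (x : L) : x - proj b c x ∈ conjPerp b c := by
  rw [← Submodule.projection_apply_eq_zero_iff (isCompl_conjPerp b c)]
  change proj b c (x - proj b c x) = 0
  rw [map_sub, proj_of_mem c (proj_mem c x), sub_self]

theorem proj_mul_proj : (proj b c : Module.End ℂ L) * proj b c = proj b c :=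
  LinearMap.ext fun x => proj_of_mem c (proj_mem c x)

theorem form_eq_zero {x y : L} (hx : x ∈ b) (hy : y ∈ conjPerp b c) : c.form x y = 0 := by
  rw [c.form_apply, neg_eq_zero, ← c.conj_conj y, c.killing_conj, traceForm_comm, hy x hx, map_zero]

theorem form_proj (x y : L) : c.form (proj b c x) y = c.form x (proj b c y) := by
  have h1 : c.form (proj b c x) (y - proj b c y) = 0 :=
    form_eq_zero c (proj_mem c x) (sub_proj_mem c y)
  have h2 : c.form (x - proj b c x) (proj b c y) = 0 := by
    rw [← c.form_symm, form_eq_zero c (proj_mem c y) (sub_proj_mem c x), map_zero]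
  rw [map_sub, sub_eq_zero] at h1
  rw [map_sub, LinearMap.sub_apply, sub_eq_zero] at h2
  rw [h1, h2]

end Borel

/-! ### The Cartan subalgebra `b ∩ conj b` -/

section Torus

open LieAlgebra LieModule

set_option linter.unusedSectionVars false

variable {L : Type*} [LieRing L] [LieAlgebra ℂ L] [FiniteDimensional ℂ L]
  {b : LieSubalgebra ℂ L} (c : CompactConj L)
  (hb : Maximal (fun b : LieSubalgebra ℂ L => IsSolvable b) b)

/-- The projection is self-adjoint and `ad y` has adjoint `-ad (conj y)`; the trace of an adjoint is
the conjugate trace. -/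
theorem trace_proj_ad_conj (y : L) :
    LinearMap.trace ℂ L (proj b c ∘ₗ ad ℂ L (c.conj y)) =
      -starRingEnd ℂ (LinearMap.trace ℂ L (proj b c ∘ₗ ad ℂ L y)) := by
  have h := trace_adjoint c.form c.form_symm c.form_pos (-(proj b c ∘ₗ ad ℂ L (c.conj y)))
    (ad ℂ L y ∘ₗ proj b c) (fun x z => by
      simp only [LinearMap.comp_apply, LinearMap.neg_apply, ad_apply, map_neg]
      rw [c.form_lie, form_proj])
  rw [map_neg] at h
  rw [show LinearMap.trace ℂ L (proj b c ∘ₗ ad ℂ L y) = LinearMap.trace ℂ L (ad ℂ L y ∘ₗ proj b c)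
    from LinearMap.trace_mul_comm ℂ _ _, ← h, neg_neg]

include hb

/-- The element of `b ∩ conj b` representing the trace of the projection of `ad` to `b`. -/
theorem exists_trace_proj_ad : ∃ ρ : L, ρ ∈ b ∧ c.conj ρ ∈ b ∧
    ∀ y, killingForm ℂ L ρ y = LinearMap.trace ℂ L (proj b c ∘ₗ ad ℂ L y) := by
  have := c.isKilling
  let f : Module.Dual ℂ L := LinearMap.trace ℂ L ∘ₗ
    (LinearMap.llcomp ℂ L L L (proj b c)) ∘ₗ (ad ℂ L : L →ₗ[ℂ] Module.End ℂ L)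
  have hf : ∀ y, f y = LinearMap.trace ℂ L (proj b c ∘ₗ ad ℂ L y) := fun y => rfl
  let ρ := ((killingForm ℂ L).toDual (IsKilling.killingForm_nondegenerate ℂ L)).symm f
  have hρ : ∀ y, killingForm ℂ L ρ y = LinearMap.trace ℂ L (proj b c ∘ₗ ad ℂ L y) := by
    intro y
    rw [← hf]
    exact LinearMap.BilinForm.apply_toDual_symm_apply f y
  -- For `y, z ∈ b`, `κ([ρ, y], z) = tr (P [ad y, ad z]) = 0`, because `ad y` and `ad z` preserve
  -- `b`. Hence `[ρ, b] ⊆ perp b ⊆ b`, and `b` is self-normalizing.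
  have hρb : ρ ∈ b := by
    refine mem_of_normalizes hb fun y hy => perp_le hb fun z hz => ?_
    have hstab : ∀ y ∈ b, (ad ℂ L y : Module.End ℂ L) * proj b c =
        proj b c * (ad ℂ L y * proj b c) := by
      intro y hy
      ext v
      exact (proj_of_mem c (b.lie_mem hy (proj_mem c v))).symm
    rw [traceForm_apply_lie_apply, hρ]
    have := trace_mul_commutator_eq_zero (proj b c) (ad ℂ L y) (ad ℂ L z) (proj_mul_proj c)
      (hstab y hy) (hstab z hz)
    rwa [← Ring.lie_def, ← LieHom.map_lie] at this
  have hconj : c.conj ρ = -ρ := by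
    apply ((killingForm ℂ L).toDual (IsKilling.killingForm_nondegenerate ℂ L)).injective
    ext y
    have e : killingForm ℂ L (c.conj ρ) y = starRingEnd ℂ (killingForm ℂ L ρ (c.conj y)) := by
      rw [← c.killing_conj, c.conj_conj]
    rw [LinearMap.BilinForm.toDual_def, LinearMap.BilinForm.toDual_def, map_neg,
      LinearMap.neg_apply, e, hρ, hρ, trace_proj_ad_conj]
    simp
  exact ⟨ρ, hρb, hconj ▸ neg_mem hρb, hρ⟩

theorem lie_mem_conjPerp {x y : L} (hy : c.conj y ∈ b) (hx : x ∈ conjPerp b c) :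
    ⁅y, x⁆ ∈ conjPerp b c := by
  rw [mem_conjPerp, c.conj_lie]
  exact lie_mem_perp hy hx

/-- `b ∩ conj b` has no centralizer in the orthogonal complement of `b`. -/
theorem eq_zero_of_mem_perp_of_lie_eq_zero {w : L} (hw : w ∈ perp b)
    (h : ∀ s ∈ b, c.conj s ∈ b → ⁅s, w⁆ = 0) : w = 0 := by
  obtain ⟨ρ, hρb, hρb', hρ⟩ := exists_trace_proj_ad c hb
  let P : Module.End ℂ L := proj b c
  let Q : Module.End ℂ L := 1 - P
  let W : Module.End ℂ L := ad ℂ L w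
  let W' : Module.End ℂ L := ad ℂ L (c.conj w)
  have hwb : w ∈ b := perp_le hb hw
  have hPP : P * P = P := proj_mul_proj c
  have hQQ : Q * Q = Q := by
    simp only [Q, mul_sub, sub_mul, hPP, one_mul, mul_one, sub_self, sub_zero]
  -- Since `conj w` lies in `conj b`, its adjoint action preserves the kernel of `P`.
  have hPW' : P * W' = P * W' * P := by
    have : P * W' * Q = 0 := by
      ext v
      exact proj_of_mem_conjPerp c (lie_mem_conjPerp c hb ((c.conj_conj w).symm ▸ hwb)
        (sub_proj_mem c v))
    have e : P * W' - P * W' * P = 0 := by rw [← this]; simp only [Q, mul_sub, mul_one]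
    exact sub_eq_zero.mp e
  -- This is `κ(ρ, [w, conj w]) = κ([ρ, w], conj w)`, which vanishes because `ρ` is in the torus and
  -- so commutes with `w`.
  have htr : LinearMap.trace ℂ L (P * (W * W' - W' * W)) = 0 := by
    have h1 : killingForm ℂ L ρ ⁅w, c.conj w⁆ = 0 := by
      rw [← traceForm_apply_lie_apply, h ρ hρb hρb']
      simp
    rw [hρ, LieHom.map_lie, Ring.lie_def] at h1
    exact h1
  have htr2 : LinearMap.trace ℂ L ((P * W * Q) * (Q * W' * P)) = 0 := by
    have e1 : LinearMap.trace ℂ L ((P * W * Q) * (Q * W' * P)) =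
        LinearMap.trace ℂ L (P * W * Q * W') := by
      rw [LinearMap.trace_mul_comm]
      have : Q * W' * P * (P * W * Q) = Q * W' * ((P * P) * W * Q) := by
        simp only [mul_assoc]
      rw [this, hPP, LinearMap.trace_mul_comm]
      have : P * W * Q * (Q * W') = P * W * (Q * Q) * W' := by simp only [mul_assoc]
      rw [this, hQQ]
    have e2 : P * W * Q * W' = P * (W * W') - P * W * (P * W') := by
      simp only [Q, mul_sub, sub_mul, mul_one, mul_assoc]
    have e3 : LinearMap.trace ℂ L (P * W * (P * W')) = LinearMap.trace ℂ L (P * (W' * W)) := by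
      rw [LinearMap.trace_mul_comm]
      have : P * W' * (P * W) = P * W' * P * W := by simp only [mul_assoc]
      rw [this, ← hPW', mul_assoc]
    rw [e1, e2, map_sub, e3, ← map_sub, ← mul_sub, htr]
  -- The adjoint of `Q W' P` is `-P W Q`, so `htr2` says that its Hilbert–Schmidt norm is zero. Thus
  -- `conj w` normalizes `b`, hence lies in `b`, while `w ∈ perp b`; then `κ(conj w, w) = 0` forces
  -- `w = 0`.
  have hzero : Q * W' * P = 0 := by
    refine eq_zero_of_trace_adjoint_comp c.form c.form_symm c.form_pos (-(P * W * Q)) _ ?_ ?_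
    · intro x y
      have hQ : ∀ u v : L, c.form (Q u) v = c.form u (Q v) := by
        intro u v
        change c.form (u - P u) v = c.form u (v - P v)
        rw [map_sub, map_sub, LinearMap.sub_apply, form_proj]
      change c.form (Q ⁅c.conj w, P x⁆) y = c.form x (-(P ⁅w, Q y⁆))
      rw [hQ, c.form_lie, c.conj_conj, form_proj, map_neg]
    · rw [LinearMap.neg_comp, map_neg]
      exact neg_eq_zero.mpr htr2
  refine eq_zero_of_mem_perp c hw (mem_of_normalizes hb fun y hy => ?_)
  have h1 := LinearMap.congr_fun hzero y
  change ⁅c.conj w, P y⁆ - P ⁅c.conj w, P y⁆ = 0 at h1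
  rw [sub_eq_zero, show P y = y from proj_of_mem c hy] at h1
  rw [h1]
  exact proj_mem c _

omit hb in
variable (b) in
/-- The subalgebra `b ∩ conj b`. -/
def torus : LieSubalgebra ℂ L where
  carrier := {x | x ∈ b ∧ c.conj x ∈ b}
  zero_mem' := ⟨b.zero_mem, by rw [map_zero]; exact b.zero_mem⟩
  add_mem' hx hy := ⟨b.add_mem hx.1 hy.1, by rw [map_add]; exact b.add_mem hx.2 hy.2⟩
  smul_mem' r x hx := ⟨b.smul_mem r hx.1, by rw [map_smulₛₗ]; exact b.smul_mem _ hx.2⟩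
  lie_mem' hx hy := ⟨b.lie_mem hx.1 hy.1, by rw [c.conj_lie]; exact b.lie_mem hx.2 hy.2⟩

omit hb in
theorem mem_torus {x : L} : x ∈ torus b c ↔ x ∈ b ∧ c.conj x ∈ b := Iff.rfl

omit hb in
theorem conj_mem_torus {x : L} (hx : x ∈ torus b c) : c.conj x ∈ torus b c :=
  ⟨hx.2, by rw [c.conj_conj]; exact hx.1⟩

/-- Decompose `conj x` along `b ⊕ conj (perp b)` and conjugate back; the second summand lands in
`perp b ⊆ b`, so the first one lies in `b` as well. -/
theorem exists_add_of_mem {x : L} (hx : x ∈ b) : ∃ w ∈ perp b, ∃ s ∈ torus b c, x = w + s := by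
  have h1 := sub_proj_mem (b := b) c (c.conj x)
  rw [mem_conjPerp, map_sub, c.conj_conj] at h1
  refine ⟨_, h1, c.conj (proj b c (c.conj x)), ⟨?_, ?_⟩, by abel⟩
  · have := sub_mem hx (perp_le hb h1)
    rwa [sub_sub_cancel] at this
  · rw [c.conj_conj]; exact proj_mem c _

/-- The bracket lies in `perp b` and in `conj b`, whose intersection is zero by definiteness. -/
theorem torus_lie_eq_zero {x y : L} (hx : x ∈ torus b c) (hy : y ∈ torus b c) : ⁅x, y⁆ = 0 :=
  eq_zero_of_mem_perp c (lie_mem_perp_of_mem hb hx.1 hy.1)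
    (by rw [c.conj_lie]; exact b.lie_mem hx.2 hy.2)

/-- The torus preserves each summand of `perp b ⊕ torus ⊕ conj (perp b)`. An element centralized by
the torus therefore has centralized components, and the outer ones vanish by
`eq_zero_of_mem_perp_of_lie_eq_zero`. -/
theorem mem_torus_of_lie_eq_zero {x : L} (h : ∀ s ∈ torus b c, ⁅s, x⁆ = 0) : x ∈ torus b c := by
  obtain ⟨w, hw, s0, hs0, e⟩ := exists_add_of_mem c hb (proj_mem (b := b) c x)
  have hv := sub_proj_mem (b := b) c x
  set v := x - proj b c x with hvdef
  have hx : x = w + s0 + v := by rw [← e, hvdef]; abel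
  have key : ∀ s ∈ torus b c, ⁅s, w⁆ = 0 ∧ ⁅s, v⁆ = 0 := by
    intro s hs
    have h1 : ⁅s, w⁆ + ⁅s, v⁆ = 0 := by
      have := h s hs
      rwa [hx, lie_add, lie_add, torus_lie_eq_zero c hb hs hs0, add_zero] at this
    have h2 : ⁅s, w⁆ ∈ b := perp_le hb (lie_mem_perp hs.1 hw)
    have h3 : ⁅s, v⁆ ∈ conjPerp b c := lie_mem_conjPerp c hb hs.2 hv
    have h4 : ⁅s, w⁆ = 0 := by
      have := congrArg (proj b c) h1
      rwa [map_add, proj_of_mem c h2, proj_of_mem_conjPerp c h3, add_zero, map_zero] at this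
    exact ⟨h4, by rwa [h4, zero_add] at h1⟩
  have hw0 : w = 0 := eq_zero_of_mem_perp_of_lie_eq_zero c hb hw fun s h1 h2 =>
    (key s ⟨h1, h2⟩).1
  have hv0 : c.conj v = 0 := eq_zero_of_mem_perp_of_lie_eq_zero c hb hv fun s h1 h2 => by
    rw [← c.conj_conj s, ← c.conj_lie, (key _ (conj_mem_torus c ⟨h1, h2⟩)).2, map_zero]
  have hv0' : v = 0 := by rw [← c.conj_conj v, hv0, map_zero]
  rw [hx, hw0, hv0', zero_add, add_zero]
  exact hs0

omit hb in
-- Moving `ad s` to the other side, the squared norm of `[s, x]` is minus the pairing of `x` with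
-- `[conj s, [s, x]]`.
theorem lie_eq_zero_of_lie_conj_lie {s x : L} (h : ⁅c.conj s, ⁅s, x⁆⁆ = 0) : ⁅s, x⁆ = 0 := by
  by_contra hne
  have := c.form_pos _ hne
  rw [c.form_lie, h] at this
  simp at this

/-- For `x` in the normalizer, `[s, x]` is in the abelian torus, so it is killed by `ad (conj s)`
and vanishes; thus `x` centralizes the torus. -/
theorem torus_isCartanSubalgebra : (torus b c).IsCartanSubalgebra := by
  have : IsLieAbelian (torus b c) := ⟨fun x y => by
    ext
    exact torus_lie_eq_zero c hb x.2 y.2⟩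
  refine ⟨inferInstance, le_antisymm (fun x hx => ?_) (LieSubalgebra.le_normalizer _)⟩
  refine mem_torus_of_lie_eq_zero c hb fun s hs => ?_
  have h1 : ⁅s, x⁆ ∈ torus b c := by
    rw [← lie_skew]
    exact neg_mem ((LieSubalgebra.mem_normalizer_iff _ x).mp hx s hs)
  exact lie_eq_zero_of_lie_conj_lie c (torus_lie_eq_zero c hb (conj_mem_torus c hs) h1)

/-- The orthogonal complement of `[torus, perp b]` inside `perp b` is centralized by the torus, by
the adjoint rule for `ad s`, hence is zero. -/
theorem perp_le_span_lie {w : L} (hw : w ∈ perp b) :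
    w ∈ Submodule.span ℂ {x | ∃ s ∈ torus b c, ∃ v ∈ perp b, ⁅s, v⁆ = x} := by
  set N := Submodule.span ℂ {x | ∃ s ∈ torus b c, ∃ v ∈ perp b, ⁅s, v⁆ = x} with hN
  have hNp : N ≤ (perp b).toSubmodule := by
    rw [hN, Submodule.span_le]
    rintro _ ⟨s, hs, v, hv, rfl⟩
    exact lie_mem_perp hs.1 hv
  let K : Submodule ℂ L :=
    { carrier := {x | ∀ y ∈ N, c.form y x = 0}
      zero_mem' := fun y _ => map_zero _
      add_mem' := fun h1 h2 y hy => by rw [map_add, h1 y hy, h2 y hy, add_zero]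
      smul_mem' := fun r x h1 y hy => by rw [map_smul, h1 y hy, smul_zero] }
  have hcompl := isCompl_of_hermitian c.form c.form_symm c.form_pos N K fun x => Iff.rfl
  obtain ⟨a, ha, d, hd, rfl⟩ := Submodule.mem_sup.mp
    (show w ∈ N ⊔ K by rw [hcompl.sup_eq_top]; trivial)
  have hdp : d ∈ perp b := by
    have := (perp b).sub_mem hw (hNp ha)
    rwa [add_sub_cancel_left] at this
  have hd0 : d = 0 := by
    refine eq_zero_of_mem_perp_of_lie_eq_zero c hb hdp fun s h1 h2 => ?_
    by_contra hne
    have := c.form_pos _ hne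
    rw [c.form_lie, ← c.form_symm, hd _ (Submodule.subset_span
      ⟨c.conj s, conj_mem_torus c ⟨h1, h2⟩, ⁅s, d⁆, lie_mem_perp h1 hdp, rfl⟩)] at this
    simp at this
  rw [hd0, add_zero]
  exact ha

-- Since `perp b = [torus, perp b]`, each of its elements is a combination of brackets in `b`.
include c in
theorem apply_eq_zero_of_mem_perp (f : b →ₗ[ℂ] ℂ) (hf : ∀ x y : b, f ⁅x, y⁆ = 0) {w : L}
    (hw : w ∈ perp b) (hwb : w ∈ b) : f ⟨w, hwb⟩ = 0 := by
  have h : ∀ w ∈ Submodule.span ℂ {x | ∃ s ∈ torus b c, ∃ v ∈ perp b, ⁅s, v⁆ = x},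
      f ⟨proj b c w, proj_mem c w⟩ = 0 := by
    intro w hw
    induction hw using Submodule.span_induction with
    | mem x h =>
      obtain ⟨s, hs, v, hv, rfl⟩ := h
      have h1 := hf ⟨s, hs.1⟩ ⟨v, perp_le hb hv⟩
      convert h1 using 2
      ext
      exact proj_of_mem c (b.lie_mem hs.1 (perp_le hb hv))
    | zero => convert map_zero f; simp
    | add x y _ _ hx hy =>
      have e : (⟨proj b c (x + y), proj_mem c _⟩ : b) =
          ⟨proj b c x, proj_mem c _⟩ + ⟨proj b c y, proj_mem c _⟩ := by ext; simp
      rw [e, map_add, hx, hy, add_zero]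
    | smul r x _ hx =>
      have e : (⟨proj b c (r • x), proj_mem c _⟩ : b) = r • ⟨proj b c x, proj_mem c _⟩ := by
        ext; simp
      rw [e, map_smul, hx, smul_zero]
  have h1 := h w (perp_le_span_lie c hb hw)
  convert h1 using 2
  ext
  exact (proj_of_mem c hwb).symm

end Torus

/-! ### Regular functionals on Borel subalgebras -/

section Regular

set_option linter.unusedSectionVars false

open LieAlgebra LieModule

variable {L : Type*} [LieRing L] [LieAlgebra ℂ L] [FiniteDimensional ℂ L]
  {b : LieSubalgebra ℂ L} (c : CompactConj L)

/-- The extension of a functional on `b` to `L` which vanishes on the conjugate of the orthogonal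
complement of `b`. -/
def extend (f : b →ₗ[ℂ] ℂ) : Module.Dual ℂ L :=
  f ∘ₗ (proj b c).codRestrict b.toSubmodule (proj_mem c)

theorem extend_apply (f : b →ₗ[ℂ] ℂ) (x : L) : extend c f x = f ⟨proj b c x, proj_mem c x⟩ := rfl

theorem extend_of_mem (f : b →ₗ[ℂ] ℂ) {x : L} (hx : x ∈ b) : extend c f x = f ⟨x, hx⟩ := by
  rw [extend_apply]
  congr 1
  ext
  exact proj_of_mem c hx

theorem extend_of_mem_conjPerp (f : b →ₗ[ℂ] ℂ) {x : L} (hx : x ∈ conjPerp b c) :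
    extend c f x = 0 := by
  rw [extend_apply, ← map_zero f]
  congr 1
  ext
  exact proj_of_mem_conjPerp c hx

variable (hb : Maximal (fun b : LieSubalgebra ℂ L => IsSolvable b) b)
  {f : b →ₗ[ℂ] ℂ} (hf : ∀ x y : b, f ⁅x, y⁆ = 0)
include hb hf

theorem extend_of_mem_perp {w : L} (hw : w ∈ perp b) : extend c f w = 0 := by
  rw [extend_of_mem c f (perp_le hb hw)]
  exact apply_eq_zero_of_mem_perp c hb f hf hw _

theorem extend_lie {s : L} (hs : s ∈ torus b c) (y : L) : extend c f ⁅s, y⁆ = 0 := by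
  have h := sub_proj_mem (b := b) c y
  have e : ⁅s, y⁆ = ⁅s, proj b c y⁆ + ⁅s, y - proj b c y⁆ := by rw [← lie_add]; congr 1; abel
  rw [e, map_add, extend_of_mem_conjPerp c f (lie_mem_conjPerp c hb hs.2 h), add_zero,
    extend_of_mem c f (b.lie_mem hs.1 (proj_mem c y))]
  exact hf ⟨s, hs.1⟩ ⟨_, proj_mem c y⟩

/-- The functional is represented, with respect to the Killing form, by an element of the torus. -/
theorem exists_torus_killing : ∃ h ∈ torus b c, ∀ y, killingForm ℂ L h y = extend c f y := by
  have := c.isKilling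
  let B := (killingForm ℂ L).toDual (IsKilling.killingForm_nondegenerate ℂ L)
  have hh : ∀ y, killingForm ℂ L (B.symm (extend c f)) y = extend c f y := fun y =>
    LinearMap.BilinForm.apply_toDual_symm_apply _ y
  refine ⟨B.symm (extend c f), mem_torus_of_lie_eq_zero c hb fun s hs => ?_, hh⟩
  -- By invariance `κ([s, h], y) = -λ[s, y] = 0` for `s` in the torus; so `h` centralizes the torus
  -- and belongs to it.
  apply B.injective
  ext y
  rw [LinearMap.BilinForm.toDual_def, ← lie_skew, map_neg, LinearMap.neg_apply,
    traceForm_apply_lie_apply, hh, extend_lie c hb hf hs, map_zero, neg_zero, LinearMap.zero_apply]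

variable {h : L} (hh : h ∈ torus b c) (hκ : ∀ y, killingForm ℂ L h y = extend c f y)
  (hreg : ∀ [(torus b c).IsCartanSubalgebra] (α : torus b c → ℂ), α ≠ 0 →
    rootSpace (torus b c) α ≠ ⊥ →
    ∀ x ∈ corootSpace (R := ℂ) (L := L) (H := torus b c) α, x ≠ 0 → f ⟨x, x.2.1⟩ ≠ 0)
include hh hκ hreg

/-- The centralizer of `h` is a torus module, hence a sum of generalized weight spaces. A nonzero
weight `χ` in it satisfies `χ(h) = 0`. The element `t_χ` dual to `χ` spans the coroot line and
`f(t_χ) = κ(h, t_χ) = χ(h) = 0`, contradicting regularity. -/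
theorem mem_torus_of_lie_regular {x : L} (hx : ⁅h, x⁆ = 0) : x ∈ torus b c := by
  have := c.isKilling
  have hcartan := torus_isCartanSubalgebra c hb
  let C : LieSubmodule ℂ (torus b c) L :=
    { LinearMap.ker (ad ℂ L h) with
      lie_mem := by
        intro s y hy
        change ⁅h, ⁅(s : L), y⁆⁆ = 0
        change ⁅h, y⁆ = 0 at hy
        rw [leibniz_lie, torus_lie_eq_zero c hb hh s.2, zero_lie, hy, lie_zero, add_zero] }
  have key : ∀ χ : torus b c → ℂ, ∀ y ∈ genWeightSpace C χ, (y : L) ∈ torus b c := by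
    intro χ y hy
    have hy' : (y : L) ∈ rootSpace (torus b c) χ :=
      map_genWeightSpace_le C.incl (LieSubmodule.mem_map_of_mem hy)
    by_cases hχ : χ = 0
    · rw [hχ, rootSpace_zero_eq] at hy'
      exact hy'
    · by_cases hy0 : (y : L) = 0
      · rw [hy0]; exact zero_mem _
      exfalso
      have hne : rootSpace (torus b c) χ ≠ ⊥ := fun h0 => by
        rw [h0] at hy'
        exact hy0 hy'
      let α : Weight ℂ (torus b c) L := ⟨χ, hne⟩
      have hαnz : α.IsNonZero := fun h0 => hχ h0
      have h1 := IsKilling.lie_eq_smul_of_mem_rootSpace hy' ⟨h, hh⟩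
      have h2 : ⁅h, (y : L)⁆ = 0 := y.2
      change ⁅h, (y : L)⁆ = _ at h1
      rw [h2] at h1
      have h3 : χ ⟨h, hh⟩ = 0 := (smul_eq_zero.mp h1.symm).resolve_right hy0
      have h4 := IsKilling.cartanEquivDual_symm_apply_mem_corootSpace α
      set tα := (IsKilling.cartanEquivDual (torus b c)).symm α with htα
      have h5 : tα ≠ 0 := fun h0 =>
        IsKilling.root_apply_cartanEquivDual_symm_ne_zero hαnz (by
          rw [← htα, h0]; exact map_zero (Weight.toLinear ℂ (torus b c) L α))
      refine hreg χ hχ hne tα h4 h5 ?_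
      rw [← extend_of_mem c f, ← hκ, traceForm_comm]
      have h6 : IsKilling.cartanEquivDual (torus b c) tα ⟨h, hh⟩ = α ⟨h, hh⟩ := by
        rw [htα, LinearEquiv.apply_symm_apply, Weight.toLinear_apply]
      rw [← h3]
      exact h6
  have htop := iSup_genWeightSpace_eq_top ℂ (torus b c) C
  have hx' : (⟨x, hx⟩ : C) ∈ ⨆ χ : torus b c → ℂ, genWeightSpace C χ := by rw [htop]; trivial
  have hle : (⨆ χ : torus b c → ℂ, genWeightSpace C χ) ≤
      LieSubmodule.comap C.incl (torus b c).toLieSubmodule := iSup_le fun χ y hy => key χ y hy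
  exact hle hx'

omit hf hh hκ hreg in
include c in
theorem perp_mem_derivedSeries {w : L} (hw : w ∈ perp b) :
    (⟨w, perp_le hb hw⟩ : b) ∈ derivedSeries ℂ b 1 := by
  have h := perp_le_span_lie c hb hw
  have key : ∀ w ∈ Submodule.span ℂ {x | ∃ s ∈ torus b c, ∃ v ∈ perp b, ⁅s, v⁆ = x},
      ∃ hwb : w ∈ b, (⟨w, hwb⟩ : b) ∈ derivedSeries ℂ b 1 := by
    intro w hw
    induction hw using Submodule.span_induction with
    | mem x h =>
      obtain ⟨s, hs, v, hv, rfl⟩ := h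
      exact ⟨b.lie_mem hs.1 (perp_le hb hv),
        lie_mem_derivedSeries_one (⟨s, hs.1⟩ : b) ⟨v, perp_le hb hv⟩⟩
    | zero => exact ⟨b.zero_mem, zero_mem _⟩
    | add x y _ _ hx hy =>
      obtain ⟨h1, h2⟩ := hx
      obtain ⟨h3, h4⟩ := hy
      exact ⟨b.add_mem h1 h3, add_mem h2 h4⟩
    | smul r x _ hx =>
      obtain ⟨h1, h2⟩ := hx
      exact ⟨b.smul_mem r h1, SMulMemClass.smul_mem r h2⟩
  exact (key w h).2

omit hf hh hκ hreg in
include c in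
theorem lie_mem_derived {w v : L} (hw : w ∈ perp b) (N : LieSubmodule ℂ b L) (hv : v ∈ N) :
    ⁅w, v⁆ ∈ ⁅derivedSeries ℂ b 1, N⁆ :=
  LieSubmodule.lie_mem_lie (perp_mem_derivedSeries c hb hw) hv

theorem eq_zero_of_lie_regular {x : L} (hxp : x ∈ perp b) (hx : ⁅h, x⁆ = 0) : x = 0 :=
  eq_zero_of_mem_perp c hxp (mem_torus_of_lie_regular c hb hf hh hκ hreg hx).2

/-- Here `ad h` is injective on `perp b`, so on each finite-dimensional `b`-submodule of it
injectivity gives surjectivity. -/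
theorem exists_lie_regular (N : LieSubmodule ℂ b L) (hN : N ≤ perp b) {x : L} (hx : x ∈ N) :
    ∃ z ∈ N, ⁅h, z⁆ = x := by
  let T : N →ₗ[ℂ] N := (ad ℂ L h).restrict (p := N.toSubmodule) (q := N.toSubmodule) fun y hy =>
    N.lie_mem (x := ⟨h, hh.1⟩) hy
  have hinj : Function.Injective T := by
    rw [← LinearMap.ker_eq_bot, LinearMap.ker_eq_bot']
    intro y hy
    ext
    exact eq_zero_of_lie_regular c hb hf hh hκ hreg (hN y.2) (congrArg Subtype.val hy)
  obtain ⟨z, hz⟩ := LinearMap.injective_iff_surjective.mp hinj ⟨x, hx⟩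
  exact ⟨z, z.2, congrArg Subtype.val hz⟩

/-- If `z ∈ N`, then `[h, z] = -[ν, z]` lies in the next filtration step. As `ad h` is bijective on
that step and injective on `perp b`, `z` lies there too; descend to zero. -/
theorem eq_zero_of_lie_regular_add {z ν : L} (hν : ν ∈ perp b) (hz : z ∈ perp b)
    (hzν : ⁅z, h + ν⁆ = 0) : z = 0 := by
  have : IsSolvable b := hb.1
  have key : ∀ N : LieSubmodule ℂ b L, N ≤ perp b → ∀ z ∈ N, ⁅z, h + ν⁆ = 0 → z = 0 := by
    refine derived_induction (fun _ z hz _ => hz) fun N ih hN z hz hzν => ?_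
    have hle : ⁅derivedSeries ℂ b 1, N⁆ ≤ perp b := (LieSubmodule.lie_le_right _ _).trans hN
    have e : ⁅h, z⁆ = -⁅ν, z⁆ := by
      rw [lie_add, ← lie_skew, ← lie_skew z ν] at hzν
      rw [eq_neg_iff_add_eq_zero, ← neg_eq_zero, neg_add]
      exact hzν
    obtain ⟨z', hz', hz''⟩ := exists_lie_regular c hb hf hh hκ hreg _ hle
      (e ▸ neg_mem (lie_mem_derived c hb hν N hz) : ⁅h, z⁆ ∈ ⁅derivedSeries ℂ b 1, N⁆)
    have h0 : z' - z = 0 := eq_zero_of_lie_regular c hb hf hh hκ hreg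
      (sub_mem (hle hz') (hN hz)) (by rw [lie_sub, hz'', sub_self])
    exact ih hle z (sub_eq_zero.mp h0 ▸ hz') hzν
  exact key (perp b) le_rfl z hz hzν

/-- The relation `r` stands for conjugacy under the group, and `hexp` for the action of `exp z` up
to terms of order two and higher. Successive exponentials push `ν` down the derived filtration until
it disappears. -/
theorem regular_add_transitive {r : L → L → Prop} (refl : ∀ x, r x x)
    (trans : ∀ x y z, r x y → r y z → r x z)
    (hexp : ∀ z ∈ perp b, ∀ (y : L) (N : Submodule ℂ L), (∀ m : ℕ, (ad ℂ L z ^ (m + 2)) y ∈ N) →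
      ∃ y', r y y' ∧ y' - y - ⁅z, y⁆ ∈ N)
    {ν : L} (hν : ν ∈ perp b) : r (h + ν) h := by
  have : IsSolvable b := hb.1
  have key : ∀ N : LieSubmodule ℂ b L, N ≤ perp b → ∀ ν ∈ N, r (h + ν) h := by
    refine derived_induction (fun _ z hz => ?_) fun N ih hN ν hν => ?_
    · rw [show z = 0 from hz, add_zero]
      exact refl h
    have hle' : ⁅derivedSeries ℂ b 1, N⁆ ≤ N := LieSubmodule.lie_le_right _ _
    obtain ⟨z, hz, hzν⟩ := exists_lie_regular c hb hf hh hκ hreg N hN hν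
    -- The choice `[h, z] = ν` makes the first-order term cancel `ν`; everything left is in the next
    -- filtration step.
    have e : ⁅z, h + ν⁆ = -ν + ⁅z, ν⁆ := by rw [lie_add, ← lie_skew, hzν]
    have hmem : ∀ m : ℕ, (ad ℂ L z ^ (m + 2)) (h + ν) ∈ ⁅derivedSeries ℂ b 1, N⁆ := by
      intro m
      induction m with
      | zero =>
        rw [zero_add, pow_two]
        change ⁅z, ⁅z, h + ν⁆⁆ ∈ _
        rw [e]
        exact lie_mem_derived c hb (hN hz) N
          (add_mem (neg_mem hν) (hle' (lie_mem_derived c hb (hN hz) N hν)))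
      | succ m ih =>
        rw [show m + 1 + 2 = (m + 2) + 1 by ring, pow_succ', Module.End.mul_apply]
        exact lie_mem_derived c hb (hN hz) N (hle' ih)
    obtain ⟨y', hr, hy'⟩ := hexp z (hN hz) (h + ν) _ hmem
    have hν' : y' - h ∈ ⁅derivedSeries ℂ b 1, N⁆ := by
      have e2 : y' - h = (y' - (h + ν) - ⁅z, h + ν⁆) + ⁅z, ν⁆ := by rw [e]; abel
      rw [e2]
      exact add_mem hy' (lie_mem_derived c hb (hN hz) N hν)
    have h2 := ih (hle'.trans hN) _ hν'
    rw [add_sub_cancel] at h2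
    exact trans _ _ _ hr h2
  exact key (perp b) le_rfl ν hν

end Regular

/-! ### The compact conjugation of the complexification -/

section Complexification

variable {N : ℕ} {gR : LieSubalgebra ℝ (Mat N)}

instance : FiniteDimensional ℝ gR :=
  inferInstanceAs (FiniteDimensional ℝ gR.toSubmodule)

instance : FiniteDimensional ℂ (complexified gR) :=
  inferInstanceAs (FiniteDimensional ℂ (complexified gR).toSubmodule)

variable (gR) in
/-- The inclusion of a real Lie algebra of matrices in the complex Lie algebra it generates. -/
def realIncl : gR →ₗ[ℝ] complexified gR where
  toFun a := ⟨a, LieSubalgebra.subset_lieSpan a.2⟩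
  map_add' _ _ := rfl
  map_smul' r a := by
    ext1
    change r • (a : Mat N) = r • (a : Mat N)
    rfl

@[simp]
theorem coe_realIncl (a : gR) : (realIncl gR a : Mat N) = a := rfl

theorem realIncl_lie (a b : gR) : realIncl gR ⁅a, b⁆ = ⁅realIncl gR a, realIncl gR b⁆ := rfl

theorem exists_realIncl_add (x : complexified gR) :
    ∃ a b : gR, x = realIncl gR a + Complex.I • realIncl gR b := by
  suffices h : ∀ x ∈ complexified gR, ∃ a b : gR, x = (a : Mat N) + Complex.I • (b : Mat N) by
    obtain ⟨a, b, e⟩ := h x x.2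
    exact ⟨a, b, Subtype.ext e⟩
  intro x hx
  induction hx using LieSubalgebra.lieSpan_induction with
  | mem x hx => exact ⟨⟨x, hx⟩, 0, by simp⟩
  | zero => exact ⟨0, 0, by simp⟩
  | add x y _ _ hx hy =>
    obtain ⟨a, b, rfl⟩ := hx
    obtain ⟨a', b', rfl⟩ := hy
    exact ⟨a + a', b + b', by push_cast; module⟩
  | smul r x _ hx =>
    obtain ⟨a, b, rfl⟩ := hx
    refine ⟨r.re • a - r.im • b, r.im • a + r.re • b, ?_⟩
    ext i j
    apply Complex.ext <;> simp <;> ring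
  | lie x y _ _ hx hy =>
    obtain ⟨a, b, rfl⟩ := hx
    obtain ⟨a', b', rfl⟩ := hy
    refine ⟨⁅a, a'⁆ - ⁅b, b'⁆, ⁅a, b'⁆ + ⁅b, a'⁆, ?_⟩
    simp only [lie_add, add_lie, lie_smul, smul_lie, smul_add, smul_smul, Complex.I_mul_I]
    push_cast
    module

variable (hgR : ∀ x ∈ gR, Complex.I • x ∈ gR → x = 0)
include hgR

theorem realIncl_add_eq_zero {a b : gR} (h : realIncl gR a + Complex.I • realIncl gR b = 0) :
    a = 0 ∧ b = 0 := by
  have h' : (a : Mat N) + Complex.I • (b : Mat N) = 0 := congrArg Subtype.val h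
  have hb : b = 0 := by
    ext1
    refine hgR b b.2 ?_
    rw [eq_neg_of_add_eq_zero_right h']
    exact neg_mem a.2
  refine ⟨?_, hb⟩
  ext1
  simpa [hb] using h'

/-- The decomposition `𝔤 = 𝔤_ℝ ⊕ i 𝔤_ℝ`. -/
def realEquiv : (gR × gR) ≃ₗ[ℝ] complexified gR :=
  LinearEquiv.ofBijective
    { toFun q := realIncl gR q.1 + Complex.I • realIncl gR q.2
      map_add' q q' := by simp only [Prod.fst_add, Prod.snd_add, map_add, smul_add]; abel
      map_smul' r q := by
        simp only [Prod.smul_fst, Prod.smul_snd, map_smul, RingHom.id_apply, smul_add]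
        rw [smul_comm] }
    ⟨by
      rw [← LinearMap.ker_eq_bot, LinearMap.ker_eq_bot']
      rintro ⟨a, b⟩ h
      obtain ⟨rfl, rfl⟩ := realIncl_add_eq_zero hgR h
      rfl, by
      intro x
      obtain ⟨a, b, rfl⟩ := exists_realIncl_add x
      exact ⟨(a, b), rfl⟩⟩

theorem realEquiv_apply (a b : gR) :
    realEquiv hgR (a, b) = realIncl gR a + Complex.I • realIncl gR b := rfl

theorem realEquiv_symm_apply (a b : gR) :
    (realEquiv hgR).symm (realIncl gR a + Complex.I • realIncl gR b) = (a, b) := by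
  rw [← realEquiv_apply hgR, LinearEquiv.symm_apply_apply]

/-- The antilinear extension to `𝔤` of a real linear endomorphism of `𝔤_ℝ`. -/
def antilinearExtension (s : gR →ₗ[ℝ] gR) : complexified gR →ₗ⋆[ℂ] complexified gR where
  toFun x := realIncl gR (s ((realEquiv hgR).symm x).1) -
    Complex.I • realIncl gR (s ((realEquiv hgR).symm x).2)
  map_add' x y := by
    simp only [map_add, Prod.fst_add, Prod.snd_add, smul_add]
    abel
  map_smul' c x := by
    obtain ⟨a, b, rfl⟩ := exists_realIncl_add x
    have e : c • (realIncl gR a + Complex.I • realIncl gR b) =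
        realIncl gR (c.re • a - c.im • b) + Complex.I • realIncl gR (c.im • a + c.re • b) := by
      ext i j
      apply Complex.ext <;> simp <;> ring
    rw [e, realEquiv_symm_apply, realEquiv_symm_apply]
    ext i j
    apply Complex.ext <;> simp <;> ring

theorem antilinearExtension_apply (s : gR →ₗ[ℝ] gR) (a b : gR) :
    antilinearExtension hgR s (realIncl gR a + Complex.I • realIncl gR b) =
      realIncl gR (s a) - Complex.I • realIncl gR (s b) := by
  change realIncl gR (s ((realEquiv hgR).symm _).1) -
    Complex.I • realIncl gR (s ((realEquiv hgR).symm _).2) = _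
  rw [realEquiv_symm_apply]

/-- A real basis of `𝔤_ℝ` as a complex basis of `𝔤`. -/
def complexBasis {ι : Type*} [Fintype ι] (e : Module.Basis ι ℝ gR) :
    Module.Basis ι ℂ (complexified gR) :=
  Module.Basis.mk (v := fun i => realIncl gR (e i))
    (by
      rw [Fintype.linearIndependent_iff]
      intro g hg
      have h : realIncl gR (∑ i, (g i).re • e i) + Complex.I • realIncl gR (∑ i, (g i).im • e i) =
          0 := by
        rw [← hg, map_sum, map_sum, Finset.smul_sum, ← Finset.sum_add_distrib]
        refine Finset.sum_congr rfl fun i _ => ?_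
        ext i j
        apply Complex.ext <;> simp [sub_eq_add_neg]
      obtain ⟨h1, h2⟩ := realIncl_add_eq_zero hgR h
      have k1 := Fintype.linearIndependent_iff.mp e.linearIndependent _ h1
      have k2 := Fintype.linearIndependent_iff.mp e.linearIndependent _ h2
      exact fun i => Complex.ext (k1 i) (k2 i))
    (by
      rintro x -
      obtain ⟨a, b, rfl⟩ := exists_realIncl_add x
      have h : ∀ a : gR, realIncl gR a ∈ Submodule.span ℂ (Set.range fun i => realIncl gR (e i)) := by
        intro a
        rw [← e.sum_repr a, map_sum]
        refine Submodule.sum_mem _ fun i _ => ?_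
        have : realIncl gR (e.repr a i • e i) = (e.repr a i : ℂ) • realIncl gR (e i) := by
          ext i j
          apply Complex.ext <;> simp
        rw [this]
        exact Submodule.smul_mem _ _ (Submodule.subset_span ⟨i, rfl⟩)
      exact add_mem (h a) (Submodule.smul_mem _ _ (h b)))

theorem complexBasis_apply {ι : Type*} [Fintype ι] (e : Module.Basis ι ℝ gR) (i : ι) :
    complexBasis hgR e i = realIncl gR (e i) := by
  rw [complexBasis, Module.Basis.mk_apply]

theorem complexBasis_repr {ι : Type*} [Fintype ι] (e : Module.Basis ι ℝ gR) (a : gR) (i : ι) :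
    (complexBasis hgR e).repr (realIncl gR a) i = (e.repr a i : ℂ) := by
  classical
  have h : realIncl gR a = ∑ i, (e.repr a i : ℂ) • complexBasis hgR e i := by
    conv_lhs => rw [← e.sum_repr a]
    rw [map_sum]
    refine Finset.sum_congr rfl fun i _ => ?_
    rw [complexBasis_apply]
    ext i j
    apply Complex.ext <;> simp
  rw [h]
  simp only [map_sum, map_smul, Finsupp.coe_finsetSum, Finset.sum_apply, Finsupp.smul_apply,
    Module.Basis.repr_self, Finsupp.single_apply, smul_eq_mul, mul_ite, mul_one, mul_zero,
    Finset.sum_ite_eq', Finset.mem_univ, if_true]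

/-- A real basis of `𝔤_ℝ` is a complex basis of `𝔤`, and the operators in question have the same
matrix in both. -/
theorem killingForm_realIncl (a b : gR) :
    killingForm ℂ (complexified gR) (realIncl gR a) (realIncl gR b) =
      (killingForm ℝ gR a b : ℂ) := by
  classical
  let e := Module.finBasis ℝ gR
  rw [killingForm_apply_apply, killingForm_apply_apply,
    LinearMap.trace_eq_matrix_trace ℂ (complexBasis hgR e), LinearMap.trace_eq_matrix_trace ℝ e,
    Matrix.trace, Matrix.trace, Complex.ofReal_sum]
  refine Finset.sum_congr rfl fun i _ => ?_
  rw [Matrix.diag_apply, Matrix.diag_apply, LinearMap.toMatrix_apply, LinearMap.toMatrix_apply,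
    complexBasis_apply, ← complexBasis_repr hgR]
  rfl

theorem killingForm_add (a b a' b' : gR) :
    killingForm ℂ (complexified gR) (realIncl gR a + Complex.I • realIncl gR b)
      (realIncl gR a' + Complex.I • realIncl gR b') =
      ((killingForm ℝ gR a a' - killingForm ℝ gR b b' : ℝ) : ℂ) +
        (killingForm ℝ gR a b' + killingForm ℝ gR b a' : ℝ) * Complex.I := by
  simp only [map_add, map_smul, LinearMap.add_apply, LinearMap.smul_apply,
    killingForm_realIncl hgR, smul_eq_mul]
  push_cast
  linear_combination (killingForm ℝ gR b b' : ℂ) * Complex.I_mul_I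

end Complexification

/-! ### The Cartan involution -/

namespace CartanDecomposition

variable {N : ℕ} {gR : LieSubalgebra ℝ (Mat N)} (C : CartanDecomposition gR)

/-- The Cartan involution of `𝔤_ℝ`. -/
def involution : gR →ₗ[ℝ] gR :=
  C.k.projection C.p C.isCompl - C.p.projection C.k C.isCompl.symm

theorem exists_add (a : gR) : ∃ x ∈ C.k, ∃ y ∈ C.p, a = x + y := by
  obtain ⟨x, hx, y, hy, e⟩ := Submodule.mem_sup.mp
    (show a ∈ C.k ⊔ C.p by rw [C.isCompl.sup_eq_top]; trivial)
  exact ⟨x, hx, y, hy, e.symm⟩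

theorem involution_add {x y : gR} (hx : x ∈ C.k) (hy : y ∈ C.p) :
    C.involution (x + y) = x - y := by
  rw [involution, LinearMap.sub_apply, map_add, map_add,
    Submodule.projection_apply_of_mem_left _ hx, Submodule.projection_apply_of_mem_left _ hy,
    (Submodule.projection_apply_eq_zero_iff C.isCompl).mpr hy,
    (Submodule.projection_apply_eq_zero_iff C.isCompl.symm).mpr hx, add_zero, zero_add]

theorem involution_involution (a : gR) : C.involution (C.involution a) = a := by
  obtain ⟨x, hx, y, hy, rfl⟩ := C.exists_add a
  rw [C.involution_add hx hy, sub_eq_add_neg, C.involution_add hx (neg_mem hy), sub_neg_eq_add]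

theorem involution_lie (a b : gR) : C.involution ⁅a, b⁆ = ⁅C.involution a, C.involution b⁆ := by
  obtain ⟨x, hx, y, hy, rfl⟩ := C.exists_add a
  obtain ⟨x', hx', y', hy', rfl⟩ := C.exists_add b
  have e : ⁅x + y, x' + y'⁆ = (⁅x, x'⁆ + ⁅y, y'⁆) + (⁅x, y'⁆ - ⁅x', y⁆) := by
    rw [add_lie, lie_add, lie_add, ← lie_skew y x']
    abel
  rw [e, C.involution_add (add_mem (C.lie_k_k _ hx _ hx') (C.lie_p_p _ hy _ hy'))
    (sub_mem (C.lie_k_p _ hx _ hy') (C.lie_k_p _ hx' _ hy)), C.involution_add hx hy,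
    C.involution_add hx' hy', sub_lie, lie_sub, lie_sub, ← lie_skew y x']
  abel

theorem killingForm_involution (a b : gR) :
    killingForm ℝ gR (C.involution a) (C.involution b) = killingForm ℝ gR a b := by
  let e : gR ≃ₗ⁅ℝ⁆ gR :=
    { C.involution with
      map_lie' := C.involution_lie _ _
      invFun := C.involution
      left_inv := C.involution_involution
      right_inv := C.involution_involution }
  exact LieAlgebra.killingForm_of_equiv_apply e a b

theorem killingForm_involution_self_neg {a : gR} (ha : a ≠ 0) :
    killingForm ℝ gR (C.involution a) a < 0 := by
  obtain ⟨x, hx, y, hy, rfl⟩ := C.exists_add a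
  have e : killingForm ℝ gR (C.involution (x + y)) (x + y) =
      killingForm ℝ gR x x - killingForm ℝ gR y y := by
    rw [C.involution_add hx hy, map_sub, LinearMap.sub_apply, map_add, map_add,
      LieModule.traceForm_comm ℝ gR gR y x]
    ring
  rw [e]
  rcases eq_or_ne x 0 with rfl | hx0
  · have := C.killing_p y hy (by simpa using ha)
    simpa using this
  · have h1 := C.killing_k x hx hx0
    rcases eq_or_ne y 0 with rfl | hy0
    · simpa using h1
    · linarith [C.killing_p y hy hy0]

variable (hgR : ∀ x ∈ gR, Complex.I • x ∈ gR → x = 0)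

/-- The conjugation of `𝔤` with respect to the compact form. -/
def compactConj : CompactConj (complexified gR) where
  conj := antilinearExtension hgR C.involution
  conj_conj x := by
    obtain ⟨a, b, rfl⟩ := exists_realIncl_add x
    rw [antilinearExtension_apply, sub_eq_add_neg, ← smul_neg, ← map_neg,
      antilinearExtension_apply, C.involution_involution, map_neg, C.involution_involution,
      map_neg, smul_neg, sub_neg_eq_add]
  conj_lie x y := by
    obtain ⟨a, b, rfl⟩ := exists_realIncl_add x
    obtain ⟨a', b', rfl⟩ := exists_realIncl_add y
    have e : ∀ a b a' b' : gR, ⁅realIncl gR a + Complex.I • realIncl gR b,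
        realIncl gR a' + Complex.I • realIncl gR b'⁆ =
        realIncl gR (⁅a, a'⁆ - ⁅b, b'⁆) + Complex.I • realIncl gR (⁅a, b'⁆ + ⁅b, a'⁆) := by
      intro a b a' b'
      simp only [lie_add, add_lie, lie_smul, smul_lie, smul_add, smul_smul, Complex.I_mul_I,
        map_add, map_sub, realIncl_lie]
      module
    have e' : ∀ a b : gR, realIncl gR a - Complex.I • realIncl gR b =
        realIncl gR a + Complex.I • realIncl gR (-b) := by
      intro a b
      rw [map_neg, smul_neg, sub_eq_add_neg]
    rw [e, antilinearExtension_apply, antilinearExtension_apply, antilinearExtension_apply, e',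
      e', e', e]
    simp only [map_add, map_sub, C.involution_lie, lie_neg, neg_lie, neg_neg, neg_add]
  killing_conj x y := by
    obtain ⟨a, b, rfl⟩ := exists_realIncl_add x
    obtain ⟨a', b', rfl⟩ := exists_realIncl_add y
    rw [antilinearExtension_apply, antilinearExtension_apply, sub_eq_add_neg, sub_eq_add_neg,
      ← smul_neg, ← smul_neg, ← map_neg, ← map_neg, ← map_neg, ← map_neg, killingForm_add hgR,
      killingForm_add hgR]
    simp only [C.killingForm_involution]
    simp [-neg_add_rev]
    ring
  killing_neg x hx := by
    obtain ⟨a, b, rfl⟩ := exists_realIncl_add x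
    rw [antilinearExtension_apply, sub_eq_add_neg, ← smul_neg, ← map_neg, ← map_neg,
      killingForm_add hgR]
    simp only [Complex.add_re, Complex.ofReal_re, Complex.mul_re, Complex.I_re, mul_zero,
      Complex.ofReal_im, Complex.I_im, mul_one, sub_self, add_zero, map_neg, LinearMap.neg_apply,
      sub_neg_eq_add]
    rcases eq_or_ne a 0 with rfl | ha
    · have hb : b ≠ 0 := fun h => hx (by simp [h])
      simpa using C.killingForm_involution_self_neg hb
    · have h1 := C.killingForm_involution_self_neg ha
      rcases eq_or_ne b 0 with rfl | hb
      · simpa using h1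
      · linarith [C.killingForm_involution_self_neg hb]

theorem mem_compactForm {u : complexified gR} :
    u ∈ C.compactForm ↔ (C.compactConj hgR).conj u = u := by
  constructor
  · rintro ⟨x, hx, y, hy, e⟩
    have e' : u = realIncl gR x + Complex.I • realIncl gR y := Subtype.ext e
    have h1 := C.involution_add hx C.p.zero_mem
    have h2 := C.involution_add C.k.zero_mem hy
    rw [add_zero, sub_zero] at h1
    rw [zero_add, zero_sub] at h2
    change antilinearExtension hgR C.involution u = u
    rw [e', antilinearExtension_apply, h1, h2, map_neg, smul_neg, sub_neg_eq_add]
  · intro h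
    obtain ⟨a, b, rfl⟩ := exists_realIncl_add u
    change antilinearExtension hgR C.involution _ = _ at h
    rw [antilinearExtension_apply, ← sub_eq_zero] at h
    obtain ⟨h1, h2⟩ := realIncl_add_eq_zero hgR (a := C.involution a - a)
      (b := -(C.involution b) - b) (by
        rw [← h]; simp only [map_sub, map_neg, smul_sub, smul_neg]; abel)
    obtain ⟨x, hx, y, hy, rfl⟩ := C.exists_add a
    obtain ⟨x', hx', y', hy', rfl⟩ := C.exists_add b
    rw [C.involution_add hx hy] at h1
    rw [C.involution_add hx' hy'] at h2
    have hy0 : y = 0 := by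
      have : (2 : ℝ) • y = 0 := by rw [← neg_eq_zero, ← h1]; module
      exact (smul_eq_zero.mp this).resolve_left two_ne_zero
    have hx0 : x' = 0 := by
      have : (2 : ℝ) • x' = 0 := by rw [← neg_eq_zero, ← h2]; module
      exact (smul_eq_zero.mp this).resolve_left two_ne_zero
    subst hy0 hx0
    exact ⟨x, hx, y', hy', by simp⟩

end CartanDecomposition

/-! ### Calculus in finite-dimensional complex vector spaces without a chosen norm -/

section Calculus

variable {V W X : Type*} [AddCommGroup V] [Module ℂ V] [AddCommGroup W] [Module ℂ W]
  [AddCommGroup X] [Module ℂ X]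

/-- The curve `f` has derivative `v` at `t`, tested by linear functionals. -/
def HasWeakDerivAt (f : ℝ → V) (v : V) (t : ℝ) : Prop :=
  ∀ φ : Module.Dual ℂ V, HasDerivAt (fun s => φ (f s)) (φ v) t

/-- The map `f` is smooth on `U`, tested by linear functionals. -/
def WeakSmoothOn {E : Type*} [NormedAddCommGroup E] [NormedSpace ℝ E] (f : E → V) (U : Set E) :
    Prop :=
  ∀ φ : Module.Dual ℂ V, ContDiffOn ℝ ∞ (fun s => φ (f s)) U

namespace HasWeakDerivAt

variable {f : ℝ → V} {v : V} {t : ℝ}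

theorem const (v : V) (t : ℝ) : HasWeakDerivAt (fun _ => v) 0 t := fun φ => by
  rw [map_zero]; exact hasDerivAt_const _ _

theorem of_basis {ι : Type*} [Fintype ι] (e : Module.Basis ι ℂ V)
    (h : ∀ i, HasDerivAt (fun s => e.repr (f s) i) (e.repr v i) t) : HasWeakDerivAt f v t := by
  intro φ
  have key : ∀ x, φ x = ∑ i, e.repr x i * φ (e i) := by
    intro x
    conv_lhs => rw [← e.sum_repr x]
    simp only [map_sum, map_smul, smul_eq_mul]
  rw [key v, funext fun s => key (f s)]
  exact HasDerivAt.fun_sum fun i _ => (h i).mul_const _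

theorem add {g : ℝ → V} {w : V} (hf : HasWeakDerivAt f v t) (hg : HasWeakDerivAt g w t) :
    HasWeakDerivAt (fun s => f s + g s) (v + w) t := fun φ => by
  simp only [map_add]; exact (hf φ).add (hg φ)

theorem linear (hf : HasWeakDerivAt f v t) (T : V →ₗ[ℂ] W) :
    HasWeakDerivAt (fun s => T (f s)) (T v) t := fun φ => hf (φ ∘ₗ T)

theorem antilinear (hf : HasWeakDerivAt f v t) (T : V →ₗ⋆[ℂ] W) :
    HasWeakDerivAt (fun s => T (f s)) (T v) t := by
  intro φ
  -- Complex conjugation makes `φ ∘ T` complex linear, so `hf` can be tested on it.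
  let ψ : Module.Dual ℂ V :=
    { toFun x := starRingEnd ℂ (φ (T x))
      map_add' x y := by simp
      map_smul' c x := by simp }
  have h := (hf ψ).star
  simpa [ψ] using h

theorem unique {w : V} [FiniteDimensional ℂ V] (hf : HasWeakDerivAt f v t)
    (hf' : HasWeakDerivAt f w t) : v = w := by
  rw [← sub_eq_zero, ← Module.forall_dual_apply_eq_zero_iff ℂ]
  intro φ
  rw [map_sub, (hf φ).unique (hf' φ), sub_self]

theorem congr {g : ℝ → V} (hf : HasWeakDerivAt f v t) (h : g =ᶠ[𝓝 t] f) : HasWeakDerivAt g v t :=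
  fun φ => (hf φ).congr_of_eventuallyEq (h.fun_comp φ)

theorem of_injective {T : V →ₗ[ℂ] W} (hT : Function.Injective T)
    (h : HasWeakDerivAt (fun s => T (f s)) (T v) t) : HasWeakDerivAt f v t := by
  obtain ⟨S, hS⟩ := T.exists_leftInverse_of_injective (LinearMap.ker_eq_bot.mpr hT)
  have h' : ∀ x, S (T x) = x := fun x => LinearMap.congr_fun hS x
  simpa only [h'] using h.linear S

theorem mem (p : Submodule ℂ V) (hf : HasWeakDerivAt f v t) (h : ∀ᶠ s in 𝓝 t, f s ∈ p) :
    v ∈ p := by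
  rw [← Subspace.forall_mem_dualAnnihilator_apply_eq_zero_iff]
  intro φ hφ
  refine (hf φ).unique ((hasDerivAt_const t (0 : ℂ)).congr_of_eventuallyEq ?_)
  filter_upwards [h] with s hs
  exact (Submodule.mem_dualAnnihilator φ).mp hφ _ hs

theorem bilinear [FiniteDimensional ℂ V] [FiniteDimensional ℂ W] (B : V →ₗ[ℂ] W →ₗ[ℂ] X)
    {g : ℝ → W} {w : W} (hf : HasWeakDerivAt f v t) (hg : HasWeakDerivAt g w t) :
    HasWeakDerivAt (fun s => B (f s) (g s)) (B v (g t) + B (f t) w) t := by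
  intro φ
  let e := Module.finBasis ℂ V
  let d := Module.finBasis ℂ W
  have key : ∀ x y, φ (B x y) = ∑ i, ∑ j, e.repr x i * d.repr y j * φ (B (e i) (d j)) := by
    intro x y
    conv_lhs => rw [← e.sum_repr x, ← d.sum_repr y]
    simp only [map_sum, LinearMap.sum_apply, map_smul, LinearMap.smul_apply, smul_eq_mul,
      Finset.mul_sum]
    rw [Finset.sum_comm]
    exact Finset.sum_congr rfl fun i _ => Finset.sum_congr rfl fun j _ => by ring
  rw [map_add, key, key, funext fun s => key (f s) (g s), ← Finset.sum_add_distrib]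
  refine HasDerivAt.fun_sum fun i _ => ?_
  rw [← Finset.sum_add_distrib]
  refine HasDerivAt.fun_sum fun j _ => ?_
  rw [← add_mul]
  exact ((hf (e.coord i)).mul (hg (d.coord j))).mul_const (φ (B (e i) (d j)))

theorem apply [FiniteDimensional ℂ V] [FiniteDimensional ℂ W] {F : ℝ → V →ₗ[ℂ] W}
    {F' : V →ₗ[ℂ] W} (hF : HasWeakDerivAt F F' t) (hf : HasWeakDerivAt f v t) :
    HasWeakDerivAt (fun s => F s (f s)) (F' (f t) + F t v) t :=
  hF.bilinear (LinearMap.id : (V →ₗ[ℂ] W) →ₗ[ℂ] V →ₗ[ℂ] W) hf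

theorem comp [FiniteDimensional ℂ V] [FiniteDimensional ℂ W] [FiniteDimensional ℂ X]
    {F : ℝ → W →ₗ[ℂ] X} {F' : W →ₗ[ℂ] X} {G : ℝ → V →ₗ[ℂ] W} {G' : V →ₗ[ℂ] W}
    (hF : HasWeakDerivAt F F' t) (hG : HasWeakDerivAt G G' t) :
    HasWeakDerivAt (fun s => F s ∘ₗ G s) (F' ∘ₗ G t + F t ∘ₗ G') t :=
  hF.bilinear (LinearMap.llcomp ℂ V W X) hG

theorem sum {ι : Type*} (A : Finset ι) {f : ι → ℝ → V} {v : ι → V}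
    (h : ∀ i ∈ A, HasWeakDerivAt (f i) (v i) t) :
    HasWeakDerivAt (fun s => ∑ i ∈ A, f i s) (∑ i ∈ A, v i) t := fun φ => by
  simp only [map_sum]; exact HasDerivAt.fun_sum fun i hi => h i hi φ

/-- A linear map is the sum of the rank-one maps given by its values on a basis, so pointwise
derivatives suffice. -/
theorem of_apply [FiniteDimensional ℂ V] {F : ℝ → V →ₗ[ℂ] W} {F' : V →ₗ[ℂ] W}
    (h : ∀ x, HasWeakDerivAt (fun s => F s x) (F' x) t) : HasWeakDerivAt F F' t := by
  let e := Module.finBasis ℂ V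
  have key : ∀ G : V →ₗ[ℂ] W, G = ∑ i, LinearMap.smulRightₗ (e.coord i) (G (e i)) := by
    intro G
    refine e.ext fun j => ?_
    simp [Finsupp.single_apply]
  rw [key F', funext fun s => key (F s)]
  exact sum _ fun i _ => (h (e i)).linear _

end HasWeakDerivAt

namespace WeakSmoothOn

variable {E : Type*} [NormedAddCommGroup E] [NormedSpace ℝ E] {f : E → V} {U : Set E}

theorem const (v : V) (U : Set E) : WeakSmoothOn (fun _ => v) U := fun _ => contDiffOn_const

theorem of_basis {ι : Type*} [Fintype ι] (e : Module.Basis ι ℂ V)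
    (h : ∀ i, ContDiffOn ℝ ∞ (fun s => e.repr (f s) i) U) : WeakSmoothOn f U := by
  intro φ
  have key : ∀ x, φ x = ∑ i, e.repr x i * φ (e i) := by
    intro x
    conv_lhs => rw [← e.sum_repr x]
    simp only [map_sum, map_smul, smul_eq_mul]
  rw [funext fun s => key (f s)]
  exact ContDiffOn.sum fun i _ => (h i).mul contDiffOn_const

theorem linear (hf : WeakSmoothOn f U) (T : V →ₗ[ℂ] W) : WeakSmoothOn (fun s => T (f s)) U :=
  fun φ => hf (φ ∘ₗ T)

theorem of_injective {T : V →ₗ[ℂ] W} (hT : Function.Injective T)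
    (h : WeakSmoothOn (fun s => T (f s)) U) : WeakSmoothOn f U := by
  obtain ⟨S, hS⟩ := T.exists_leftInverse_of_injective (LinearMap.ker_eq_bot.mpr hT)
  have h' : ∀ x, S (T x) = x := fun x => LinearMap.congr_fun hS x
  simpa only [h'] using h.linear S

theorem bilinear [FiniteDimensional ℂ V] [FiniteDimensional ℂ W] (B : V →ₗ[ℂ] W →ₗ[ℂ] X)
    {g : E → W} (hf : WeakSmoothOn f U) (hg : WeakSmoothOn g U) :
    WeakSmoothOn (fun s => B (f s) (g s)) U := by
  intro φ
  let e := Module.finBasis ℂ V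
  let d := Module.finBasis ℂ W
  have key : ∀ x y, φ (B x y) = ∑ i, ∑ j, e.repr x i * d.repr y j * φ (B (e i) (d j)) := by
    intro x y
    conv_lhs => rw [← e.sum_repr x, ← d.sum_repr y]
    simp only [map_sum, LinearMap.sum_apply, map_smul, LinearMap.smul_apply, smul_eq_mul,
      Finset.mul_sum]
    rw [Finset.sum_comm]
    exact Finset.sum_congr rfl fun i _ => Finset.sum_congr rfl fun j _ => by ring
  rw [funext fun s => key (f s) (g s)]
  exact ContDiffOn.sum fun i _ => ContDiffOn.sum fun j _ =>
    ((hf (e.coord i)).mul (hg (d.coord j))).mul contDiffOn_const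

theorem apply [FiniteDimensional ℂ V] [FiniteDimensional ℂ W] {F : E → V →ₗ[ℂ] W}
    (hF : WeakSmoothOn F U) (hf : WeakSmoothOn f U) : WeakSmoothOn (fun s => F s (f s)) U :=
  hF.bilinear (LinearMap.id : (V →ₗ[ℂ] W) →ₗ[ℂ] V →ₗ[ℂ] W) hf

theorem comp [FiniteDimensional ℂ V] [FiniteDimensional ℂ W] [FiniteDimensional ℂ X]
    {F : E → W →ₗ[ℂ] X} {G : E → V →ₗ[ℂ] W} (hF : WeakSmoothOn F U) (hG : WeakSmoothOn G U) :
    WeakSmoothOn (fun s => F s ∘ₗ G s) U :=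
  hF.bilinear (LinearMap.llcomp ℂ V W X) hG

theorem of_apply [FiniteDimensional ℂ V] {F : E → V →ₗ[ℂ] W}
    (h : ∀ x, WeakSmoothOn (fun s => F s x) U) : WeakSmoothOn F U := by
  let e := Module.finBasis ℂ V
  have key : ∀ G : V →ₗ[ℂ] W, G = ∑ i, LinearMap.smulRightₗ (e.coord i) (G (e i)) := by
    intro G
    refine e.ext fun j => ?_
    simp [Finsupp.single_apply]
  rw [funext fun s => key (F s)]
  intro φ
  simp only [map_sum]
  exact ContDiffOn.sum fun i _ => (h (e i)).linear (LinearMap.smulRightₗ (e.coord i)) φ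

end WeakSmoothOn

/-- The derivative of `f` in the direction `u`. -/
def dirDeriv {E : Type*} [NormedAddCommGroup E] [NormedSpace ℝ E] [FiniteDimensional ℂ V]
    (f : E → V) (u : E) (z : E) : V :=
  ∑ i, fderiv ℝ (fun x => (Module.finBasis ℂ V).coord i (f x)) z u • Module.finBasis ℂ V i

section DirDeriv

variable {E : Type*} [NormedAddCommGroup E] [NormedSpace ℝ E] [FiniteDimensional ℂ V]
  {f : E → V} {U : Set E} {z : E}

theorem apply_dirDeriv (hU : IsOpen U) (hf : WeakSmoothOn f U) (hz : z ∈ U) (u : E)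
    (φ : Module.Dual ℂ V) : φ (dirDeriv f u z) = fderiv ℝ (fun x => φ (f x)) z u := by
  let e := Module.finBasis ℂ V
  have key : ∀ x, φ x = ∑ i, e.repr x i * φ (e i) := by
    intro x
    conv_lhs => rw [← e.sum_repr x]
    simp only [map_sum, map_smul, smul_eq_mul]
  have hd : ∀ i, HasFDerivAt (fun x => e.repr (f x) i) (fderiv ℝ (fun x => e.repr (f x) i) z) z :=
    fun i => (((hf (e.coord i)).contDiffAt (hU.mem_nhds hz)).differentiableAt
      (by simp)).hasFDerivAt
  have h := HasFDerivAt.fun_sum (u := Finset.univ) fun i _ => (hd i).mul_const (φ (e i))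
  rw [funext fun s => key (f s), h.fderiv]
  simp only [dirDeriv, map_sum, map_smul, smul_eq_mul, sum_apply, smul_apply]
  exact Finset.sum_congr rfl fun i _ => mul_comm _ _

theorem WeakSmoothOn.dirDeriv (hU : IsOpen U) (hf : WeakSmoothOn f U) (u : E) :
    WeakSmoothOn (dirDeriv f u) U := by
  intro φ
  have h : ContDiffOn ℝ ∞ (fun z => fderiv ℝ (fun x => φ (f x)) z u) U :=
    ((hf φ).fderiv_of_isOpen hU (by simp)).clm_apply contDiffOn_const
  exact h.congr fun z hz => apply_dirDeriv hU hf hz u φ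

theorem dirDeriv_comm (hU : IsOpen U) (hf : WeakSmoothOn f U) (hz : z ∈ U) (u v : E) :
    dirDeriv (dirDeriv f u) v z = dirDeriv (dirDeriv f v) u z := by
  rw [← sub_eq_zero, ← Module.forall_dual_apply_eq_zero_iff ℂ]
  intro φ
  have hd : ContDiffAt ℝ ∞ (fun x => φ (f x)) z := (hf φ).contDiffAt (hU.mem_nhds hz)
  have key : ∀ u v, φ (dirDeriv (dirDeriv f u) v z) =
      fderiv ℝ (fderiv ℝ (fun x => φ (f x))) z v u := by
    intro u v
    rw [apply_dirDeriv hU (hf.dirDeriv hU u) hz]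
    have he : (fun x => φ (dirDeriv f u x)) =ᶠ[𝓝 z] fun x => fderiv ℝ (fun x => φ (f x)) x u := by
      filter_upwards [hU.mem_nhds hz] with x hx using apply_dirDeriv hU hf hx u φ
    rw [he.fderiv_eq]
    have h1 : DifferentiableAt ℝ (fderiv ℝ (fun x => φ (f x))) z :=
      (hd.fderiv_right (m := 1) (by norm_cast)).differentiableAt (by simp)
    rw [fderiv_clm_apply h1 (differentiableAt_const u)]
    simp
  rw [map_sub, key, key, sub_eq_zero]
  exact (hd.isSymmSndFDerivAt (by simpa using ENat.LEInfty.out)) v u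

theorem hasWeakDerivAt_dirDeriv (hU : IsOpen U) (hf : WeakSmoothOn f U) {γ : ℝ → E} {u : E}
    {t : ℝ} (hγ : HasDerivAt γ u t) (hz : γ t ∈ U) :
    HasWeakDerivAt (fun s => f (γ s)) (dirDeriv f u (γ t)) t := by
  intro φ
  rw [apply_dirDeriv hU hf hz]
  have hd : ContDiffAt ℝ ∞ (fun x => φ (f x)) (γ t) := (hf φ).contDiffAt (hU.mem_nhds hz)
  exact (hd.differentiableAt (by simp)).hasFDerivAt.comp_hasDerivAt t hγ

end DirDeriv

/-! ### Inverses -/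

section Inverse

variable {n : Type*} [Fintype n] [DecidableEq n]

theorem contDiffOn_det {E : Type*} [NormedAddCommGroup E] [NormedSpace ℝ E] {U : Set E}
    {A : E → Matrix n n ℂ} (h : ∀ i j, ContDiffOn ℝ ∞ (fun z => A z i j) U) :
    ContDiffOn ℝ ∞ (fun z => (A z).det) U := by
  simp only [Matrix.det_apply]
  refine ContDiffOn.sum fun σ _ => ?_
  simp only [Units.smul_def, zsmul_eq_mul]
  exact contDiffOn_const.mul (contDiffOn_prod fun i _ => h _ _)

theorem contDiffOn_inv {E : Type*} [NormedAddCommGroup E] [NormedSpace ℝ E] {U : Set E}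
    {A : E → Matrix n n ℂ} (h : ∀ i j, ContDiffOn ℝ ∞ (fun z => A z i j) U)
    (hA : ∀ z ∈ U, IsUnit (A z).det) (i j : n) : ContDiffOn ℝ ∞ (fun z => (A z)⁻¹ i j) U := by
  have e : ∀ z, (A z)⁻¹ i j = ((A z).det)⁻¹ * (A z).adjugate i j := fun z => by
    rw [Matrix.inv_def, Matrix.smul_apply, Ring.inverse_eq_inv', smul_eq_mul]
  simp only [e, Matrix.adjugate_apply]
  refine ((contDiffOn_det h).inv fun z hz => (hA z hz).ne_zero).mul (contDiffOn_det fun k l => ?_)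
  simp only [Matrix.updateRow_apply]
  split
  · exact contDiffOn_const
  · exact h k l

theorem differentiableAt_det {t : ℝ}
    {A : ℝ → Matrix n n ℂ} (h : ∀ i j, DifferentiableAt ℝ (fun z => A z i j) t) :
    DifferentiableAt ℝ (fun z => (A z).det) t := by
  simp only [Matrix.det_apply]
  refine DifferentiableAt.fun_sum fun σ _ => ?_
  simp only [Units.smul_def, zsmul_eq_mul]
  exact (differentiableAt_const _).mul (DifferentiableAt.fun_finsetProd fun i _ => h _ _)

theorem differentiableAt_inv {t : ℝ}
    {A : ℝ → Matrix n n ℂ} (h : ∀ i j, DifferentiableAt ℝ (fun z => A z i j) t)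
    (hA : IsUnit (A t).det) (i j : n) : DifferentiableAt ℝ (fun z => (A z)⁻¹ i j) t := by
  have e : ∀ z, (A z)⁻¹ i j = ((A z).det)⁻¹ * (A z).adjugate i j := fun z => by
    rw [Matrix.inv_def, Matrix.smul_apply, Ring.inverse_eq_inv', smul_eq_mul]
  simp only [e, Matrix.adjugate_apply]
  refine ((differentiableAt_det h).inv hA.ne_zero).mul (differentiableAt_det fun k l => ?_)
  simp only [Matrix.updateRow_apply]
  split
  · exact differentiableAt_const _
  · exact h k l

end Inverse

end Calculus

/-! ### Uniqueness of the twist functional; Borel subalgebras under automorphisms -/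

section

open LieAlgebra LieModule

variable {L : Type*} [LieRing L] [LieAlgebra ℂ L] [FiniteDimensional ℂ L]
  {b : LieSubalgebra ℂ L} (c : CompactConj L)
  (hb : Maximal (fun b : LieSubalgebra ℂ L => IsSolvable b) b)

omit [FiniteDimensional ℂ L] in
theorem CompactConj.exists_fixed_add (x : L) :
    ∃ u v : L, c.conj u = u ∧ c.conj v = v ∧ x = u + Complex.I • v ∧
      u = (1 / 2 : ℂ) • (x + c.conj x) ∧ v = (-Complex.I / 2) • (x - c.conj x) := by
  refine ⟨_, _, ?_, ?_, ?_, rfl, rfl⟩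
  · rw [map_smulₛₗ, map_add, c.conj_conj, add_comm]
    simp [map_ofNat (starRingEnd ℂ) 2]
  · rw [map_smulₛₗ, map_sub, c.conj_conj, ← neg_sub (c.conj x), smul_neg, ← neg_smul]
    congr 1
    simp [neg_div, map_ofNat (starRingEnd ℂ) 2]
  · have h : Complex.I • (-Complex.I / 2) • (x - c.conj x) = (1 / 2 : ℂ) • (x - c.conj x) := by
      rw [smul_smul]
      congr 1
      linear_combination (-1 / 2 : ℂ) * Complex.I_mul_I
    rw [h]
    module

-- The conditions on real elements extend complex linearly to the torus. Then `g` kills `[torus,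
-- L]`, which contains `perp b` and its conjugate, and agrees with `f` on the torus; these three
-- spaces span `L`.
include hb in
theorem eq_extend {f : b →ₗ[ℂ] ℂ} (hf : ∀ x y : b, f ⁅x, y⁆ = 0) {g : Module.Dual ℂ L}
    (h1 : ∀ t : b, c.conj t = t → g t = f t)
    (h2 : ∀ t ∈ b, c.conj t = t → ∀ u, c.conj u = u → g ⁅t, u⁆ = 0) : g = extend c f := by
  have hreal : ∀ s ∈ torus b c, ∃ u v : L, (u ∈ b ∧ c.conj u = u) ∧ (v ∈ b ∧ c.conj v = v) ∧
      s = u + Complex.I • v := by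
    intro s hs
    obtain ⟨u, v, hu, hv, e, hu', hv'⟩ := c.exists_fixed_add s
    exact ⟨u, v, ⟨hu' ▸ b.smul_mem _ (b.add_mem hs.1 hs.2), hu⟩,
      ⟨hv' ▸ b.smul_mem _ (b.sub_mem hs.1 hs.2), hv⟩, e⟩
  have hlie : ∀ s ∈ torus b c, ∀ y, g ⁅s, y⁆ = 0 := by
    intro s hs y
    obtain ⟨u, v, ⟨hub, hu⟩, ⟨hvb, hv⟩, rfl⟩ := hreal s hs
    obtain ⟨u', v', hu', hv', rfl, -⟩ := c.exists_fixed_add y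
    simp only [add_lie, lie_add, smul_lie, lie_smul, map_add, map_smul, h2 u hub hu u' hu',
      h2 u hub hu v' hv', h2 v hvb hv u' hu', h2 v hvb hv v' hv', smul_zero, add_zero]
  have htorus : ∀ s ∈ torus b c, g s = extend c f s := by
    intro s hs
    obtain ⟨u, v, ⟨hub, hu⟩, ⟨hvb, hv⟩, rfl⟩ := hreal s hs
    rw [map_add, map_add, map_smul, map_smul, extend_of_mem c f hub, extend_of_mem c f hvb,
      ← h1 ⟨u, hub⟩ hu, ← h1 ⟨v, hvb⟩ hv]
  have hperp : ∀ w ∈ perp b, g w = 0 ∧ g (c.conj w) = 0 := by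
    intro w hw
    have hspan := perp_le_span_lie c hb hw
    clear hw
    induction hspan using Submodule.span_induction with
    | mem x h =>
      obtain ⟨s, hs, v, hv, rfl⟩ := h
      exact ⟨hlie s hs v, by rw [c.conj_lie]; exact hlie _ (conj_mem_torus c hs) _⟩
    | zero => simp
    | add x y _ _ hx hy => simp [hx, hy]
    | smul r x _ hx => simp [hx]
  ext x
  have hv := sub_proj_mem (b := b) c x
  obtain ⟨w, hw, s, hs, e⟩ := exists_add_of_mem c hb (proj_mem (b := b) c x)
  have hx : x = w + s + (x - proj b c x) := by rw [← e]; abel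
  rw [hx, map_add, map_add, map_add, map_add, (hperp w hw).1, htorus s hs,
    extend_of_mem_perp c hb hf hw, extend_of_mem_conjPerp c f hv,
    ← c.conj_conj (x - proj b c x), (hperp _ hv).2]

omit [FiniteDimensional ℂ L] in
theorem maximal_map (e : L ≃ₗ⁅ℂ⁆ L) (hb : Maximal (fun b : LieSubalgebra ℂ L => IsSolvable b) b) :
    Maximal (fun b : LieSubalgebra ℂ L => IsSolvable b) (b.map (e : L →ₗ⁅ℂ⁆ L)) := by
  have hs : ∀ (e : L ≃ₗ⁅ℂ⁆ L) (b : LieSubalgebra ℂ L), IsSolvable b →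
      IsSolvable (b.map (e : L →ₗ⁅ℂ⁆ L)) := fun e b h =>
    (solvable_iff_equiv_solvable (R := ℂ) (e.lieSubalgebraMap b).symm).mpr h
  refine ⟨hs e b hb.1, fun b' hb' hle x hx => ?_⟩
  have h := hb.2 (hs e.symm b' hb') (fun y hy => ?_)
  · exact ⟨e.symm x, h ⟨x, hx, rfl⟩, e.apply_symm_apply x⟩
  · exact ⟨e y, hle ⟨y, hy, rfl⟩, e.symm_apply_apply y⟩

end

/-! ### The exponential series of the adjoint action -/

section Exp

/-- Left multiplication by `x` and right multiplication by `-x` commute, so conjugation by `exp x`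
is the exponential of their sum, which is `ad x`. -/
theorem hasSum_exp_conj {A : Type*} [NormedRing A] [NormedAlgebra ℂ A] [CompleteSpace A]
    (x y : A) :
    HasSum (fun n : ℕ => ((n.factorial : ℂ)⁻¹) •
        ((LinearMap.mulLeft ℂ x - LinearMap.mulRight ℂ x) ^ n) y)
      (NormedSpace.exp x * y * NormedSpace.exp (-x)) := by
  let L : A →L[ℂ] A := (ContinuousLinearMap.mul ℂ A) x
  let R : A →L[ℂ] A := (ContinuousLinearMap.mul ℂ A).flip (-x)
  have hLz : ∀ z, L z = x * z := fun z => rfl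
  have hRz : ∀ z, R z = z * (-x) := fun z => rfl
  clear_value L R
  have hLR : Commute L R := by
    ext1 z
    simp [hLz, hRz, mul_assoc]
  have hL : ∀ z n, (L ^ n) z = x ^ n * z := by
    intro z n
    induction n generalizing z with
    | zero => simp
    | succ n ih => rw [pow_succ, pow_succ, mul_apply_eq_comp, ih, hLz, mul_assoc]
  have hR : ∀ z n, (R ^ n) z = z * (-x) ^ n := by
    intro z n
    induction n generalizing z with
    | zero => simp
    | succ n ih => rw [pow_succ, pow_succ', mul_apply_eq_comp, ih, hRz, mul_assoc]
  have hev : ∀ (T : A →L[ℂ] A) (z : A),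
      HasSum (fun n : ℕ => ((n.factorial : ℂ)⁻¹) • (T ^ n) z) (NormedSpace.exp T z) := by
    intro T z
    have h := NormedSpace.exp_series_hasSum_exp' (𝕂 := ℂ) T
    simpa using h.mapL (ContinuousLinearMap.apply ℂ A z)
  have eL : ∀ z, NormedSpace.exp L z = NormedSpace.exp x * z := by
    intro z
    have h := (NormedSpace.exp_series_hasSum_exp' (𝕂 := ℂ) x).mul_right z
    refine (hev L z).unique ?_
    simpa [hL] using h
  have eR : ∀ z, NormedSpace.exp R z = z * NormedSpace.exp (-x) := by
    intro z
    have h := (NormedSpace.exp_series_hasSum_exp' (𝕂 := ℂ) (-x)).mul_left z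
    refine (hev R z).unique ?_
    simpa only [hR, Algebra.mul_smul_comm] using h
  have e : NormedSpace.exp (L + R) y = NormedSpace.exp x * y * NormedSpace.exp (-x) := by
    let _ : NormedAlgebra ℚ (A →L[ℂ] A) := NormedAlgebra.restrictScalars ℚ ℂ (A →L[ℂ] A)
    rw [NormedSpace.exp_add_of_commute hLR, mul_apply_eq_comp, eR, eL, mul_assoc]
  rw [← e]
  have hp : ∀ n, ((L + R) ^ n) y = ((LinearMap.mulLeft ℂ x - LinearMap.mulRight ℂ x) ^ n) y := by
    intro n
    induction n with
    | zero => rfl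
    | succ n ih =>
      rw [pow_succ', pow_succ', mul_apply_eq_comp, ih, Module.End.mul_apply]
      simp [hLz, hRz, sub_eq_add_neg]
  simpa only [hp] using hev (L + R) y

section

attribute [local instance] Matrix.linftyOpNormedRing Matrix.linftyOpNormedAlgebra

/-- What remains is the tail of the series from degree two on, and a finite-dimensional subspace is
closed. -/
theorem exp_conj_sub_mem {N : ℕ} (S : Submodule ℂ (Mat N)) (x y : Mat N)
    (h : ∀ n : ℕ, ((LinearMap.mulLeft ℂ x - LinearMap.mulRight ℂ x) ^ (n + 2)) y ∈ S) :
    NormedSpace.exp x * y * NormedSpace.exp (-x) - y - (x * y - y * x) ∈ S := by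
  have hs := (hasSum_nat_add_iff' 2).mpr (hasSum_exp_conj x y)
  have e : NormedSpace.exp x * y * NormedSpace.exp (-x) - ∑ i ∈ Finset.range 2,
      ((i.factorial : ℂ)⁻¹) • ((LinearMap.mulLeft ℂ x - LinearMap.mulRight ℂ x) ^ i) y =
      NormedSpace.exp x * y * NormedSpace.exp (-x) - y - (x * y - y * x) := by
    simp [Finset.sum_range_succ, sub_sub]
  rw [← e]
  refine S.closed_of_finiteDimensional.mem_of_tendsto hs (Filter.Eventually.of_forall fun s => ?_)
  exact S.sum_mem fun n _ => S.smul_mem _ (h n)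

theorem hasDerivAt_exp_smul_entry {N : ℕ} (x : Mat N) (t : ℝ) (i j : Fin N) :
    HasDerivAt (fun s : ℝ => NormedSpace.exp (s • x) i j) ((x * NormedSpace.exp (t • x)) i j) t := by
  have h := hasDerivAt_exp_smul_const' (𝕂 := ℝ) x t
  let φ : Mat N →L[ℝ] ℂ := LinearMap.toContinuousLinearMap
    { toFun M := M i j
      map_add' _ _ := rfl
      map_smul' _ _ := rfl }
  exact φ.hasFDerivAt.comp_hasDerivAt t h

theorem contDiff_exp_smul_entry {N : ℕ} (x : Mat N) (i j : Fin N) :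
    ContDiff ℝ ∞ (fun s : ℝ => NormedSpace.exp (s • x) i j) := by
  let φ : Mat N →L[ℝ] ℂ := LinearMap.toContinuousLinearMap
    { toFun M := M i j
      map_add' _ _ := rfl
      map_smul' _ _ := rfl }
  have h : ContDiff ℝ ∞ (NormedSpace.exp : Mat N → Mat N) := by
    refine contDiff_iff_contDiffAt.mpr fun M => ?_
    exact (NormedSpace.exp_analytic (𝕂 := ℝ) M).contDiffAt
  exact φ.contDiff.comp (h.comp (contDiff_id.smul contDiff_const))

end

end Exp

/-! ### The adjoint action -/

section AdjointAction

variable {N : ℕ} {gR : LieSubalgebra ℝ (Mat N)}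

theorem coe_Ad (k : complexGroup gR) (y : complexified gR) :
    (Ad k y : Mat N) = (k : (Mat N)ˣ) * (y : Mat N) * ((k : (Mat N)ˣ)⁻¹ : (Mat N)ˣ) := rfl

theorem Ad_one (y : complexified gR) : Ad (1 : complexGroup gR) y = y := by
  ext1
  rw [coe_Ad]
  simp

theorem Ad_mul (k k' : complexGroup gR) (y : complexified gR) : Ad (k * k') y = Ad k (Ad k' y) := by
  ext1
  simp only [coe_Ad, Subgroup.coe_mul, mul_inv_rev, Units.val_mul, mul_assoc]

theorem Ad_inv_Ad (k : complexGroup gR) (y : complexified gR) : Ad k⁻¹ (Ad k y) = y := by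
  rw [← Ad_mul, inv_mul_cancel, Ad_one]

theorem Ad_Ad_inv (k : complexGroup gR) (y : complexified gR) : Ad k (Ad k⁻¹ y) = y := by
  rw [← Ad_mul, mul_inv_cancel, Ad_one]

/-- `Ad k` as an automorphism of `𝔤`. -/
def AdEquiv (k : complexGroup gR) : complexified gR ≃ₗ⁅ℂ⁆ complexified gR where
  toLieHom := Ad k
  invFun := Ad k⁻¹
  left_inv := Ad_inv_Ad k
  right_inv := Ad_Ad_inv k

theorem killingForm_Ad (k : complexGroup gR) (x y : complexified gR) :
    killingForm ℂ (complexified gR) (Ad k x) (Ad k y) = killingForm ℂ (complexified gR) x y :=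
  LieAlgebra.killingForm_of_equiv_apply (AdEquiv k) x y

theorem coAd_apply (k : complexGroup gR) (ζ : Module.Dual ℂ (complexified gR))
    (y : complexified gR) : coAd k ζ y = ζ (Ad k⁻¹ y) := rfl

/-- The image `k · x` of a point of the flag variety. -/
def FlagVariety.translate (k : complexGroup gR) (x : FlagVariety gR) : FlagVariety gR :=
  ⟨x.borel.map (Ad k), maximal_map (AdEquiv k) x.2⟩

theorem FlagVariety.isTranslate (k : complexGroup gR) (x : FlagVariety gR) :
    IsTranslate k x (x.translate k) := rfl

theorem IsTranslate.eq {k : complexGroup gR} {x x' : FlagVariety gR} (h : IsTranslate k x x') :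
    x' = x.translate k := Subtype.ext h

theorem IsTranslate.Ad_mem_iff {k : complexGroup gR} {x x' : FlagVariety gR}
    (h : IsTranslate k x x') {y : complexified gR} : Ad k y ∈ x'.borel ↔ y ∈ x.borel := by
  rw [show x'.borel = _ from h]
  constructor
  · rintro ⟨z, hz, e⟩
    have e' : z = y := (AdEquiv k).injective e
    exact e' ▸ hz
  · exact fun hy => ⟨y, hy, rfl⟩

theorem IsTranslate.mem_iff {k : complexGroup gR} {x x' : FlagVariety gR}
    (h : IsTranslate k x x') {y : complexified gR} : y ∈ x'.borel ↔ Ad k⁻¹ y ∈ x.borel := by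
  rw [← h.Ad_mem_iff, Ad_Ad_inv]

theorem isTranslate_of_forall {k : complexGroup gR} {x x' : FlagVariety gR}
    (h : ∀ y, y ∈ x'.borel ↔ Ad k⁻¹ y ∈ x.borel) : IsTranslate k x x' := by
  refine LieSubalgebra.ext _ _ fun y => ?_
  rw [h]
  constructor
  · exact fun hy => ⟨_, hy, Ad_Ad_inv k y⟩
  · rintro ⟨z, hz, rfl⟩
    have : Ad k⁻¹ (Ad k z) ∈ x.borel := by rw [Ad_inv_Ad]; exact hz
    exact this

theorem isTranslate_one (x : FlagVariety gR) : IsTranslate 1 x x :=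
  isTranslate_of_forall fun y => by rw [inv_one, Ad_one]

theorem IsTranslate.mul {k k' : complexGroup gR} {x x' x'' : FlagVariety gR}
    (h : IsTranslate k x x') (h' : IsTranslate k' x' x'') : IsTranslate (k' * k) x x'' :=
  isTranslate_of_forall fun y => by rw [h'.mem_iff, h.mem_iff, mul_inv_rev, Ad_mul]

theorem IsTranslate.inv {k : complexGroup gR} {x x' : FlagVariety gR}
    (h : IsTranslate k x x') : IsTranslate k⁻¹ x' x :=
  isTranslate_of_forall fun y => by rw [h.mem_iff, inv_inv, Ad_inv_Ad]

/-- The element `exp x` of `G`. -/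
def expGroup (x : complexified gR) : complexGroup gR :=
  ⟨(Matrix.isUnit_exp (x : Mat N)).unit, Subgroup.subset_closure ⟨x, x.2, rfl⟩⟩

theorem coe_expGroup (x : complexified gR) :
    (((expGroup x : complexGroup gR) : (Mat N)ˣ) : Mat N) = NormedSpace.exp (x : Mat N) := rfl

theorem coe_Ad_expGroup (x y : complexified gR) :
    (Ad (expGroup x) y : Mat N) =
      NormedSpace.exp (x : Mat N) * y * NormedSpace.exp (-(x : Mat N)) := by
  rw [coe_Ad, exp_inv (coe_expGroup x), coe_expGroup]

theorem Ad_expGroup_sub_mem (x y : complexified gR) (S : Submodule ℂ (complexified gR))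
    (h : ∀ m : ℕ, ((LieAlgebra.ad ℂ (complexified gR) x) ^ (m + 2)) y ∈ S) :
    Ad (expGroup x) y - y - ⁅x, y⁆ ∈ S := by
  have hp : ∀ m : ℕ, ((LinearMap.mulLeft ℂ (x : Mat N) - LinearMap.mulRight ℂ (x : Mat N)) ^ m)
      (y : Mat N) = (((LieAlgebra.ad ℂ (complexified gR) x) ^ m) y : complexified gR) := by
    intro m
    induction m with
    | zero => rfl
    | succ m ih =>
      rw [pow_succ', pow_succ', Module.End.mul_apply, Module.End.mul_apply, ih]
      rfl
  have h' := exp_conj_sub_mem (S.map (complexified gR).toSubmodule.subtype) x y fun n => by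
    rw [hp]
    exact Submodule.mem_map_of_mem (h n)
  rw [← coe_Ad_expGroup] at h'
  obtain ⟨z, hz, e⟩ := h'
  have : z = Ad (expGroup x) y - y - ⁅x, y⁆ := Subtype.ext e
  exact this ▸ hz

end AdjointAction

/-! ### Smooth curves in the group -/

/-- Differentiability of `G` is assumed with an unknown derivative; the product rule for `F G = 1`
then determines it. -/
theorem HasWeakDerivAt.inv {V : Type*} [AddCommGroup V] [Module ℂ V] [FiniteDimensional ℂ V]
    {F G : ℝ → V →ₗ[ℂ] V} {F' G' : V →ₗ[ℂ] V} {t : ℝ} (hF : HasWeakDerivAt F F' t)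
    (hG : HasWeakDerivAt G G' t) (h : ∀ s y, F s (G s y) = y) (h1 : ∀ y, F t y = y) :
    HasWeakDerivAt G (-F') t := by
  have hp := hF.comp hG
  have e : ∀ s, F s ∘ₗ G s = LinearMap.id := fun s => LinearMap.ext (h s)
  have e1 : F t = LinearMap.id := LinearMap.ext h1
  have e2 : G t = LinearMap.id := by rw [← e t, e1, LinearMap.id_comp]
  simp only [e] at hp
  have h0 := hp.unique (HasWeakDerivAt.const _ t)
  rw [e1, e2, LinearMap.id_comp, LinearMap.comp_id] at h0
  rw [neg_eq_of_add_eq_zero_right h0]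
  exact hG

section SmoothGroup

variable {N : ℕ} {gR : LieSubalgebra ℝ (Mat N)}

theorem HasWeakDerivAt.of_entries {f : ℝ → Mat N} {v : Mat N} {t : ℝ}
    (h : ∀ i j, HasDerivAt (fun s => f s i j) (v i j) t) : HasWeakDerivAt f v t :=
  HasWeakDerivAt.of_basis (Matrix.stdBasis ℂ (Fin N) (Fin N)) fun i => h i.1 i.2

variable {E : Type*} [NormedAddCommGroup E] [NormedSpace ℝ E]

theorem WeakSmoothOn.of_entries {f : E → Mat N} {U : Set E}
    (h : ∀ i j, ContDiffOn ℝ ∞ (fun s => f s i j) U) : WeakSmoothOn f U :=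
  WeakSmoothOn.of_basis (Matrix.stdBasis ℂ (Fin N) (Fin N)) fun i => h i.1 i.2

variable {k : E → complexGroup gR} {U : Set E}

theorem SmoothOnGroup.inv (h : SmoothOnGroup k U) : SmoothOnGroup (fun z => (k z)⁻¹) U := by
  intro i j
  have h' := contDiffOn_inv h
    (fun z _ => (Matrix.isUnit_iff_isUnit_det _).mp ((k z : (Mat N)ˣ).isUnit)) i j
  refine h'.congr fun z _ => ?_
  rw [Subgroup.coe_inv, Matrix.coe_units_inv]

theorem SmoothOnGroup.mul {k' : E → complexGroup gR} (h : SmoothOnGroup k U)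
    (h' : SmoothOnGroup k' U) : SmoothOnGroup (fun z => k z * k' z) U := by
  intro i j
  simp only [Subgroup.coe_mul, Units.val_mul, Matrix.mul_apply]
  exact ContDiffOn.sum fun l _ => (h i l).mul (h' l j)

theorem SmoothOnGroup.weakSmoothOn_Ad (h : SmoothOnGroup k U) :
    WeakSmoothOn (fun z => (Ad (k z) : complexified gR →ₗ[ℂ] complexified gR)) U := by
  refine WeakSmoothOn.of_apply fun y => ?_
  refine WeakSmoothOn.of_injective (T := (complexified gR).toSubmodule.subtype)
    (Submodule.injective_subtype _) (WeakSmoothOn.of_entries fun i j => ?_)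
  change ContDiffOn ℝ ∞ (fun z => (((k z : (Mat N)ˣ) : Mat N) * (y : Mat N) *
    (((k z)⁻¹ : complexGroup gR) : (Mat N)ˣ)) i j) U
  simp only [Matrix.mul_apply]
  exact ContDiffOn.sum fun l _ =>
    (ContDiffOn.sum fun m _ => (h i m).mul contDiffOn_const).mul (h.inv l j)

variable {κ : ℝ → complexGroup gR} {I : Set ℝ} {t : ℝ} {u : complexified gR}

theorem SmoothOnGroup.hasWeakDerivAt_inv (h : SmoothOnGroup κ I) (hI : IsOpen I) (ht : t ∈ I)
    (h1 : κ t = 1)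
    (hu : ∀ i j, HasDerivAt (fun s => ((κ s : (Mat N)ˣ) : Mat N) i j) ((u : Mat N) i j) t) :
    HasWeakDerivAt (fun s => ((((κ s)⁻¹ : complexGroup gR) : (Mat N)ˣ) : Mat N)) (-u : Mat N) t := by
  have hk := HasWeakDerivAt.of_entries hu
  have hd := hasWeakDerivAt_dirDeriv hI (WeakSmoothOn.of_entries h.inv) (hasDerivAt_id t) ht
  have hp := hk.bilinear (LinearMap.mul ℂ (Mat N)) hd
  have e : ∀ s, ((κ s : (Mat N)ˣ) : Mat N) * ((((κ s)⁻¹ : complexGroup gR) : (Mat N)ˣ) : Mat N) = 1 :=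
    fun s => by rw [Subgroup.coe_inv, Units.mul_inv]
  simp only [LinearMap.mul_apply', id_eq, e] at hp
  have h0 := hp.unique (HasWeakDerivAt.const 1 t)
  simp only [h1, inv_one, Subgroup.coe_one, Units.val_one, one_mul, mul_one] at h0
  rw [neg_eq_of_add_eq_zero_right h0]
  exact hd

theorem SmoothOnGroup.hasWeakDerivAt_Ad (h : SmoothOnGroup κ I) (hI : IsOpen I) (ht : t ∈ I)
    (h1 : κ t = 1)
    (hu : ∀ i j, HasDerivAt (fun s => ((κ s : (Mat N)ˣ) : Mat N) i j) ((u : Mat N) i j) t) :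
    HasWeakDerivAt (fun s => (Ad (κ s) : complexified gR →ₗ[ℂ] complexified gR))
      (LieAlgebra.ad ℂ (complexified gR) u) t := by
  refine HasWeakDerivAt.of_apply fun y => ?_
  refine HasWeakDerivAt.of_injective (T := (complexified gR).toSubmodule.subtype)
    (Submodule.injective_subtype _) ?_
  have hk := (HasWeakDerivAt.of_entries hu).linear (LinearMap.mulRight ℂ (y : Mat N))
  have hp := hk.bilinear (LinearMap.mul ℂ (Mat N)) (h.hasWeakDerivAt_inv hI ht h1 hu)
  simp only [LinearMap.mul_apply', LinearMap.mulRight_apply, h1, inv_one, Subgroup.coe_one,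
    Units.val_one, one_mul, mul_one, mul_neg, ← sub_eq_add_neg] at hp
  exact hp

theorem SmoothOnGroup.hasWeakDerivAt_Ad_inv (h : SmoothOnGroup κ I) (hI : IsOpen I) (ht : t ∈ I)
    (h1 : κ t = 1)
    (hu : ∀ i j, HasDerivAt (fun s => ((κ s : (Mat N)ˣ) : Mat N) i j) ((u : Mat N) i j) t) :
    HasWeakDerivAt (fun s => (Ad (κ s)⁻¹ : complexified gR →ₗ[ℂ] complexified gR))
      (-LieAlgebra.ad ℂ (complexified gR) u) t := by
  have hd := hasWeakDerivAt_dirDeriv hI h.inv.weakSmoothOn_Ad (hasDerivAt_id t) ht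
  exact (h.hasWeakDerivAt_Ad hI ht h1 hu).inv hd (fun s y => Ad_Ad_inv _ y)
    (fun y => by rw [h1]; exact Ad_one y)

end SmoothGroup

/-! ### Functionals vanishing on a Borel subalgebra -/

section Annihilator

open LieAlgebra LieModule

variable {L : Type*} [LieRing L] [LieAlgebra ℂ L] [FiniteDimensional ℂ L]
  {b : LieSubalgebra ℂ L} (c : CompactConj L)

include c in
theorem exists_perp_killing {g : Module.Dual ℂ L} (hg : ∀ y ∈ b, g y = 0) :
    ∃ ν ∈ perp b, ∀ y, killingForm ℂ L ν y = g y := by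
  have := c.isKilling
  let B := (killingForm ℂ L).toDual (IsKilling.killingForm_nondegenerate ℂ L)
  have hh : ∀ y, killingForm ℂ L (B.symm g) y = g y := fun y =>
    LinearMap.BilinForm.apply_toDual_symm_apply _ y
  exact ⟨B.symm g, fun y hy => (hh y).trans (hg y hy), hh⟩

variable (hb : Maximal (fun b : LieSubalgebra ℂ L => IsSolvable b) b)
  {f : b →ₗ[ℂ] ℂ} (hf : ∀ x y : b, f ⁅x, y⁆ = 0)
  (hreg : ∀ [(torus b c).IsCartanSubalgebra] (α : torus b c → ℂ), α ≠ 0 →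
    rootSpace (torus b c) α ≠ ⊥ →
    ∀ x ∈ corootSpace (R := ℂ) (L := L) (H := torus b c) α, x ≠ 0 → f ⟨x, x.2.1⟩ ≠ 0)
include hb hf hreg

/-- Through the Killing form the equation becomes `[h + ν, z] = -ν'` in `perp b`, where `ad (h + ν)`
is injective and hence surjective. -/
theorem exists_perp_apply_lie {g η : Module.Dual ℂ L} (hg : ∀ y ∈ b, g y = 0)
    (hη : ∀ y ∈ b, η y = 0) : ∃ z ∈ perp b, ∀ y, η y = -(g + extend c f) ⁅z, y⁆ := by
  obtain ⟨h, hh, hκ⟩ := exists_torus_killing c hb hf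
  obtain ⟨ν, hν, hνg⟩ := exists_perp_killing c hg
  obtain ⟨ν', hν', hνη⟩ := exists_perp_killing c hη
  have hmem : ∀ z ∈ perp b, ⁅h + ν, z⁆ ∈ perp b := fun z hz =>
    lie_mem_perp (b.add_mem hh.1 (perp_le hb hν)) hz
  let T : (perp b).toSubmodule →ₗ[ℂ] (perp b).toSubmodule :=
    (ad ℂ L (h + ν)).restrict hmem
  have hT : Function.Injective T := by
    rw [← LinearMap.ker_eq_bot, LinearMap.ker_eq_bot']
    intro z hz
    have h0 : ⁅h + ν, (z : L)⁆ = 0 := congrArg Subtype.val hz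
    exact Subtype.ext (eq_zero_of_lie_regular_add c hb hf hh hκ hreg hν z.2
      (by rw [← lie_skew, h0, neg_zero]))
  obtain ⟨z, hz⟩ := (LinearMap.injective_iff_surjective.mp hT) ⟨-ν', neg_mem hν'⟩
  have hz' : ⁅h + ν, (z : L)⁆ = -ν' := congrArg Subtype.val hz
  refine ⟨z, z.2, fun y => ?_⟩
  rw [LinearMap.add_apply, ← hκ, ← hνg, ← LinearMap.add_apply, ← map_add, add_comm ν h,
    ← traceForm_apply_lie_apply, hz', map_neg, LinearMap.neg_apply, neg_neg, hνη]

end Annihilator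

/-! ### The twist and the coadjoint orbit -/

section Twist

variable {N : ℕ} {gR : LieSubalgebra ℝ (Mat N)} (hgR : ∀ x ∈ gR, Complex.I • x ∈ gR → x = 0)
  (C : CartanDecomposition gR) (lam : UniversalWeight gR)

theorem FlagVariety.maximal (x : FlagVariety gR) : Maximal
    (fun b : LieSubalgebra ℂ (complexified gR) => LieAlgebra.IsSolvable b) x.borel := x.2

-- The projected weight satisfies both conditions defining the twist, and `eq_extend` says that
-- nothing else does, so the chosen functional is this one.
include hgR in
theorem twist_eq_extend (x : FlagVariety gR) :
    twist C lam x = extend (C.compactConj hgR) (lam.onBorel x) := by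
  have h := Classical.epsilon_spec (p := fun f : Module.Dual ℂ (complexified gR) =>
    (∀ t : x.borel, (t : complexified gR) ∈ C.compactForm → f t = lam.onBorel x t) ∧
    ∀ t ∈ x.borel, t ∈ C.compactForm → ∀ u ∈ C.compactForm, f ⁅t, u⁆ = 0)
    ⟨extend (C.compactConj hgR) (lam.onBorel x), fun t _ => extend_of_mem _ _ t.2,
      fun t ht ht' u _ => by
        rw [C.mem_compactForm hgR] at ht'
        exact extend_lie (C.compactConj hgR) x.maximal (lam.map_lie x)
          ((mem_torus _).mpr ⟨ht, by rw [ht']; exact ht⟩) u⟩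
  change (∀ t : x.borel, (t : complexified gR) ∈ C.compactForm →
      twist C lam x t = lam.onBorel x t) ∧
    ∀ t ∈ x.borel, t ∈ C.compactForm → ∀ u ∈ C.compactForm, twist C lam x ⁅t, u⁆ = 0 at h
  simp only [C.mem_compactForm hgR] at h
  exact eq_extend _ x.maximal (lam.map_lie x) h.1 h.2

theorem moment_apply_of_mem (p : CotangentBundle gR) {y : complexified gR}
    (hy : y ∈ p.proj.borel) : moment p y = 0 := by
  have : p.proj.borel.toSubmodule.mkQ y = 0 := (Submodule.Quotient.mk_eq_zero _).mpr hy
  change p.covec (p.proj.borel.toSubmodule.mkQ y) = 0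
  rw [this, map_zero]

variable {lam} (hlam : lam.IsRegular)

include hlam in
theorem UniversalWeight.IsRegular.torus (x : FlagVariety gR) [(torus x.borel
      (C.compactConj hgR)).IsCartanSubalgebra]
    (α : torus x.borel (C.compactConj hgR) → ℂ) (hα : α ≠ 0)
    (hr : LieAlgebra.rootSpace (torus x.borel (C.compactConj hgR)) α ≠ ⊥) :
    ∀ h ∈ LieAlgebra.corootSpace (R := ℂ) (L := complexified gR)
      (H := torus x.borel (C.compactConj hgR)) α, h ≠ 0 → lam.onBorel x ⟨h, h.2.1⟩ ≠ 0 :=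
  hlam x _ (fun _ h => ((mem_torus _).mp h).1) α hα hr

include hgR hlam in
/-- Functionals which vanish on `𝔟_x` are tangent to the coadjoint orbit of `μ_λ(p)`. -/
theorem exists_coad_twistedMoment (p : CotangentBundle gR) {η : Module.Dual ℂ (complexified gR)}
    (hη : ∀ y ∈ p.proj.borel, η y = 0) :
    ∃ z ∈ perp p.proj.borel, η = coad z (twistedMoment C lam p) := by
  obtain ⟨z, hz, e⟩ := exists_perp_apply_lie (C.compactConj hgR) p.proj.maximal (lam.map_lie _)
    (fun [_] => hlam.torus hgR C p.proj) (g := moment p) (fun y hy => moment_apply_of_mem p hy) hη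
  rw [← twist_eq_extend] at e
  exact ⟨z, hz, LinearMap.ext e⟩

-- The Killing dual of `μ_λ(p)` is `h + ν` with `ν ∈ perp b`; it is conjugate under `G` to `h`, the
-- dual of the twist at the same point `x`.
include hgR hlam in
theorem twistedMoment_mem_twistedOrbit (p : CotangentBundle gR) :
    twistedMoment C lam p ∈ twistedOrbit C lam := by
  obtain ⟨h, hh, hκ⟩ := exists_torus_killing (C.compactConj hgR) p.proj.maximal (lam.map_lie _)
  obtain ⟨ν, hν, hνg⟩ := exists_perp_killing (b := p.proj.borel) (C.compactConj hgR)
    (fun y hy => moment_apply_of_mem p hy)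
  obtain ⟨k, hk⟩ := regular_add_transitive (C.compactConj hgR) p.proj.maximal (lam.map_lie _) hh hκ
    (fun [_] => hlam.torus hgR C p.proj) (r := fun y y' => ∃ k : complexGroup gR, Ad k y = y')
    (fun y => ⟨1, Ad_one y⟩)
    (fun x y z ⟨k, hk⟩ ⟨k', hk'⟩ => ⟨k' * k, by rw [Ad_mul, hk, hk']⟩)
    (fun z _ y S hS => ⟨_, ⟨expGroup z, rfl⟩, Ad_expGroup_sub_mem z y S hS⟩) hν
  refine ⟨p.proj, k⁻¹, LinearMap.ext fun y => ?_⟩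
  have e : killingForm ℂ (complexified gR) h (Ad k y) =
      killingForm ℂ (complexified gR) (h + ν) y := by rw [← killingForm_Ad k (h + ν) y, hk]
  rw [coAd_apply, inv_inv, twistedMoment, twist_eq_extend hgR, LinearMap.add_apply, ← hκ, ← hκ,
    ← hνg, e, map_add, LinearMap.add_apply, add_comm]

end Twist

/-! ### The derivative of the twist -/

/-- Near `t` the map `M s` is invertible with differentiable inverse by Cramer's rule, so `F s = F t
∘ (M s)⁻¹` is differentiable; the product rule gives the value. -/
theorem HasWeakDerivAt.of_comp_eq {V W : Type*} [AddCommGroup V] [Module ℂ V]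
    [FiniteDimensional ℂ V] [AddCommGroup W] [Module ℂ W] [FiniteDimensional ℂ W]
    {F : ℝ → V →ₗ[ℂ] W} {M : ℝ → V →ₗ[ℂ] V} {M' : V →ₗ[ℂ] V} {t : ℝ}
    (hM : HasWeakDerivAt M M' t) (h1 : M t = LinearMap.id)
    (h : ∀ᶠ s in 𝓝 t, F s ∘ₗ M s = F t) : HasWeakDerivAt F (-(F t ∘ₗ M')) t := by
  let e := Module.finBasis ℂ V
  let A := fun s => LinearMap.toMatrix e e (M s)
  have hA : ∀ i j, DifferentiableAt ℝ (fun s => A s i j) t := fun i j =>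
    (hM (Matrix.entryLinearMap ℂ ℂ i j ∘ₗ (LinearMap.toMatrix e e).toLinearMap)).differentiableAt
  have hA1 : A t = 1 := by simp only [A, h1, LinearMap.toMatrix_id]
  have hdet : IsUnit (A t).det := by rw [hA1, Matrix.det_one]; exact isUnit_one
  have hev : ∀ᶠ s in 𝓝 t, IsUnit (A s).det := by
    filter_upwards [(differentiableAt_det hA).continuousAt.eventually_ne hdet.ne_zero] with s hs
    exact isUnit_iff_ne_zero.mpr hs
  have hG : HasWeakDerivAt (fun s => (A s)⁻¹)
      (Matrix.of fun i j => deriv (fun s => (A s)⁻¹ i j) t) t :=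
    HasWeakDerivAt.of_basis (Matrix.stdBasis ℂ _ _) fun i =>
      (differentiableAt_inv hA hdet i.1 i.2).hasDerivAt
  have hF := ((hG.linear (Matrix.toLin e e).toLinearMap).linear
    (LinearMap.llcomp ℂ V V W (F t))).congr (g := F) (by
      filter_upwards [h, hev] with s hs hu
      rw [LinearMap.llcomp_apply', ← hs, LinearMap.comp_assoc]
      have e1 : M s = Matrix.toLin e e (A s) := (Matrix.toLin_toMatrix e e (M s)).symm
      rw [e1, LinearEquiv.coe_coe, ← Matrix.toLin_mul, Matrix.mul_nonsing_inv _ hu,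
        Matrix.toLin_one, LinearMap.comp_id])
  have h0 := (hF.comp hM).unique ((HasWeakDerivAt.const (F t) t).congr h)
  rw [h1, LinearMap.comp_id] at h0
  rw [neg_eq_of_add_eq_zero_left h0]
  exact hF

section Abstract

open LieAlgebra LieModule

variable {L : Type*} [LieRing L] [LieAlgebra ℂ L] [FiniteDimensional ℂ L]
  {b : LieSubalgebra ℂ L} (c : CompactConj L)

/-- The complex linear endomorphism `conj ∘ A ∘ conj`. -/
def CompactConj.conjugate (A : L →ₗ[ℂ] L) : L →ₗ[ℂ] L where
  toFun x := c.conj (A (c.conj x))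
  map_add' x y := by simp
  map_smul' r x := by simp

variable (hb : Maximal (fun b : LieSubalgebra ℂ L => IsSolvable b) b)
  {f : b →ₗ[ℂ] ℂ} (hf : ∀ x y : b, f ⁅x, y⁆ = 0)
include hb hf

/-- The moving twist is prescribed on `K s b` and vanishes on `conj (K s (perp b))`. Hence its
composite with `K s ∘ P + (conj ∘ K s ∘ conj) ∘ Q` is constant, where `Q = 1 - P`, and `of_comp_eq`
applies. The curve lies in `G`, not in the compact group, so `u` has to be replaced by `v ∈ u + b`
at the end. -/
theorem hasWeakDerivAt_of_conjugate {K : ℝ → L →ₗ[ℂ] L} {t : ℝ} {u v : L}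
    (hK : HasWeakDerivAt K (ad ℂ L u) t) (h1 : K t = LinearMap.id) (hv : c.conj v = v)
    (huv : u - v ∈ b) {F : ℝ → Module.Dual ℂ L} (hFt : F t = extend c f)
    (hF : ∀ᶠ s in 𝓝 t, (∀ y ∈ b, F s (K s y) = extend c f y) ∧
      ∀ y ∈ perp b, F s (c.conj (K s y)) = 0) :
    HasWeakDerivAt F (-(extend c f ∘ₗ ad ℂ L v)) t := by
  let P := proj b c
  let Q : L →ₗ[ℂ] L := LinearMap.id - P
  have hQ : ∀ x, Q x ∈ conjPerp b c := sub_proj_mem c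
  have hcK : HasWeakDerivAt (fun s => c.conjugate (K s)) (ad ℂ L (c.conj u)) t := by
    refine HasWeakDerivAt.of_apply fun x => ?_
    have h := ((hK.apply (HasWeakDerivAt.const (c.conj x) t))).antilinear c.conj
    have e : ad ℂ L (c.conj u) x =
        c.conj ((ad ℂ L u) (c.conj x) + (K t) 0) := by
      rw [map_zero, add_zero, ad_apply, ad_apply, c.conj_lie, c.conj_conj]
    rw [e]
    exact h
  have hM : HasWeakDerivAt (fun s => K s ∘ₗ P + c.conjugate (K s) ∘ₗ Q)
      (ad ℂ L u ∘ₗ P + ad ℂ L (c.conj u) ∘ₗ Q) t :=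
    (hK.linear (LinearMap.lcomp ℂ L P)).add (hcK.linear (LinearMap.lcomp ℂ L Q))
  have h := hM.of_comp_eq (F := F) (by
    rw [h1]
    ext x
    change P x + c.conj (c.conj (x - P x)) = x
    rw [c.conj_conj]
    abel) (by
    filter_upwards [hF] with s hs
    ext x
    change F s (K s (P x) + c.conj (K s (c.conj (Q x)))) = F t x
    rw [map_add, hs.1 _ (proj_mem c x), hs.2 _ (hQ x), add_zero, hFt, extend_of_mem c f
      (proj_mem c x), extend_apply])
  rw [hFt] at h
  convert h using 2
  ext x
  change extend c f ⁅v, x⁆ = extend c f (⁅u, P x⁆ + ⁅c.conj u, Q x⁆)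
  -- Replacing `u` by `v` costs nothing: on `b` because `f` kills `[b, b]`, and on `conj (perp b)`
  -- because `conj (u - v) ∈ conj b` preserves that space.
  have e1 : extend c f ⁅u - v, P x⁆ = 0 := by
    rw [extend_of_mem c f (b.lie_mem huv (proj_mem c x))]
    exact hf ⟨_, huv⟩ ⟨_, proj_mem c x⟩
  have e2 : extend c f ⁅c.conj (u - v), Q x⁆ = 0 :=
    extend_of_mem_conjPerp c f (lie_mem_conjPerp c hb (by rw [c.conj_conj]; exact huv) (hQ x))
  rw [map_sub, hv, sub_lie, map_sub, sub_eq_zero] at e2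
  rw [sub_lie, map_sub, sub_eq_zero] at e1
  rw [map_add, e1, e2, ← map_add, ← lie_add]
  congr 2
  change x = P x + (x - P x)
  abel

-- This is `𝔤 = 𝔲_ℝ + b`: the component of `u` along `conj (perp b)` plus its own conjugate is real,
-- and that conjugate lies in `perp b ⊆ b`.
omit hf in
theorem exists_fixed_sub_mem (u : L) : ∃ v, c.conj v = v ∧ u - v ∈ b := by
  have h := sub_proj_mem (b := b) c u
  refine ⟨(u - proj b c u) + c.conj (u - proj b c u), ?_, ?_⟩
  · rw [map_add, c.conj_conj, add_comm]
  · have e : u - (u - proj b c u + c.conj (u - proj b c u)) =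
        proj b c u - c.conj (u - proj b c u) := by abel
    rw [e]
    exact b.sub_mem (proj_mem c u) (perp_le hb h)

end Abstract

theorem dualVelocity_iff {N : ℕ} {gR : LieSubalgebra ℝ (Mat N)}
    {f : ℝ → Module.Dual ℂ (complexified gR)} {t : ℝ} {α : Module.Dual ℂ (complexified gR)} :
    DualVelocity f t α ↔ HasWeakDerivAt f α t := by
  refine ⟨fun h => HasWeakDerivAt.of_apply fun y φ => ?_, fun h y =>
    h (LinearMap.applyₗ y)⟩
  have e : ∀ z, φ z = z * φ 1 := fun z => by
    conv_lhs => rw [← mul_one z, ← smul_eq_mul, map_smul, smul_eq_mul]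
  rw [e, funext fun s => e (f s y)]
  exact (h y).mul_const _

section Twist

variable {N : ℕ} {gR : LieSubalgebra ℝ (Mat N)} (hgR : ∀ x ∈ gR, Complex.I • x ∈ gR → x = 0)
  (C : CartanDecomposition gR) (lam : UniversalWeight gR)

theorem FlagVariety.vec_eq_vec_iff {x : FlagVariety gR} {u v : complexified gR} :
    x.vec u = x.vec v ↔ u - v ∈ x.borel := Submodule.Quotient.eq _

include hgR

theorem exists_compactForm_vec {x : FlagVariety gR} (a : x.Tangent) :
    ∃ v ∈ C.compactForm, a = x.vec v := by
  obtain ⟨u, rfl⟩ := Submodule.Quotient.mk_surjective _ a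
  obtain ⟨v, hv, h⟩ := exists_fixed_sub_mem (C.compactConj hgR) x.maximal u
  exact ⟨v, (C.mem_compactForm hgR).mpr hv, FlagVariety.vec_eq_vec_iff.mpr h⟩

theorem dualVelocity_twist {c : ℝ → FlagVariety gR} {t : ℝ} {x : FlagVariety gR}
    {v : complexified gR} (hv : v ∈ C.compactForm) (h : FlagVelocity c t (x.vec v)) :
    DualVelocity (fun s => twist C lam (c s)) t (coad v (twist C lam x)) := by
  obtain ⟨hx, I, hI, ht, k, hk, h1, hkx, u, hu, huv⟩ := h
  rw [dualVelocity_iff, twist_eq_extend hgR]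
  refine hasWeakDerivAt_of_conjugate (C.compactConj hgR) x.maximal (lam.map_lie x)
    (hk.hasWeakDerivAt_Ad hI ht h1 hu) (LinearMap.ext fun y => by rw [h1]; exact Ad_one y)
    ((C.mem_compactForm hgR).mp hv) (FlagVariety.vec_eq_vec_iff.mp huv.symm)
    (by rw [hx, twist_eq_extend hgR]) ?_
  filter_upwards [hI.mem_nhds ht] with s hs
  simp only [twist_eq_extend hgR]
  refine ⟨fun y hy => ?_, fun y hy => ?_⟩
  · have hmem : Ad (k s) y ∈ (c s).borel := (hkx s hs).Ad_mem_iff.mpr hy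
    rw [extend_of_mem _ _ hy]
    exact (extend_of_mem _ _ hmem).trans
      (lam.equivariant (k s) x (c s) (hkx s hs) ⟨y, hy⟩ ⟨_, hmem⟩ rfl)
  · refine extend_of_mem_conjPerp _ _ ((mem_conjPerp _).mpr ?_)
    rw [(C.compactConj hgR).conj_conj, mem_perp]
    intro z hz
    have hz' := mem_perp.mp hy _ ((hkx s hs).mem_iff.mp hz)
    rw [← killingForm_Ad (k s), Ad_Ad_inv] at hz'
    exact hz'

theorem dTwistedMoment_eq {p : CotangentBundle gR} {V : p.Ambient} (hV : V ∈ p.tangentSpace)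
    {v : complexified gR} (hv : v ∈ C.compactForm) (hVv : V.base = p.proj.vec v) :
    dTwistedMoment C lam V = V.dual + coad v (twist C lam p.proj) := by
  have h : ∀ c : ℝ → CotangentBundle gR, SmoothCotangent c → CotangentVelocity c 0 V →
      DualVelocity (fun s => twistedMoment C lam (c s)) 0
        (V.dual + coad v (twist C lam p.proj)) := by
    intro c _ hcV
    have h1 := dualVelocity_twist hgR C lam hv (hVv ▸ hcV.2.1)
    exact fun y => (hcV.2.2 y).add (h1 y)
  have h' := Classical.epsilon_spec (p := fun α => ∀ c : ℝ → CotangentBundle gR,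
    SmoothCotangent c → CotangentVelocity c 0 V →
      DualVelocity (fun s => twistedMoment C lam (c s)) 0 α) ⟨_, h⟩
  obtain ⟨c, hc, hcV⟩ := hV
  exact LinearMap.ext fun y => (h' c hc hcV y).unique (h c hc hcV y)

end Twist

/-! ### The forms on the orbit and on the flag variety -/

section Forms

variable {N : ℕ} {gR : LieSubalgebra ℝ (Mat N)}

theorem coad_apply (u : complexified gR) (ζ : Module.Dual ℂ (complexified gR))
    (y : complexified gR) : coad u ζ y = -ζ ⁅u, y⁆ := rfl

/-- The value `ζ[u, v]` depends on `u` only through `ad*_u ζ`, and likewise for `v`; so the number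
chosen in the definition is determined. -/
theorem kirillovKostant_coad (ζ : Module.Dual ℂ (complexified gR)) (u v : complexified gR) :
    kirillovKostant ζ (coad u ζ) (coad v ζ) = ζ ⁅u, v⁆ := by
  have h : ∀ u' v', coad u ζ = coad u' ζ → coad v ζ = coad v' ζ → ζ ⁅u, v⁆ = ζ ⁅u', v'⁆ := by
    intro u' v' hu hv
    have h1 := LinearMap.congr_fun hu v
    have h2 := LinearMap.congr_fun hv u'
    rw [coad_apply, coad_apply, neg_inj] at h1 h2
    rw [h1, ← lie_skew, map_neg, h2, ← map_neg, lie_skew]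
  have h' := Classical.epsilon_spec (p := fun c : ℂ => ∀ u' v', coad u ζ = coad u' ζ →
    coad v ζ = coad v' ζ → c = ζ ⁅u', v'⁆) ⟨_, h⟩
  exact h' u v rfl rfl

theorem tau_vec (hgR : ∀ x ∈ gR, Complex.I • x ∈ gR → x = 0) (C : CartanDecomposition gR)
    (lam : UniversalWeight gR) (x : FlagVariety gR) {u v : complexified gR}
    (hu : u ∈ C.compactForm) (hv : v ∈ C.compactForm) :
    tau C lam (x.vec u) (x.vec v) = twist C lam x ⁅u, v⁆ := by
  -- Two representatives in `𝔲_ℝ` differ by an element of `𝔲_ℝ ∩ b`, which lies in the torus, and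
  -- the twist kills all brackets with the torus.
  have hlie : ∀ u ∈ C.compactForm, ∀ u' ∈ C.compactForm, x.vec u = x.vec u' → ∀ y,
      twist C lam x ⁅u, y⁆ = twist C lam x ⁅u', y⁆ := by
    intro u hu u' hu' h y
    rw [C.mem_compactForm hgR] at hu hu'
    have hb := FlagVariety.vec_eq_vec_iff.mp h
    have h0 := extend_lie (C.compactConj hgR) x.maximal (lam.map_lie x)
      (s := u - u') ((mem_torus _).mpr ⟨hb, by rw [map_sub, hu, hu']; exact hb⟩) y
    rw [sub_lie, map_sub, sub_eq_zero] at h0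
    rw [twist_eq_extend hgR]
    exact h0
  have h : ∀ u' ∈ C.compactForm, ∀ v' ∈ C.compactForm, x.vec u = x.vec u' →
      x.vec v = x.vec v' → twist C lam x ⁅u, v⁆ = twist C lam x ⁅u', v'⁆ := by
    intro u' hu' v' hv' h1 h2
    rw [hlie u hu u' hu' h1, ← lie_skew, map_neg, hlie v hv v' hv' h2, ← map_neg, lie_skew]
  have h' := Classical.epsilon_spec (p := fun c : ℂ => ∀ u' ∈ C.compactForm,
    ∀ v' ∈ C.compactForm, x.vec u = x.vec u' → x.vec v = x.vec v' →
      c = twist C lam x ⁅u', v'⁆) ⟨_, h⟩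
  exact h' u hu v hv rfl rfl

end Forms

/-! ### Velocities in the cotangent bundle -/

section Velocity

variable {N : ℕ} {gR : LieSubalgebra ℝ (Mat N)}

theorem liouville_eq {p : CotangentBundle gR} {V : p.Ambient} {v : complexified gR}
    (h : V.base = p.proj.vec v) : liouville V = moment p v := by
  rw [liouville, h]; rfl

/-- Along the curve `μ(c(s))` vanishes on `Ad k(s) y` for `y ∈ b`; differentiate this identity. -/
theorem CotangentVelocity.dual_apply {c : ℝ → CotangentBundle gR} {t : ℝ}
    {p : CotangentBundle gR} {V : p.Ambient} (h : CotangentVelocity c t V) {v : complexified gR}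
    (hv : V.base = p.proj.vec v) {y : complexified gR} (hy : y ∈ p.proj.borel) :
    V.dual y = -moment p ⁅v, y⁆ := by
  obtain ⟨hp, ⟨-, I, hI, ht, k, hk, h1, hkx, u, hu, huv⟩, hdual⟩ := h
  have hA := (hk.hasWeakDerivAt_Ad hI ht h1 hu).apply (HasWeakDerivAt.const y t)
  have hd := (dualVelocity_iff.mp hdual).apply hA
  have h0 : HasWeakDerivAt (fun s => moment (c s) ((Ad (k s) : complexified gR →ₗ[ℂ] _) y)) 0 t := by
    refine (HasWeakDerivAt.const (0 : ℂ) t).congr ?_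
    filter_upwards [hI.mem_nhds ht] with s hs
    exact moment_apply_of_mem _ ((hkx s hs).Ad_mem_iff.mpr hy)
  have e := hd.unique h0
  have e1 : (Ad (k t) : complexified gR →ₗ[ℂ] complexified gR) y = y := by
    rw [h1]; exact Ad_one y
  rw [e1, hp, map_zero, add_zero, LieAlgebra.ad_apply] at e
  rw [eq_neg_of_add_eq_zero_left e, neg_inj]
  have hmem := p.proj.borel.lie_mem (FlagVariety.vec_eq_vec_iff.mp (hv.symm.trans huv)) hy
  rw [sub_lie] at hmem
  have h2 := moment_apply_of_mem p hmem
  rw [map_sub, sub_eq_zero] at h2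
  exact h2.symm

/-- The velocity of the curve `s ↦ k(s) · x` is the class of the logarithmic derivative of `k`. -/
theorem FlagVelocity.eq_vec {c : ℝ → FlagVariety gR} {t : ℝ} {x x₀ : FlagVariety gR}
    {a : x.Tangent} (h : FlagVelocity c t a)
    {k : ℝ → complexGroup gR} {w : complexified gR}
    (hk : ∀ᶠ s in 𝓝 t, IsTranslate (k s) x₀ (c s))
    (hw : HasWeakDerivAt (fun s => (Ad (k s) : complexified gR →ₗ[ℂ] complexified gR))
      (LieAlgebra.ad ℂ (complexified gR) w ∘ₗ (Ad (k t) : complexified gR →ₗ[ℂ] complexified gR))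
      t) : a = x.vec w := by
  obtain ⟨hx, I, hI, ht, k', hk', h1, hkx, u, hu, rfl⟩ := h
  refine (FlagVariety.vec_eq_vec_iff.mpr ?_).symm
  refine mem_of_normalizes x.maximal fun y hy => ?_
  -- Two lifts of the same curve differ by maps preserving `b`. Differentiating shows that `w - u`
  -- normalizes `b`, so it lies in `b`.
  have hd := (hk'.hasWeakDerivAt_Ad_inv hI ht h1 hu).apply
    (hw.apply (HasWeakDerivAt.const (Ad (k t)⁻¹ y) t))
  have hm := hd.mem x.borel.toSubmodule (by
    filter_upwards [hk, hI.mem_nhds ht] with s hs hsI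
    refine (hkx s hsI).mem_iff.mp (hs.Ad_mem_iff.mpr ?_)
    exact (hx ▸ hk.self_of_nhds).mem_iff.mp hy)
  have e1 : (Ad (k t) : complexified gR →ₗ[ℂ] complexified gR) (Ad (k t)⁻¹ y) = y := Ad_Ad_inv _ y
  have e2 : ∀ z, (Ad (k' t)⁻¹ : complexified gR →ₗ[ℂ] complexified gR) z = z := by
    intro z
    rw [h1, inv_one]
    exact Ad_one z
  rw [map_zero, add_zero, e2, LinearMap.comp_apply, e1, LinearMap.neg_apply, LieAlgebra.ad_apply,
    LieAlgebra.ad_apply, neg_add_eq_sub, ← sub_lie] at hm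
  exact hm

end Velocity

/-! ### Logarithmic derivatives of families of automorphisms -/

section LogDeriv

open LieAlgebra LieModule

variable {L : Type*} [LieRing L] [LieAlgebra ℂ L] [FiniteDimensional ℂ L]
  {E : Type*} [NormedAddCommGroup E] [NormedSpace ℝ E] {U : Set E} {z : E}

theorem hasWeakDerivAt_line {V : Type*} [AddCommGroup V] [Module ℂ V] [FiniteDimensional ℂ V]
    {f : E → V} (hU : IsOpen U) (hf : WeakSmoothOn f U) (hz : z ∈ U) (u : E) :
    HasWeakDerivAt (fun s : ℝ => f (z + s • u)) (dirDeriv f u z) 0 := by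
  have hγ : HasDerivAt (fun s : ℝ => z + s • u) u 0 := by
    simpa using ((hasDerivAt_id (0 : ℝ)).smul_const u).const_add z
  have h := hasWeakDerivAt_dirDeriv hU hf hγ (by simpa using hz)
  simpa using h

variable [IsKilling ℂ L] {K : E → L →ₗ⁅ℂ⁆ L} {Kinv : E → L →ₗ[ℂ] L}
  (hU : IsOpen U) (hK : WeakSmoothOn (fun z => (K z : L →ₗ[ℂ] L)) U)
  (hKinv : WeakSmoothOn Kinv U) (h1 : ∀ z y, K z (Kinv z y) = y) (h2 : ∀ z y, Kinv z (K z y) = y)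
include hU hK hKinv h1 h2

/-- For a family of automorphisms, `(dK) K⁻¹` is a derivation, and derivations of a Killing Lie
algebra are inner. A linear left inverse of `ad` makes the resulting element smooth in `z`. -/
theorem exists_logDeriv (e : E) : ∃ a : E → L, WeakSmoothOn a U ∧
    ∀ z ∈ U, dirDeriv (fun z => (K z : L →ₗ[ℂ] L)) e z = ad ℂ L (a z) ∘ₗ (K z : L →ₗ[ℂ] L) := by
  have hinj : LinearMap.ker (ad ℂ L : L →ₗ[ℂ] Module.End ℂ L) = ⊥ := by
    rw [LinearMap.ker_eq_bot']
    intro x hx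
    have := (LieHom.mem_ker (f := ad ℂ L) (x := x)).mpr hx
    rw [LieAlgebra.ad_ker_eq_bot_of_hasTrivialRadical] at this
    exact this
  obtain ⟨S, hS⟩ := (ad ℂ L : L →ₗ[ℂ] Module.End ℂ L).exists_leftInverse_of_injective hinj
  have hdK := hK.dirDeriv hU e
  refine ⟨fun z => S (dirDeriv (fun z => (K z : L →ₗ[ℂ] L)) e z ∘ₗ Kinv z),
    (hdK.comp hKinv).linear S, fun z hz => ?_⟩
  set D := dirDeriv (fun z => (K z : L →ₗ[ℂ] L)) e z with hD
  have hline := hasWeakDerivAt_line hU hK hz e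
  have hlie : ∀ x y, D ⁅x, y⁆ = ⁅D x, K z y⁆ + ⁅K z x, D y⁆ := by
    intro x y
    have hx := hline.apply (HasWeakDerivAt.const x 0)
    have hy := hline.apply (HasWeakDerivAt.const y 0)
    have hxy := hline.apply (HasWeakDerivAt.const ⁅x, y⁆ 0)
    have hb := hx.bilinear (ad ℂ L : L →ₗ[ℂ] Module.End ℂ L) hy
    have e := hxy.unique (hb.congr (Filter.Eventually.of_forall fun s => LieHom.map_lie _ x y))
    simpa using e
  let δ : LieDerivation ℂ L L :=
    { toLinearMap := D ∘ₗ Kinv z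
      leibniz' := by
        intro x y
        have hk : Kinv z ⁅x, y⁆ = ⁅Kinv z x, Kinv z y⁆ := by
          rw [← h2 z ⁅Kinv z x, Kinv z y⁆, LieHom.map_lie, h1, h1]
        rw [LinearMap.comp_apply, hk, hlie, h1, h1, ← lie_skew y]
        simp [add_comm, sub_eq_add_neg] }
  obtain ⟨a, ha⟩ := LieDerivation.IsKilling.exists_eq_ad δ
  have ha' : D ∘ₗ Kinv z = ad ℂ L a := by
    ext y
    have e := LieDerivation.congr_fun ha y
    rw [LieDerivation.ad_apply_apply] at e
    exact e.symm
  change D = ad ℂ L (S (D ∘ₗ Kinv z)) ∘ₗ _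
  have hSa : S (ad ℂ L a) = a := LinearMap.congr_fun hS a
  rw [ha', hSa, ← ha']
  ext y
  change D y = D (Kinv z (K z y))
  rw [h2]

-- The Maurer–Cartan equation: the mixed second derivatives of `K` agree, and `𝔤` has trivial
-- centre, so an identity of adjoint operators is one of elements.
omit hKinv h2 in
theorem dirDeriv_logDeriv {e e' : E} {a a' : E → L} (ha : WeakSmoothOn a U)
    (ha' : WeakSmoothOn a' U)
    (h : ∀ z ∈ U, dirDeriv (fun z => (K z : L →ₗ[ℂ] L)) e z =
      ad ℂ L (a z) ∘ₗ (K z : L →ₗ[ℂ] L))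
    (h' : ∀ z ∈ U, dirDeriv (fun z => (K z : L →ₗ[ℂ] L)) e' z =
      ad ℂ L (a' z) ∘ₗ (K z : L →ₗ[ℂ] L)) (hz : z ∈ U) :
    dirDeriv a' e z - dirDeriv a e' z = ⁅a z, a' z⁆ := by
  have key : ∀ {e e' : E} {a a' : E → L}, WeakSmoothOn a U → WeakSmoothOn a' U →
      (∀ z ∈ U, dirDeriv (fun z => (K z : L →ₗ[ℂ] L)) e z = ad ℂ L (a z) ∘ₗ (K z : L →ₗ[ℂ] L)) →
      (∀ z ∈ U, dirDeriv (fun z => (K z : L →ₗ[ℂ] L)) e' z =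
        ad ℂ L (a' z) ∘ₗ (K z : L →ₗ[ℂ] L)) → ∀ y,
      dirDeriv (dirDeriv (fun z => (K z : L →ₗ[ℂ] L)) e') e z (Kinv z y) =
        ⁅dirDeriv a' e z, y⁆ + ⁅a' z, ⁅a z, y⁆⁆ := by
    intro e e' a a' _ ha' h h' y
    have hl := hasWeakDerivAt_line hU hK hz e
    have hr := ((hasWeakDerivAt_line hU ha' hz e).linear (ad ℂ L : L →ₗ[ℂ] Module.End ℂ L)).comp hl
    have hev : ∀ᶠ s : ℝ in 𝓝 0, z + s • e ∈ U := by
      have hc : Filter.Tendsto (fun s : ℝ => z + s • e) (𝓝 0) (𝓝 (z + (0 : ℝ) • e)) :=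
        (continuous_const.add (continuous_id.smul continuous_const)).tendsto 0
      rw [zero_smul, add_zero] at hc
      exact hc (hU.mem_nhds hz)
    have hd := (hasWeakDerivAt_line hU (hK.dirDeriv hU e') hz e).unique (hr.congr (by
      filter_upwards [hev] with s hs
      exact h' _ hs))
    rw [hd, h z hz]
    simp [h1]
  have hc := dirDeriv_comm hU hK hz e' e
  rw [← sub_eq_zero]
  have hcenter : ∀ x : L, (∀ y : L, ⁅x, y⁆ = 0) → x = 0 := by
    intro x hx
    have : x ∈ (ad ℂ L).ker := (LieHom.mem_ker (f := ad ℂ L)).mpr (LinearMap.ext hx)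
    rw [LieAlgebra.ad_ker_eq_bot_of_hasTrivialRadical] at this
    exact this
  refine hcenter _ fun y => ?_
  have e1 := LinearMap.congr_fun hc (Kinv z y)
  rw [key ha ha' h h', key ha' ha h' h] at e1
  rw [sub_lie, sub_lie, lie_lie]
  rw [eq_sub_of_add_eq e1]
  abel

end LogDeriv

/-! ### The canonical symplectic form -/

section CanonicalForm

variable {N : ℕ} {gR : LieSubalgebra ℝ (Mat N)}

/-- With `a`, `b` the logarithmic derivatives of a lift to `G`, the Liouville form on the partial
velocities is `μ(a)` and `μ(b)`. Differentiating produces `μ(∂₁b - ∂₂a)`, which Maurer–Cartan turns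
into `μ[a, b]`. -/
theorem deriv_liouville_sub [LieAlgebra.IsKilling ℂ (complexified gR)] {p : CotangentBundle gR}
    {V W : p.Ambient} {v w : complexified gR} (hv : V.base = p.proj.vec v)
    (hw : W.base = p.proj.vec w) {φ : ℝ × ℝ → CotangentBundle gR}
    {V₁ V₂ : ∀ z, (φ z).Ambient} (hφ : SmoothCotangent φ)
    (h₁ : ∀ z, CotangentVelocity (fun s => φ (s, z.2)) z.1 (V₁ z))
    (h₂ : ∀ z, CotangentVelocity (fun s => φ (z.1, s)) z.2 (V₂ z))
    (hV : CotangentVelocity (fun s => φ (s, 0)) 0 V)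
    (hW : CotangentVelocity (fun s => φ (0, s)) 0 W) :
    deriv (fun s : ℝ => liouville (V₂ (s, 0))) 0 - deriv (fun s : ℝ => liouville (V₁ (0, s))) 0 =
      V.dual w - W.dual v + moment p ⁅v, w⁆ := by
  obtain ⟨U, hU, h0, k, hk, hkx⟩ := hφ.1 (0, 0)
  have hK := hk.weakSmoothOn_Ad
  have hKinv := hk.inv.weakSmoothOn_Ad
  obtain ⟨a, ha, haK⟩ := exists_logDeriv hU hK hKinv (fun z y => Ad_Ad_inv (k z) y)
    (fun z y => Ad_inv_Ad (k z) y) (1, 0)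
  obtain ⟨b, hb, hbK⟩ := exists_logDeriv hU hK hKinv (fun z y => Ad_Ad_inv (k z) y)
    (fun z y => Ad_inv_Ad (k z) y) (0, 1)
  have hγ₁ : ∀ z : ℝ × ℝ, HasDerivAt (fun s : ℝ => (s, z.2)) (1, 0) z.1 := fun z =>
    (hasDerivAt_id z.1).prodMk (hasDerivAt_const z.1 z.2)
  have hγ₂ : ∀ z : ℝ × ℝ, HasDerivAt (fun s : ℝ => (z.1, s)) (0, 1) z.2 := fun z =>
    (hasDerivAt_const z.2 z.1).prodMk (hasDerivAt_id z.2)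
  have hev₁ : ∀ z ∈ U, ∀ᶠ s in 𝓝 z.1, (s, z.2) ∈ U := fun z hz =>
    (hγ₁ z).continuousAt.eventually_mem (hU.mem_nhds hz)
  have hev₂ : ∀ z ∈ U, ∀ᶠ s in 𝓝 z.2, (z.1, s) ∈ U := fun z hz =>
    (hγ₂ z).continuousAt.eventually_mem (hU.mem_nhds hz)
  have hbase₁ : ∀ z ∈ U, ∀ x (α : FlagVariety.Tangent x),
      FlagVelocity (fun s => (φ (s, z.2)).proj) z.1 α → α = x.vec (a z) := by
    intro z hz x α h
    refine h.eq_vec (x₀ := (φ (0, 0)).proj) (k := fun s => k (s, z.2)) ?_ ?_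
    · filter_upwards [hev₁ z hz] with s hs using hkx _ hs
    · rw [← haK z hz]
      exact hasWeakDerivAt_dirDeriv hU hK (hγ₁ z) hz
  have hbase₂ : ∀ z ∈ U, ∀ x (α : FlagVariety.Tangent x),
      FlagVelocity (fun s => (φ (z.1, s)).proj) z.2 α → α = x.vec (b z) := by
    intro z hz x α h
    refine h.eq_vec (x₀ := (φ (0, 0)).proj) (k := fun s => k (z.1, s)) ?_ ?_
    · filter_upwards [hev₂ z hz] with s hs using hkx _ hs
    · rw [← hbK z hz]
      exact hasWeakDerivAt_dirDeriv hU hK (hγ₂ z) hz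
  have hp₁ : φ (0, 0) = p := hV.1
  have hd₁ : HasDerivAt (fun s : ℝ => liouville (V₂ (s, 0)))
      (V.dual (b (0, 0)) + moment p (dirDeriv b (1, 0) (0, 0))) 0 := by
    have h := (dualVelocity_iff.mp hV.2.2).apply
      (hasWeakDerivAt_dirDeriv hU hb (hγ₁ (0, 0)) h0) LinearMap.id
    refine (h.congr_deriv (by simp [hp₁])).congr_of_eventuallyEq ?_
    filter_upwards [hev₁ (0, 0) h0] with s hs
    exact liouville_eq (hbase₂ (s, 0) hs _ _ (h₂ (s, 0)).2.1)
  have hd₂ : HasDerivAt (fun s : ℝ => liouville (V₁ (0, s)))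
      (W.dual (a (0, 0)) + moment p (dirDeriv a (0, 1) (0, 0))) 0 := by
    have h := (dualVelocity_iff.mp hW.2.2).apply
      (hasWeakDerivAt_dirDeriv hU ha (hγ₂ (0, 0)) h0) LinearMap.id
    refine (h.congr_deriv (by simp [hp₁])).congr_of_eventuallyEq ?_
    filter_upwards [hev₂ (0, 0) h0] with s hs
    exact liouville_eq (hbase₁ (0, s) hs _ _ (h₁ (0, s)).2.1)
  rw [hd₁.deriv, hd₂.deriv]
  have hVa := hbase₁ (0, 0) h0 _ _ hV.2.1
  have hWb := hbase₂ (0, 0) h0 _ _ hW.2.1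
  have hmem₁ := FlagVariety.vec_eq_vec_iff.mp (hv.symm.trans hVa)
  have hmem₂ := FlagVariety.vec_eq_vec_iff.mp (hw.symm.trans hWb)
  have hc := dirDeriv_logDeriv hU hK (fun z y => Ad_Ad_inv (k z) y) ha hb haK hbK h0
  have e := congrArg (moment p) hc
  -- At the origin `a`, `b` agree with `v`, `w` only modulo the Borel subalgebra; `dual_apply`
  -- evaluates the differences.
  have e1 := hV.dual_apply hv hmem₂
  have e2 := hW.dual_apply hWb hmem₁
  rw [map_sub] at e
  simp only [map_sub, lie_sub] at e1 e2
  have s1 : moment p ⁅b (0, 0), v⁆ = -moment p ⁅v, b (0, 0)⁆ := by rw [← lie_skew, map_neg]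
  have s2 : moment p ⁅b (0, 0), a (0, 0)⁆ = -moment p ⁅a (0, 0), b (0, 0)⁆ := by
    rw [← lie_skew, map_neg]
  linear_combination e - e1 + e2 + s2 - s1

theorem CotangentBundle.ext_moment {p q : CotangentBundle gR} (h : p.proj = q.proj)
    (h' : moment p = moment q) : p = q := by
  obtain ⟨x, ξ⟩ := p
  obtain ⟨y, ξ'⟩ := q
  obtain rfl : x = y := h
  congr 1
  refine Submodule.linearMap_qext _ ?_
  exact h'

/-- The covector at `x` given by a functional which vanishes on `𝔟_x`. -/
def CotangentBundle.ofDual (x : FlagVariety gR) (g : Module.Dual ℂ (complexified gR))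
    (hg : ∀ y ∈ x.borel, g y = 0) : CotangentBundle gR :=
  ⟨x, x.borel.toSubmodule.liftQ g hg⟩

theorem moment_ofDual (x : FlagVariety gR) (g : Module.Dual ℂ (complexified gR))
    (hg : ∀ y ∈ x.borel, g y = 0) : moment (CotangentBundle.ofDual x g hg) = g :=
  Submodule.liftQ_mkQ _ _ _

theorem exists_dualVelocity {f : ℝ → Module.Dual ℂ (complexified gR)} {t : ℝ}
    (h : ∀ y, DifferentiableAt ℝ (fun s => f s y) t) : ∃ α, DualVelocity f t α := by
  refine ⟨{ toFun := fun y => deriv (fun s => f s y) t, map_add' := ?_, map_smul' := ?_ },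
    fun y => (h y).hasDerivAt⟩
  · intro y z
    simp only [map_add]
    exact ((h y).hasDerivAt.add (h z).hasDerivAt).deriv
  · intro r y
    simp only [map_smul, smul_eq_mul]
    exact ((h y).hasDerivAt.const_mul r).deriv

theorem expGroup_zero : expGroup (0 : complexified gR) = 1 := by
  ext1
  ext1
  rw [coe_expGroup]
  simp

theorem expGroup_add_smul (s t : ℂ) (v : complexified gR) :
    expGroup ((s + t) • v) = expGroup (s • v) * expGroup (t • v) := by
  ext1
  ext1
  rw [coe_expGroup, Subgroup.coe_mul, Units.val_mul, coe_expGroup, coe_expGroup, add_smul]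
  exact Matrix.exp_add_of_commute _ _
    (((Commute.refl (v : Mat N)).smul_left s).smul_right t)

theorem smoothOnGroup_expGroup {E : Type*} [NormedAddCommGroup E] [NormedSpace ℝ E] {f : E → ℝ}
    (hf : ContDiff ℝ ∞ f) (v : complexified gR) :
    SmoothOnGroup (fun z => expGroup ((f z : ℂ) • v)) Set.univ := fun i j =>
  ((contDiff_exp_smul_entry (v : Mat N) i j).comp hf).contDiffOn

theorem smoothOnGroup_const {E : Type*} [NormedAddCommGroup E] [NormedSpace ℝ E]
    (k : complexGroup gR) (U : Set E) : SmoothOnGroup (fun _ : E => k) U := fun _ _ =>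
  contDiffOn_const

theorem hasDerivAt_expGroup (g : complexGroup gR) (v : complexified gR) (t : ℝ) (i j : Fin N) :
    HasDerivAt (fun s : ℝ =>
      ((g * expGroup (((s - t : ℝ) : ℂ) • v) * g⁻¹ : complexGroup gR) : (Mat N)ˣ).1 i j)
      ((Ad g v : Mat N) i j) t := by
  have h : HasWeakDerivAt (fun s : ℝ => NormedSpace.exp ((s - t) • (v : Mat N))) (v : Mat N) t := by
    refine HasWeakDerivAt.of_entries fun i j => ?_
    have h := (hasDerivAt_exp_smul_entry (v : Mat N) (t - t) i j).comp_sub_const t t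
    simpa using h
  exact (h.linear (LinearMap.mulRight ℂ (((g⁻¹ : complexGroup gR) : (Mat N)ˣ) : Mat N) ∘ₗ
    LinearMap.mulLeft ℂ ((g : (Mat N)ˣ) : Mat N))) (Matrix.entryLinearMap ℂ ℂ i j)

theorem flagVelocity_expGroup {x : FlagVariety gR} (g : complexGroup gR) (v : complexified gR)
    {t : ℝ} {c : ℝ → FlagVariety gR}
    (h : ∀ s : ℝ, IsTranslate (g * expGroup (((s - t : ℝ) : ℂ) • v) * g⁻¹) x (c s)) :
    FlagVelocity c t (x.vec (Ad g v)) := by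
  have h1 : g * expGroup (((t - t : ℝ) : ℂ) • v) * g⁻¹ = 1 := by
    rw [sub_self, Complex.ofReal_zero, zero_smul, expGroup_zero, mul_one, mul_inv_cancel]
  refine ⟨?_, Set.univ, isOpen_univ, Set.mem_univ t, _, ?_, h1, fun s _ => h s, _,
    hasDerivAt_expGroup g v t, rfl⟩
  · have h2 := h t
    rw [h1] at h2
    exact h2.eq.trans (isTranslate_one x).eq.symm
  · exact ((smoothOnGroup_const g _).mul
      (smoothOnGroup_expGroup (contDiff_id.sub contDiff_const) v)).mul (smoothOnGroup_const _ _)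

theorem dualVelocity_coAd {κ : ℝ → complexGroup gR} (hκ : SmoothOnGroup κ Set.univ)
    {u : complexified gR} (hu : ∀ s, κ s = expGroup ((s : ℂ) • u))
    (ξ η : Module.Dual ℂ (complexified gR)) :
    DualVelocity (fun s : ℝ => coAd (κ s) (ξ + (s : ℂ) • η)) 0 (η + coad u ξ) := by
  have h1 : κ 0 = 1 := by rw [hu, Complex.ofReal_zero, zero_smul, expGroup_zero]
  have hA := hκ.hasWeakDerivAt_Ad_inv isOpen_univ (Set.mem_univ 0) h1 (u := u) (fun i j => by
    have h := hasDerivAt_expGroup 1 u 0 i j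
    rw [Ad_one] at h
    simpa only [sub_zero, one_mul, inv_one, mul_one, hu] using h)
  have hg : HasWeakDerivAt (fun s : ℝ => ξ + (s : ℂ) • η) η 0 := by
    intro ψ
    have h := ((Complex.ofRealCLM.hasDerivAt (x := (0 : ℝ))).mul_const (ψ η)).const_add (ψ ξ)
    simpa using h
  intro y
  have h := hg.apply (hA.apply (HasWeakDerivAt.const y 0)) LinearMap.id
  refine h.congr_deriv ?_
  have e : (Ad (κ 0)⁻¹ : complexified gR →ₗ[ℂ] complexified gR) y = y := by
    rw [h1, inv_one]; exact Ad_one y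
  rw [e]
  simp [coad_apply, -lie_skew]

/-- Every pair of tangent vectors is spanned by a smooth two-parameter family. -/
theorem exists_smoothCotangent {p : CotangentBundle gR} {V W : p.Ambient}
    (hV : V ∈ p.tangentSpace) (hW : W ∈ p.tangentSpace) :
    ∃ (φ : ℝ × ℝ → CotangentBundle gR) (V₁ V₂ : ∀ z, (φ z).Ambient), SmoothCotangent φ ∧
      (∀ z, CotangentVelocity (fun s => φ (s, z.2)) z.1 (V₁ z)) ∧
      (∀ z, CotangentVelocity (fun s => φ (z.1, s)) z.2 (V₂ z)) ∧
      CotangentVelocity (fun s => φ (s, 0)) 0 V ∧ CotangentVelocity (fun s => φ (0, s)) 0 W := by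
  obtain ⟨v, hv⟩ := Submodule.Quotient.mk_surjective _ V.base
  obtain ⟨w, hw⟩ := Submodule.Quotient.mk_surjective _ W.base
  obtain ⟨c, -, hcV⟩ := hV
  obtain ⟨d, -, hdW⟩ := hW
  let k : ℝ × ℝ → complexGroup gR := fun z => expGroup ((z.1 : ℂ) • v) * expGroup ((z.2 : ℂ) • w)
  -- Translation by `exp (s v)` already contributes `ad*_v μ`, so only the remainder of `V.dual` is
  -- added along the fibre. It vanishes on `𝔟_x` by `dual_apply`, so translating it gives genuine
  -- covectors.
  let g : ℝ × ℝ → Module.Dual ℂ (complexified gR) := fun z =>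
    moment p + (z.1 : ℂ) • (V.dual - coad v (moment p)) +
      (z.2 : ℂ) • (W.dual - coad w (moment p))
  have hg : ∀ z, ∀ y ∈ (p.proj.translate (k z)).borel, coAd (k z) (g z) y = 0 := by
    intro z y hy
    have hy' := (FlagVariety.isTranslate (k z) p.proj).mem_iff.mp hy
    rw [coAd_apply]
    simp only [g, LinearMap.add_apply, LinearMap.smul_apply, LinearMap.sub_apply, coad_apply,
      moment_apply_of_mem p hy', hcV.dual_apply hv.symm hy', hdW.dual_apply hw.symm hy', sub_self,
      smul_zero, add_zero]
  let φ : ℝ × ℝ → CotangentBundle gR := fun z =>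
    CotangentBundle.ofDual (p.proj.translate (k z)) (coAd (k z) (g z)) (hg z)
  have hmom : ∀ z, moment (φ z) = coAd (k z) (g z) := fun z => moment_ofDual _ _ _
  have hk : SmoothOnGroup k Set.univ :=
    (smoothOnGroup_expGroup contDiff_fst v).mul (smoothOnGroup_expGroup contDiff_snd w)
  have hgs : ∀ y, ContDiff ℝ ∞ (fun z => moment (φ z) y) := by
    intro y
    have hgw : WeakSmoothOn g Set.univ := by
      intro ψ
      simp only [g, map_add, map_smul, smul_eq_mul]
      exact ((contDiff_const.add ((Complex.ofRealCLM.contDiff.comp contDiff_fst).mul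
        contDiff_const)).add ((Complex.ofRealCLM.contDiff.comp contDiff_snd).mul
        contDiff_const)).contDiffOn
    have h := hgw.apply (hk.inv.weakSmoothOn_Ad.apply (WeakSmoothOn.const y Set.univ))
    have h' := h LinearMap.id
    rw [contDiffOn_univ] at h'
    simp only [hmom]
    exact h'
  have htrans : ∀ z z', IsTranslate (k z' * (k z)⁻¹) (φ z).proj (φ z').proj := fun z z' =>
    (FlagVariety.isTranslate (k z) p.proj).inv.mul (FlagVariety.isTranslate (k z') p.proj)
  have hφ : SmoothCotangent φ := by
    refine ⟨fun z₀ => ⟨Set.univ, isOpen_univ, Set.mem_univ _, fun z => k z * (k z₀)⁻¹,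
      hk.mul (smoothOnGroup_const _ _), fun z _ => htrans z₀ z⟩, hgs⟩
  have hsub : ∀ (s t : ℝ) (u : complexified gR), expGroup ((s : ℂ) • u) =
      expGroup (((s - t : ℝ) : ℂ) • u) * expGroup ((t : ℂ) • u) := by
    intro s t u
    rw [← expGroup_add_smul]
    simp
  have hv₁ : ∀ z, FlagVelocity (fun s => (φ (s, z.2)).proj) z.1
      ((φ z).proj.vec (Ad 1 v)) := by
    intro z
    refine flagVelocity_expGroup 1 v fun s => ?_
    convert htrans z (s, z.2) using 1
    simp only [k]
    rw [hsub s z.1 v]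
    group
  have hv₂ : ∀ z, FlagVelocity (fun s => (φ (z.1, s)).proj) z.2
      ((φ z).proj.vec (Ad (expGroup ((z.1 : ℂ) • v)) w)) := by
    intro z
    refine flagVelocity_expGroup _ w fun s => ?_
    convert htrans z (z.1, s) using 1
    simp only [k]
    rw [hsub s z.2 w]
    group
  have hφ0 : φ (0, 0) = p := by
    have hk0 : k (0, 0) = 1 := by simp [k, expGroup_zero]
    refine CotangentBundle.ext_moment ?_ ?_
    · change p.proj.translate (k (0, 0)) = p.proj
      rw [hk0]
      exact (isTranslate_one p.proj).eq.symm
    · rw [hmom, hk0]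
      ext y
      rw [coAd_apply, inv_one, Ad_one]
      simp [g]
  have hd₁ : ∀ z : ℝ × ℝ, ∃ α, DualVelocity (fun s => moment (φ (s, z.2))) z.1 α := fun z =>
    exists_dualVelocity fun y =>
      ((hgs y).comp (contDiff_id.prodMk contDiff_const)).differentiable (by simp) _
  have hd₂ : ∀ z : ℝ × ℝ, ∃ α, DualVelocity (fun s => moment (φ (z.1, s))) z.2 α := fun z =>
    exists_dualVelocity fun y =>
      ((hgs y).comp (contDiff_const.prodMk contDiff_id)).differentiable (by simp) _
  choose α hα using hd₁
  choose β hβ using hd₂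
  refine ⟨φ, fun z => ⟨_, α z⟩, fun z => ⟨_, β z⟩, hφ, fun z => ⟨rfl, hv₁ z, hα z⟩,
    fun z => ⟨rfl, hv₂ z, hβ z⟩, ⟨hφ0, ?_, ?_⟩, ⟨hφ0, ?_, ?_⟩⟩
  · rw [← hv]
    have h : ∀ q, φ (0, 0) = q →
        FlagVelocity (fun s => (φ (s, 0)).proj) 0 (q.proj.vec (Ad 1 v)) := by
      rintro _ rfl
      exact hv₁ (0, 0)
    have h' := h p hφ0
    rw [Ad_one] at h'
    exact h'
  · have h := dualVelocity_coAd (κ := fun s => k (s, 0)) (u := v)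
      (fun i j => (hk i j).comp (contDiff_id.prodMk contDiff_const).contDiffOn
        (Set.mapsTo_univ _ _))
      (fun s => by simp [k, expGroup_zero]) (moment p) (V.dual - coad v (moment p))
    simpa only [hmom, g, Complex.ofReal_zero, zero_smul, add_zero, sub_add_cancel] using h
  · rw [← hw]
    have h : ∀ q, φ (0, 0) = q → FlagVelocity (fun s => (φ (0, s)).proj) 0
        (q.proj.vec (Ad (expGroup (((0 : ℝ) : ℂ) • v)) w)) := by
      rintro _ rfl
      exact hv₂ (0, 0)
    have h' := h p hφ0
    rw [Complex.ofReal_zero, zero_smul, expGroup_zero, Ad_one] at h'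
    exact h'
  · have h := dualVelocity_coAd (κ := fun s => k (0, s)) (u := w)
      (fun i j => (hk i j).comp (contDiff_const.prodMk contDiff_id).contDiffOn
        (Set.mapsTo_univ _ _))
      (fun s => by simp [k, expGroup_zero]) (moment p) (W.dual - coad w (moment p))
    simpa only [hmom, g, Complex.ofReal_zero, zero_smul, add_zero, sub_add_cancel] using h

/-- All admissible families give the same number, and `exists_smoothCotangent` supplies one, so the
number chosen in the definition is that one. -/
theorem canonicalForm_eq [LieAlgebra.IsKilling ℂ (complexified gR)] {p : CotangentBundle gR}
    {V W : p.Ambient} (hV : V ∈ p.tangentSpace) (hW : W ∈ p.tangentSpace)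
    {v w : complexified gR} (hv : V.base = p.proj.vec v) (hw : W.base = p.proj.vec w) :
    canonicalForm V W = V.dual w - W.dual v + moment p ⁅v, w⁆ := by
  obtain ⟨φ, V₁, V₂, hφ, h₁, h₂, hφV, hφW⟩ := exists_smoothCotangent hV hW
  have h := Classical.epsilon_spec (p := fun c : ℂ =>
    ∀ (φ : ℝ × ℝ → CotangentBundle gR) (V₁ V₂ : ∀ z, (φ z).Ambient), SmoothCotangent φ →
      (∀ z, CotangentVelocity (fun s => φ (s, z.2)) z.1 (V₁ z)) →
      (∀ z, CotangentVelocity (fun s => φ (z.1, s)) z.2 (V₂ z)) →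
      CotangentVelocity (fun s => φ (s, 0)) 0 V →
      CotangentVelocity (fun s => φ (0, s)) 0 W →
      c = deriv (fun s : ℝ => liouville (V₂ (s, 0))) 0 -
        deriv (fun s : ℝ => liouville (V₁ (0, s))) 0)
    ⟨_, fun φ V₁ V₂ hφ h₁ h₂ hφV hφW => (deriv_liouville_sub hv hw hφ h₁ h₂ hφV hφW).symm⟩
  exact (h φ V₁ V₂ hφ h₁ h₂ hφV hφW).trans (deriv_liouville_sub hv hw hφ h₁ h₂ hφV hφW)

end CanonicalForm

/-! ### The differential of the twisted moment map as a coadjoint vector -/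

section Differential

variable {N : ℕ} {gR : LieSubalgebra ℝ (Mat N)}

/-- The differential of the twisted moment map at a tangent vector over `v_x`, with `v ∈ 𝔲_ℝ`. -/
theorem exists_dTwistedMoment_eq_coad (hgR : ∀ x ∈ gR, Complex.I • x ∈ gR → x = 0)
    (C : CartanDecomposition gR) {lam : UniversalWeight gR} (hlam : lam.IsRegular)
    {p : CotangentBundle gR} {V : p.Ambient} (hV : V ∈ p.tangentSpace) {v : complexified gR}
    (hv : v ∈ C.compactForm) (hVv : V.base = p.proj.vec v) :
    ∃ z ∈ p.proj.borel,
      dTwistedMoment C lam V = coad (v + z) (twistedMoment C lam p) ∧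
      (∀ y, twistedMoment C lam p ⁅z, y⁆ = -(V.dual y + moment p ⁅v, y⁆)) ∧
      ∀ y ∈ p.proj.borel, V.dual y = -moment p ⁅v, y⁆ := by
  have hdual : ∀ y ∈ p.proj.borel, V.dual y = -moment p ⁅v, y⁆ := by
    obtain ⟨c, -, hc⟩ := hV
    exact fun y hy => hc.dual_apply hVv hy
  -- The difference `V.dual - ad*_v μ` is the vertical part: it vanishes on `𝔟_x`, hence is tangent
  -- to the orbit through `μ_λ(p)` in a direction `z ∈ perp 𝔟_x`.
  obtain ⟨z, hz, e⟩ := exists_coad_twistedMoment hgR C hlam p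
    (η := V.dual - coad v (moment p)) (fun y hy => by
      rw [LinearMap.sub_apply, hdual y hy, coad_apply, sub_self])
  have e' : ∀ y, twistedMoment C lam p ⁅z, y⁆ = -(V.dual y + moment p ⁅v, y⁆) := by
    intro y
    have h := LinearMap.congr_fun e y
    rw [LinearMap.sub_apply, coad_apply, coad_apply, sub_neg_eq_add] at h
    rw [h, neg_neg]
  refine ⟨z, perp_le p.proj.maximal hz, ?_, e', hdual⟩
  rw [dTwistedMoment_eq hgR C lam hV hv hVv]
  ext y
  rw [LinearMap.add_apply, coad_apply, coad_apply, add_lie, map_add, e', twistedMoment,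
    LinearMap.add_apply]
  ring

end Differential

end TwistedMoment

end

/-! ### The pullback formula -/

theorem mainTheorem4 (N : ℕ) (gR : LieSubalgebra ℝ (TwistedMoment.Mat N))
    [LieAlgebra.IsSemisimple ℝ gR]
    (hgR : ∀ x ∈ gR, Complex.I • x ∈ gR → x = 0)
    (C : TwistedMoment.CartanDecomposition gR)
    (lam : TwistedMoment.UniversalWeight gR) (hlam : lam.IsRegular)
    (p : TwistedMoment.CotangentBundle gR) :
    TwistedMoment.twistedMoment C lam p ∈ TwistedMoment.twistedOrbit C lam ∧
    ∀ V ∈ p.tangentSpace, ∀ W ∈ p.tangentSpace,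
      TwistedMoment.dTwistedMoment C lam V ∈
        TwistedMoment.orbitTangent (TwistedMoment.twistedMoment C lam p) ∧
      TwistedMoment.dTwistedMoment C lam W ∈
        TwistedMoment.orbitTangent (TwistedMoment.twistedMoment C lam p) ∧
      TwistedMoment.kirillovKostant (TwistedMoment.twistedMoment C lam p)
          (TwistedMoment.dTwistedMoment C lam V) (TwistedMoment.dTwistedMoment C lam W) =
        -TwistedMoment.canonicalForm V W + TwistedMoment.tau C lam V.base W.base := by
  refine ⟨TwistedMoment.twistedMoment_mem_twistedOrbit hgR C hlam p, fun V hV W hW => ?_⟩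
  have := (C.compactConj hgR).isKilling
  obtain ⟨v, hv, hVv⟩ := TwistedMoment.exists_compactForm_vec hgR C V.base
  obtain ⟨w, hw, hWw⟩ := TwistedMoment.exists_compactForm_vec hgR C W.base
  obtain ⟨z, hz, eV, hη, hV'⟩ := TwistedMoment.exists_dTwistedMoment_eq_coad hgR C hlam hV hv hVv
  obtain ⟨z', hz', eW, hη', -⟩ := TwistedMoment.exists_dTwistedMoment_eq_coad hgR C hlam hW hw hWw
  refine ⟨⟨_, eV⟩, ⟨_, eW⟩, ?_⟩
  -- The vertical directions are isotropic: `z` pairs with `z'` through `V.dual` and `μ[v, ·]`,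
  -- which cancel on `𝔟_x`.
  have h0 : TwistedMoment.twistedMoment C lam p ⁅z, z'⁆ = 0 := by
    rw [hη, hV' z' hz']; ring
  have h1 := hη w
  have h2 := hη' v
  have s1 : TwistedMoment.twistedMoment C lam p ⁅v, z'⁆ =
      -TwistedMoment.twistedMoment C lam p ⁅z', v⁆ := by rw [← lie_skew, map_neg]
  have s2 : TwistedMoment.moment p ⁅w, v⁆ = -TwistedMoment.moment p ⁅v, w⁆ := by
    rw [← lie_skew, map_neg]
  have h3 : TwistedMoment.twistedMoment C lam p ⁅v, w⁆ =
    TwistedMoment.moment p ⁅v, w⁆ + TwistedMoment.twist C lam p.proj ⁅v, w⁆ := rfl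
  rw [eV, eW, TwistedMoment.kirillovKostant_coad, TwistedMoment.canonicalForm_eq hV hW hVv hWw,
    hVv, hWw, TwistedMoment.tau_vec hgR C lam _ hv hw]
  -- Each of the two mixed terms contributes `-μ[v, w]`, and `μ_λ[v, w]` contributes `+μ[v, w]`; the
  -- net `-μ[v, w]` is the bracket term of `-σ`.
  simp only [add_lie, lie_add, map_add]
  linear_combination h0 + h1 - h2 + s1 + h3 + s2
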